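/- Let $n,r\ge 0$, $k=r(r+1)/2$, and let $\delta_r=(r,r-1,\dots,1)$ be the staircase partition. Let $W_n$ be the group of permutations $w$ of $\{\pm1,\dots,\pm n\}$ with $w(-i)=-w(i)$, and let $\mathfrak S_{2n+k}$ be the symmetric group on the ordered set $$\{-n<\dots<-1<0_1<\dots<0_k<1<\dots<n\}.$$ Let $\iota_r:W_n\to\mathfrak S_{2n+k}$ be the embedding for which $\iota_r(w)$ sends $\pm i$ to $w(\pm i)$ and fixes every $0_j$, and let $W_I\cong\mathfrak S_k$ be the subgroup of $\mathfrak S_{2n+k}$ permuting the $0_j$ and fixing all $\pm i$. For a permutation $\pi$ of a finite totally ordered set, $P(\pi)$ and $Q(\pi)$ are its Robinson–Schensted insertion and recording tableaux, filled with elements of that set. Let $\mathbf c_0$ be the two-sided cell of $W_I$ of shape $\delta_r$, i.e. the set of all $x\in W_I$ (viewed as permutations of $0_1<\dots<0_k$) for which $P(x)$ has shape $\delta_r$. For $w\in W_n$ let $P^r(w)=((\delta_r\leftarrow w(1))\leftarrow\cdots)\leftarrow w(n)$ be the (Barbasch–Vogan/Garfinkle) domino insertion tableau with core $\delta_r$,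 and let $Q^r(w)$ be the domino recording tableau, whose domino $m$ is the difference of the shapes after $m$ and $m-1$ insertions. Here $D\leftarrow \pm i$ ($i>0$) is computed as follows: keep the core and the dominoes of value $<i$; add a domino of value $i$, horizontally at the end of the first row for $+i$, vertically at the end of the first column for $-i$; then treat the dominoes $\mathrm{dom}_j$ of $D$ with $j>i$ in increasing order of $j$, where $\mu$ is the shape built so far: if $\mathrm{dom}_j\cap\mu=\emptyset$, it stays in place; if $\mathrm{dom}_j\cap\mu$ is a single square (row $a$, column $b$), that square is replaced by the square (row $a+1$, column $b+1$); if $\mathrm{dom}_j\subset\mu$, it is moved to the end of the next row when it is horizontal and to the end of the next column when it is vertical. Write $w\simeq_r w'$ if $Q^r(w)=Q^r(w')$. For a domino tableau $D$ with core $\delta_r$ and dominoes $1,\dots,n$, and a standard tableau $Y$ of shape $\delta_r$ in the letters $0_1,\dots,0_k$, let $T_Y(D)$ be the Young tableau in which $\delta_r$ is filled by $Y$ and the domino with value $i$ is replaced by two boxes filled $\bar i$ (the left or upper one) and $i$; it is standard for $0_1<\dots<0_k<\bar1<1<\dots<\bar n<n$. Let $T^{\operatorname{neg}}$ be obtained from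 $T$ by converting $\bar1$ to $-1$, then $\bar2$ to $-2$, …, then $\bar n$ to $-n$ (with $-n<\dots<-1$ smaller than all other letters), where converting a letter $a$ to a smaller letter $b$ means replacing $a$ by $b$ and then repeatedly swapping $b$ with the larger of its upper and left neighbours until the tableau is standard. **Theorem.** Let $x\in\mathbf c_0$. For every $w\in W_n$, with $\pi=\iota_r(w)x\in\mathfrak S_{2n+k}$, $$(T_{P(x)}(P^r(w)))^{\operatorname{neg}}=P(\pi)\qquad\text{and}\qquad (T_{Q(x)}(Q^r(w)))^{\operatorname{neg}}=Q(\pi).$$ Moreover, for all $w,w'\in W_n$: $w\simeq_r w'$ if and only if $Q(\iota_r(w)x)=Q(\iota_r(w')x)$. -/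

import Mathlib

namespace DominoInsertion

/-! ### Letters and fillings -/

/-- Letters of tableaux: the integers `z` (negative letters `-i`, usual letters `i`), the
letters `0_j` (here numbered from `j = 0`), and the barred letters `ī`. -/
inductive Letter : Type
  | num (z : ℤ)
  | zero (j : ℕ)
  | bar (i : ℕ)

/-- Sort key of a letter, encoding the order
`⋯ < -2 < -1 < 0_0 < 0_1 < ⋯ < 1̄ < 1 < 2̄ < 2 < ⋯`. -/
def Letter.key : Letter → ℤ ×ₗ ℤ
  | .num z => if z < 0 then toLex (-1, z) else toLex (1, 2 * z + 1)
  | .zero j => toLex (0, (j : ℤ))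
  | .bar i => toLex (1, 2 * (i : ℤ))

theorem Letter.key_injective : Function.Injective Letter.key := by
  intro a b h
  rcases a with a | a | a <;> rcases b with b | b | b <;>
    simp only [Letter.key] at h <;> (try split_ifs at h) <;>
    simp only [toLex_inj, Prod.mk.injEq] at h <;>
    first
      | (exfalso; omega)
      | (congr 1; omega)

instance : LinearOrder Letter := LinearOrder.lift' Letter.key Letter.key_injective

/-- A filling of some of the squares `(row, column)` (both numbered from `0`) of the quadrant;
the value `⊥` means that the square is empty (does not belong to the shape). -/
abbrev Filling (α : Type) := ℕ × ℕ → WithBot α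

/-- Apply a map to all the letters of a filling. -/
def Filling.map {α β : Type} (f : α → β) (T : Filling α) : Filling β :=
  fun c => WithBot.map f (T c)

/-! ### The Robinson–Schensted correspondence -/

section RS

variable {α : Type} [LinearOrder α]

/-- Insert `a` in a row: `a` replaces the leftmost entry larger than `a` (which is returned),
or is put at the end of the row if there is no such entry. -/
def rowInsert (a : α) : List α → List α × Option α
  | [] => ([a], none)
  | b :: R => if a < b then (a :: R, some b) else (b :: (rowInsert a R).1, (rowInsert a R).2)

/-- Schensted insertion of a letter into a tableau, given as the list of its rows. -/
def schenstedInsert (a : α) : List (List α) → List (List α)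
  | [] => [[a]]
  | R :: Rs =>
    match rowInsert a R with
    | (R', none) => R' :: Rs
    | (R', some b) => R' :: schenstedInsert b Rs

/-- The filling attached to a list of rows. -/
def fillingOfRows (Rs : List (List α)) : Filling α :=
  fun c => ((Rs[c.1]?).bind fun R => R[c.2]?).elim ⊥ (fun a => (a : WithBot α))

/-- The Schensted insertion tableau of a word. -/
def schensted (u : List α) : Filling α :=
  fillingOfRows (u.foldl (fun Rs a => schenstedInsert a Rs) [])

variable [Fintype α]

/-- The elements of a finite totally ordered set, in increasing order. -/
def increasingList (α : Type) [LinearOrder α] [Fintype α] : List α :=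
  (Finset.univ : Finset α).sort (· ≤ ·)

/-- The Robinson–Schensted insertion tableau `P(π)` of a permutation of a finite totally
ordered set: the insertion tableau of the word of values of `π`. -/
def rsP (π : Equiv.Perm α) : Filling α := schensted ((increasingList α).map π)

/-- The Robinson–Schensted recording tableau `Q(π)`: a square is labelled by the first
position `a` such that the square is occupied after the insertion of the letters in
positions `≤ a`. -/
def rsQ (π : Equiv.Perm α) : Filling α := fun c =>
  ((increasingList α).find? fun a =>
    decide (schensted (((increasingList α).filter (· ≤ a)).map π) c ≠ ⊥)).elim
      ⊥ (fun a => (a : WithBot α))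

/-- `π ≃_𝔖 π'`: the two permutations have the same recording tableau. -/
def RSEquiv (π π' : Equiv.Perm α) : Prop := rsQ π = rsQ π'

end RS

/-! ### The hyperoctahedral group and its embedding in a symmetric group -/

/-- The set `{-n, …, -1} ∪ {1, …, n}`. -/
abbrev Signed (n : ℕ) : Type := {z : ℤ // z ≠ 0 ∧ z.natAbs ≤ n}

noncomputable instance (n : ℕ) : Fintype (Signed n) :=
  Fintype.subtype ((Finset.Icc (-(n : ℤ)) n).erase 0) (by
    intro z
    simp only [Finset.mem_erase, Finset.mem_Icc]
    omega)

/-- The element `-i` of `{-n, …, -1} ∪ {1, …, n}`. -/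
def Signed.opp {n : ℕ} (i : Signed n) : Signed n :=
  ⟨-(i : ℤ), by have h := i.2; omega⟩

/-- The hyperoctahedral group `W_n`: permutations `w` of `{±1, …, ±n}` with
`w(-i) = -w(i)`. -/
def W (n : ℕ) : Subgroup (Equiv.Perm (Signed n)) where
  carrier := {w | ∀ i, w i.opp = (w i).opp}
  mul_mem' := by
    intro a b ha hb i
    simp only [Set.mem_ofPred_eq] at ha hb
    simp [Equiv.Perm.mul_apply, hb, ha]
  one_mem' := by intro i; rfl
  inv_mem' := by
    intro a ha i
    simp only [Set.mem_ofPred_eq] at ha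
    rw [Equiv.Perm.inv_eq_iff_eq, ha]
    simp

/-- The element `i + 1` of `{±1, …, ±n}`, for `0 ≤ i < n`. -/
def posPoint {n : ℕ} (i : Fin n) : Signed n :=
  ⟨(i : ℤ) + 1, by omega⟩

/-- The one-line notation `w(1) w(2) ⋯ w(n)`. -/
def oneLine {n : ℕ} (w : W n) : List ℤ :=
  List.ofFn fun i : Fin n => ((w.1 (posPoint i) : Signed n) : ℤ)

/-- The set `{-n < ⋯ < -1 < 0_1 < ⋯ < 0_k < 1 < ⋯ < n}` (the `0_j` numbered from `0`). -/
def Points (n k : ℕ) : Type := Signed n ⊕ Fin k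

/-- The letter corresponding to a point. -/
def Points.letter {n k : ℕ} : Points n k → Letter
  | .inl z => .num z
  | .inr j => .zero j

theorem Points.letter_injective {n k : ℕ} :
    Function.Injective (Points.letter : Points n k → Letter) := by
  intro a b h
  rcases a with a | a <;> rcases b with b | b <;> simp only [Points.letter] at h
  · injection h with h
    exact congrArg Sum.inl (Subtype.ext h)
  · cases h
  · cases h
  · injection h with h
    exact congrArg Sum.inr (Fin.ext h)

instance (n k : ℕ) : LinearOrder (Points n k) :=
  LinearOrder.lift' Points.letter Points.letter_injective

noncomputable instance (n k : ℕ) : Fintype (Points n k) :=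
  instFintypeSum (Signed n) (Fin k)

/-- The number `r(r+1)/2` of squares of the staircase `δ_r`. -/
abbrev coreSize (r : ℕ) : ℕ := r * (r + 1) / 2

/-- The embedding `ι_r` of `W_n` in the symmetric group on
`{-n < ⋯ < -1 < 0_1 < ⋯ < 0_{r(r+1)/2} < 1 < ⋯ < n}`: the element `ι_r(w)` sends `±i` to
`w(±i)` and fixes all the `0_j`. -/
def iota {n : ℕ} (r : ℕ) : W n →* Equiv.Perm (Points n (coreSize r)) :=
  (Equiv.Perm.sumCongrHom (Signed n) (Fin (coreSize r))).comp
    ((MonoidHom.inl _ _).comp (W n).subtype)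

/-- The inclusion of `W_I`, the symmetric group on the `0_j`, in the symmetric group on
`{-n < ⋯ < -1 < 0_1 < ⋯ < 0_k < 1 < ⋯ < n}`. -/
def inclI (n : ℕ) {k : ℕ} : Equiv.Perm (Fin k) →* Equiv.Perm (Points n k) :=
  (Equiv.Perm.sumCongrHom (Signed n) (Fin k)).comp (MonoidHom.inr _ _)

/-! ### Domino insertion -/

/-- The squares of the staircase partition `δ_r = (r, r-1, …, 0)`. -/
def staircase (r : ℕ) : Finset (ℕ × ℕ) :=
  (Finset.range r ×ˢ Finset.range r).filter fun c => c.1 + c.2 < r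

/-- The two-sided cell of shape `δ_r` of the symmetric group of degree `r(r+1)/2`: the
permutations whose Robinson–Schensted tableaux have shape `δ_r`. -/
def cellZero (r : ℕ) : Set (Equiv.Perm (Fin (coreSize r))) :=
  {x | ∀ c, rsP x c ≠ ⊥ ↔ c ∈ staircase r}

/-- The dominoes of an (injective) domino tableau: `D i` is the set of the two squares of the
domino `dom_i` with value `i`, and `D i = ∅` if the value `i` does not occur. -/
abbrev Dominoes := ℕ → Finset (ℕ × ℕ)

/-- The shape of the part of a domino tableau with core `κ` formed by the core and the
dominoes with values `≤ N`. -/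
def shapeUpTo (κ : Finset (ℕ × ℕ)) (N : ℕ) (D : Dominoes) : Finset (ℕ × ℕ) :=
  κ ∪ (Finset.range (N + 1)).biUnion D

/-- The horizontal domino that extends row `a` of the shape `μ`. -/
def horizontalAt (μ : Finset (ℕ × ℕ)) (a : ℕ) : Finset (ℕ × ℕ) :=
  let l := (μ.filter fun c => c.1 = a).card
  {(a, l), (a, l + 1)}

/-- The vertical domino that extends column `b` of the shape `μ`. -/
def verticalAt (μ : Finset (ℕ × ℕ)) (b : ℕ) : Finset (ℕ × ℕ) :=
  let l := (μ.filter fun c => c.2 = b).card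
  {(l, b), (l + 1, b)}

/-- The new place of a domino `d` of the old tableau, when the dominoes with smaller values
and the core now occupy the shape `μ`.
* If `d` does not meet `μ` (or there is no domino, `d = ∅`), it stays in place.
* If `d ⊆ μ` is horizontal (vertical), it is bumped to the end of the next row (column).
* If `d` meets `μ` in one square `(k, l)`, then `d` is replaced by the domino
  `(d ∖ {(k, l)}) ∪ {(k + 1, l + 1)}`. -/
def bump (μ d : Finset (ℕ × ℕ)) : Finset (ℕ × ℕ) :=
  if d ∩ μ = ∅ then d
  else if d ⊆ μ then
    (d.filter fun c => (c.1, c.2 + 1) ∈ d).biUnion (fun c => horizontalAt μ (c.1 + 1)) ∪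
      (d.filter fun c => (c.1 + 1, c.2) ∈ d).biUnion (fun c => verticalAt μ (c.2 + 1))
  else (d \ μ) ∪ (d ∩ μ).image fun c => (c.1 + 1, c.2 + 1)

/-- `insertUpTo κ D z j` is the tableau `E_{≤ j}` in the insertion `E = D ← z` (core `κ`).
With `i = |z|`, the dominoes with values `< i` are kept; then a domino with value `i` is
added, horizontal in the first row if `z > 0` and vertical in the first column if `z < 0`;
then the dominoes with values `> i` are treated one after the other by `bump`. -/
def insertUpTo (κ : Finset (ℕ × ℕ)) (D : Dominoes) (z : ℤ) : ℕ → Dominoes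
  | 0 => fun _ => ∅
  | j + 1 =>
    let E := insertUpTo κ D z j
    let μ := shapeUpTo κ j E
    Function.update E (j + 1)
      (if j + 1 < z.natAbs then D (j + 1)
      else if j + 1 = z.natAbs then
        (if 0 < z then horizontalAt μ 0 else verticalAt μ 0)
      else bump μ (D (j + 1)))

/-- The domino insertion `E = D ← z`, the limit of the `E_{≤ j}`. -/
def dominoInsert (κ : Finset (ℕ × ℕ)) (D : Dominoes) (z : ℤ) : Dominoes :=
  fun j => insertUpTo κ D z j j

/-- Successive domino insertion of the letters of a word in the core `κ`. -/
def dominoInsertWord (κ : Finset (ℕ × ℕ)) (u : List ℤ) : Dominoes :=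
  u.foldl (dominoInsert κ) (fun _ => ∅)

/-- The domino insertion tableau `P^r(w)`. -/
def dominoP {n : ℕ} (r : ℕ) (w : W n) : Dominoes :=
  dominoInsertWord (staircase r) (oneLine w)

/-- The domino recording tableau `Q^r(w)`: the domino with value `m` is the difference of the
shapes after `m` and after `m - 1` insertions. -/
def dominoQ {n : ℕ} (r : ℕ) (w : W n) : Dominoes := fun m =>
  shapeUpTo (staircase r) n (dominoInsertWord (staircase r) ((oneLine w).take m)) \
    shapeUpTo (staircase r) n (dominoInsertWord (staircase r) ((oneLine w).take (m - 1)))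

/-- `w ≃_r w'`: the two elements of `W_n` have the same domino recording tableau. -/
def DominoEquiv {n : ℕ} (r : ℕ) (w w' : W n) : Prop := dominoQ r w = dominoQ r w'

/-! ### From domino tableaux to Young tableaux -/

/-- The tableau `T_Y(D)` for a domino tableau `D` with values in `{1, …, n}`: the upper or left
square of the domino with value `i` receives `ī`, its other square receives `i`, and the
squares that are in no domino are filled as in `Y`. -/
def youngOfDomino (n : ℕ) (Y : Filling Letter) (D : Dominoes) : Filling Letter := fun c =>
  match (List.range (n + 1)).find? (fun i => decide (c ∈ D i)) with
  | none => Y c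
  | some i =>
    if (c.1 + 1, c.2) ∈ D i ∨ (c.1, c.2 + 1) ∈ D i then (Letter.bar i : WithBot Letter)
    else (Letter.num i : WithBot Letter)

/-- The entry above the square `c` (`⊥` if there is none). -/
def entryAbove {α : Type} (T : Filling α) : ℕ × ℕ → WithBot α
  | (0, _) => ⊥
  | (a + 1, b) => T (a, b)

/-- The entry to the left of the square `c` (`⊥` if there is none). -/
def entryLeft {α : Type} (T : Filling α) : ℕ × ℕ → WithBot α
  | (_, 0) => ⊥
  | (a, b + 1) => T (a, b)

/-- One step of the conversion process. In a filling with a distinguished square `c`, if the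
entry of `c` is smaller than the one above it or the one to its left, it is swapped with the
larger of these two neighbours (and `c` becomes the new place of that entry); otherwise
nothing is changed. -/
def swapStep {α : Type} [LinearOrder α] (s : Filling α × (ℕ × ℕ)) : Filling α × (ℕ × ℕ) :=
  let T := s.1
  let c := s.2
  let u := entryAbove T c
  let l := entryLeft T c
  if max u l ≤ T c then s
  else if l < u then
    (Function.update (Function.update T c u) (c.1 - 1, c.2) (T c), (c.1 - 1, c.2))
  else
    (Function.update (Function.update T c l) (c.1, c.2 - 1) (T c), (c.1, c.2 - 1))

/-- The tableau obtained by putting the letter `b` in the square `c` of `T` and swapping it with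
its neighbours (above or to the left) until the tableau is standard. Every swap lowers
`row + column` by one, so `c.1 + c.2` steps are enough. -/
def replaceAndSwap {α : Type} [LinearOrder α] (T : Filling α) (c : ℕ × ℕ) (b : α) : Filling α :=
  ((swapStep^[c.1 + c.2]) (Function.update T c (b : WithBot α), c)).1

open Classical in
/-- Conversion of the letter `a` of the tableau `T` to a smaller letter `b`. -/
noncomputable def convertLetter {α : Type} [LinearOrder α] (T : Filling α) (a b : α) :
    Filling α :=
  if h : ∃ c, T c = (a : WithBot α) then replaceAndSwap T h.choose b else T

/-- The operation `T ↦ T^neg` on tableaux whose barred letters are among `1̄, …, n̄`: convert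
`1̄` to `-1`, then `2̄` to `-2`, …, then `n̄` to `-n`. -/
noncomputable def negTableau : ℕ → Filling Letter → Filling Letter
  | 0, T => T
  | n + 1, T => convertLetter (negTableau n T) (.bar (n + 1)) (.num (-((n : ℤ) + 1)))

/-- The letter `0_j` attached to an element of `{0, …, k-1}`. -/
def zeroLetter {k : ℕ} (j : Fin k) : Letter := .zero j

end DominoInsertion

namespace DominoInsertion

/-! ### Local rules for shapes -/

/-! A permutation is a finite set of points with two linear orders, position and value. To every
subset of points belongs the Robinson–Schensted shape of the corresponding subword, and the proof
works with the way these shapes grow when extreme points are added. For the last point and the point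
of largest value the growth is the row rule of Schensted insertion (`rowGrowth_rsShape`). This rule
is symmetric in positions and values. A consistency check on a three-dimensional cube (`cube_rules`)
derives from it the column rule (first point, largest value) and the jeu de taquin rule (first and
last point), see `RowGrowth.jdt_col_aux`. Thus inversion and reversal are available from the local
rules alone.

For `π = ι_r(w)x`, let the window `(i, m)` consist of the points with absolute position at most `m`
and absolute value at most `i`. If `i = 0` or `m = 0`, only the `0_j` remain, and the shape is `δ_r`
because `x` lies in the cell. Enlarging a window by one in either direction adds either no point or
a pair of opposite points, and such a pair adds a domino (`windowShape_dominoes`). When both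
directions bring in different pairs, the four points are extreme in the four directions, and the
local rules on a four-dimensional cube force exactly the bumping rule for dominoes
(`RowGrowth.frame_bump`). When the two pairs coincide, a domino appears at the end of the first row
or column. Hence domino insertion computes the window shapes (`insertUpTo_window`): `P^r(w)` records
the windows `(i, n)` and `Q^r(w)` the windows `(n, m)`.

A tableau is a chain of shapes (`IsTab`): `P(π)` belongs to the chain of points ordered by value,
`Q(π)` to the chain ordered by position. Converting a barred letter into a new smallest letter
carries out, along such a chain, the jeu de taquin rule for adding a smallest point
(`IsTab.convert`). So after `j` conversions the inner part of the domino tableau has become the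
tableau of the `j`-th window (`DominoChain.exists_negTableau`), and both identities follow since a
chain has only one tableau (`IsTab.unique`).

For fixed `x`, the second identity shows that `Q^r(w)` determines `Q(π)`. Conversely, the jeu de
taquin rule can be undone (`JdtRule.unique`), so stripping outermost points from `Q(π)` recovers the
window shapes and with them `Q^r(w)`. -/

/-- The rule of Schensted row insertion for the shapes around a unit square: `B` and `C` are
obtained from `A` by adding a square each; if these two squares differ then `D` is the union of
`B` and `C`, and otherwise `D` has one more square, in the next row. -/
def RowRule (A B C D : Set (ℕ × ℕ)) : Prop :=
  ∃ p q, p ∉ A ∧ q ∉ A ∧ B = insert p A ∧ C = insert q A ∧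
    ((p ≠ q ∧ D = insert p (insert q A)) ∨
      (p = q ∧ ∃ y, (p.1 + 1, y) ∉ B ∧ D = insert (p.1 + 1, y) B))

/-- The transposed form of `RowRule`. -/
def ColRule (A B C D : Set (ℕ × ℕ)) : Prop :=
  ∃ p q, p ∉ A ∧ q ∉ A ∧ B = insert p A ∧ C = insert q A ∧
    ((p ≠ q ∧ D = insert p (insert q A)) ∨
      (p = q ∧ ∃ x, (x, p.2 + 1) ∉ B ∧ D = insert (x, p.2 + 1) B))

/-- The rule of jeu de taquin for the shapes around a unit square. -/
def JdtRule (A B C D : Set (ℕ × ℕ)) : Prop :=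
  ∃ p q, p ∉ A ∧ q ∉ A ∧ B = insert p A ∧ C = insert q A ∧
    ((p ≠ q ∧ D = insert p (insert q A)) ∨
      (p = q ∧ ∃ e, (e = (p.1 + 1, p.2) ∨ e = (p.1, p.2 + 1)) ∧ D = insert e B))

/-- Shapes: a set of squares closed under moving up or to the left. -/
def IsShape (A : Set (ℕ × ℕ)) : Prop :=
  ∀ a b a' b', (a, b) ∈ A → a' ≤ a → b' ≤ b → (a', b') ∈ A

theorem IsShape.transpose {A : Set (ℕ × ℕ)} (h : IsShape A) : IsShape (Prod.swap ⁻¹' A) :=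
  fun a b a' b' hm ha hb => h b a b' a' hm hb ha

theorem RowRule.symm {A B C D : Set (ℕ × ℕ)} (h : RowRule A B C D) : RowRule A C B D := by
  obtain ⟨p, q, hp, hq, rfl, rfl, ⟨hne, rfl⟩ | ⟨rfl, h⟩⟩ := h
  · exact ⟨q, p, hq, hp, rfl, rfl, Or.inl ⟨hne.symm, Set.insert_comm _ _ _⟩⟩
  · exact ⟨p, p, hp, hp, rfl, rfl, Or.inr ⟨rfl, h⟩⟩

theorem preimage_swap_insert (p : ℕ × ℕ) (A : Set (ℕ × ℕ)) :
    Prod.swap ⁻¹' (insert p A) = insert p.swap (Prod.swap ⁻¹' A) := by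
  ext ⟨a, b⟩
  simp [Prod.ext_iff, and_comm]

theorem ColRule.transpose {A B C D : Set (ℕ × ℕ)} (h : ColRule A B C D) :
    RowRule (Prod.swap ⁻¹' A) (Prod.swap ⁻¹' B) (Prod.swap ⁻¹' C) (Prod.swap ⁻¹' D) := by
  obtain ⟨p, q, hp, hq, rfl, rfl, ⟨hne, rfl⟩ | ⟨rfl, x, hx, rfl⟩⟩ := h
  · refine ⟨p.swap, q.swap, by simpa using hp, by simpa using hq, preimage_swap_insert _ _,
      preimage_swap_insert _ _, Or.inl ⟨fun e => hne (Prod.swap_injective e), ?_⟩⟩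
    simp [preimage_swap_insert]
  · refine ⟨p.swap, p.swap, by simpa using hp, by simpa using hp, preimage_swap_insert _ _,
      preimage_swap_insert _ _, Or.inr ⟨rfl, x, ?_, ?_⟩⟩
    · exact hx
    · simp [preimage_swap_insert]

theorem RowRule.transpose {A B C D : Set (ℕ × ℕ)}
    (h : RowRule (Prod.swap ⁻¹' A) (Prod.swap ⁻¹' B) (Prod.swap ⁻¹' C) (Prod.swap ⁻¹' D)) :
    ColRule A B C D := by
  obtain ⟨p, q, hp, hq, h1, h2, h3⟩ := h
  have e : ∀ {X Y : Set (ℕ × ℕ)}, Prod.swap ⁻¹' X = Y → X = Prod.swap ⁻¹' Y := by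
    rintro X Y rfl; rfl
  refine ⟨p.swap, q.swap, hp, hq, ?_, ?_, ?_⟩
  · rw [e h1, preimage_swap_insert]; rfl
  · rw [e h2, preimage_swap_insert]; rfl
  · rcases h3 with ⟨hne, h3⟩ | ⟨rfl, y, hy, h3⟩
    · refine Or.inl ⟨fun e => hne (Prod.swap_injective e), ?_⟩
      rw [e h3, preimage_swap_insert, preimage_swap_insert]; rfl
    · refine Or.inr ⟨rfl, y, hy, ?_⟩
      rw [e h3, preimage_swap_insert]; rfl

/-- Two squares of the same row that can be added to a shape are equal. -/
theorem eq_of_same_row {A : Set (ℕ × ℕ)} {a b c : ℕ} (hb : (a, b) ∉ A) (hc : (a, c) ∉ A)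
    (h1 : IsShape (insert (a, b) A)) (h2 : IsShape (insert (a, c) A)) : b = c := by
  rcases lt_trichotomy b c with h | h | h
  · have := h2 a c a b (Set.mem_insert _ _) le_rfl h.le
    simp only [Set.mem_insert_iff, Prod.mk.injEq, hb, or_false] at this
    exact this.2
  · exact h
  · have := h1 a b a c (Set.mem_insert _ _) le_rfl h.le
    simp only [Set.mem_insert_iff, Prod.mk.injEq, hc, or_false] at this
    exact this.2.symm

theorem eq_of_same_col {A : Set (ℕ × ℕ)} {a b c : ℕ} (hb : (b, a) ∉ A) (hc : (c, a) ∉ A)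
    (h1 : IsShape (insert (b, a) A)) (h2 : IsShape (insert (c, a) A)) : b = c := by
  refine eq_of_same_row (A := Prod.swap ⁻¹' A) (a := a) hb hc ?_ ?_
  · simpa [preimage_swap_insert] using h1.transpose
  · simpa [preimage_swap_insert] using h2.transpose

/-- Compatibility of the row rule, the column rule and the jeu de taquin rule on a cube. -/
theorem cube_rules {A L R T LR LT RT U : Set (ℕ × ℕ)}
    (hA : IsShape A) (hL : IsShape L) (hR : IsShape R) (hT : IsShape T) (hLR : IsShape LR)
    (hLT : IsShape LT) (hRT : IsShape RT) (hU : IsShape U)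
    (h1 : JdtRule A L R LR) (h2 : RowRule A R T RT) (h3 : ColRule A L T LT)
    (h4 : RowRule L LR LT U) :
    ColRule R LR RT U ∧ JdtRule T LT RT U := by
  obtain ⟨l, r, hl, hr, rfl, rfl, h1⟩ := h1
  obtain ⟨r', t, -, ht, er, rfl, h2⟩ := h2
  obtain ⟨l', t', -, -, el, et, h3⟩ := h3
  have inj : ∀ {u v : ℕ × ℕ}, u ∉ A → insert u A = insert v A → u = v := by
    intro u v hu e
    have : u ∈ insert v A := e ▸ Set.mem_insert u A
    simpa [hu] using this
  obtain rfl := inj hr er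
  obtain rfl := inj hl el
  obtain rfl := inj ht et
  obtain ⟨u, v, hu, hv, eu, ev, h4⟩ := h4
  clear er el et
  have inj2 : ∀ {X : Set (ℕ × ℕ)} {u v : ℕ × ℕ}, u ∉ X → insert v X = insert u X → u = v := by
    intro X u v hu e
    have : u ∈ insert v X := e ▸ Set.mem_insert u X
    simpa [hu] using this
  have down : ∀ {X : Set (ℕ × ℕ)} {p q : ℕ × ℕ}, IsShape X → p ∈ X → q.1 ≤ p.1 → q.2 ≤ p.2 →
    q ∈ X := fun hX hp h1 h2 => hX _ _ _ _ hp h1 h2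
  -- The cases are the possible coincidences among the squares `l`, `r`, `t` added to `A` by the
  -- three directions.
  by_cases hlr : l = r
  · subst hlr
    obtain ⟨hne, -⟩ | ⟨-, e, he, rfl⟩ := h1
    · exact absurd rfl hne
    have heA : e ∉ insert l A := by
      rintro (h | h)
      · rcases he with rfl | rfl <;> simp [Prod.ext_iff] at h
      · exact hl (down hA h (by rcases he with rfl | rfl <;> simp)
          (by rcases he with rfl | rfl <;> simp))
    obtain rfl := inj2 hu eu
    by_cases hlt : l = t
    · subst hlt
      obtain ⟨hne, -⟩ | ⟨-, y, hy, rfl⟩ := h2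
      · exact absurd rfl hne
      obtain ⟨hne, -⟩ | ⟨-, x, hx, rfl⟩ := h3
      · exact absurd rfl hne
      obtain rfl := inj2 hv ev
      obtain ⟨a, b⟩ := l
      have hyb : y ≤ b := by
        by_contra hyb
        have h : (a + 1, b) ∈ insert (a + 1, y) (insert (a, b) A) :=
          hRT _ _ _ _ (Set.mem_insert _ _) le_rfl (by omega)
        simp only [Set.mem_insert_iff, Prod.mk.injEq] at h
        have : (a + 1, b) ∉ A := fun h => hl (hA _ _ _ _ h (by omega) le_rfl)
        grind
      -- All three squares coincide. If the slide goes down, the row bump must land on `e`; if it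
      -- goes right, the column bump must.
      rcases he with rfl | rfl
      · obtain rfl := eq_of_same_row hu hy hLR hRT
        have hne : ((a + 1, b) : ℕ × ℕ) ≠ (x, b + 1) := by simp
        have hU : U = insert (a + 1, b) (insert (x, b + 1) (insert (a, b) A)) := by
          rcases h4 with ⟨-, h⟩ | ⟨h, -⟩
          · exact h
          · exact absurd h hne
        exact ⟨⟨_, _, hu, hu, rfl, rfl, Or.inr ⟨rfl, x, by simpa using hx, by
          rw [hU, Set.insert_comm]⟩⟩, ⟨_, _, hv, hu, rfl, rfl, Or.inl ⟨hne.symm, by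
          rw [hU, Set.insert_comm]⟩⟩⟩
      · obtain rfl := eq_of_same_col hv hu hLT hLR
        obtain ⟨hne, -⟩ | ⟨-, y', hy', rfl⟩ := h4
        · exact absurd rfl hne
        have hyy : y' = y := by
          rcases lt_trichotomy y' y with h | h | h
          · have := hRT _ _ (x + 1) y' (Set.mem_insert _ _) le_rfl h.le
            grind
          · exact h
          · have := hU _ _ (x + 1) y (Set.mem_insert _ _) le_rfl h.le
            grind
        subst hyy
        have hne : ((x, b + 1) : ℕ × ℕ) ≠ (x + 1, y') := by simp
        exact ⟨⟨_, _, hu, hy, rfl, rfl, Or.inl ⟨hne, by rw [Set.insert_comm]⟩⟩,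
          ⟨_, _, hu, hy, rfl, rfl, Or.inl ⟨hne, by rw [Set.insert_comm]⟩⟩⟩
    · obtain ⟨-, rfl⟩ | ⟨h, -⟩ := h2
      swap
      · exact absurd h hlt
      obtain ⟨-, rfl⟩ | ⟨h, -⟩ := h3
      swap
      · exact absurd h hlt
      have hvt : v = t := inj2 hv (by rw [← ev, Set.insert_comm])
      subst hvt
      -- The square `t` can be added to `A` on its own, whereas `u` is adjacent to `l` and needs `l`
      -- to be present.
      have hne : u ≠ v := by
        rintro rfl
        have : l ∈ insert u A := down hT (Set.mem_insert _ _)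
          (by rcases he with rfl | rfl <;> simp) (by rcases he with rfl | rfl <;> simp)
        rcases this with h | h
        · exact hlt h
        · exact hl h
      have hU : U = insert u (insert v (insert l A)) := by
        rcases h4 with ⟨-, h⟩ | ⟨h, -⟩
        · exact h
        · exact absurd h hne
      have hlv : l ∉ insert v A := by simp [hl, hlt]
      exact ⟨⟨u, v, hu, hv, rfl, Set.insert_comm _ _ _, Or.inl ⟨hne, hU⟩⟩,
        ⟨l, l, hlv, hlv, rfl, rfl, Or.inr ⟨rfl, u, he, by rw [hU, Set.insert_comm l v]⟩⟩⟩
  · obtain ⟨-, rfl⟩ | ⟨h, -⟩ := h1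
    swap
    · exact absurd h hlr
    have hur : u = r := inj2 hu (by rw [← eu, Set.insert_comm])
    subst hur
    have hlu : l ∉ insert u A := by simp [hl, hlr]
    by_cases hlt : l = t
    · subst hlt
      obtain ⟨-, rfl⟩ | ⟨h, -⟩ := h2
      swap
      · exact absurd h.symm hlr
      obtain ⟨hne, -⟩ | ⟨-, x, hx, rfl⟩ := h3
      · exact absurd rfl hne
      obtain rfl := inj2 hv ev
      -- The square into which the column rule bumps may be the one of `r`. Then `U` is completed by
      -- a row bump, which has to land directly below it, and the jeu de taquin rule holds in its
      -- second form.
      by_cases hvu : u = (x, l.2 + 1)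
      · subst hvu
        obtain ⟨hne, -⟩ | ⟨-, y, hy, rfl⟩ := h4
        · exact absurd rfl hne
        obtain ⟨a, b⟩ := l
        simp only at hr hv hx hy hU hR hRT hLT hLR hu hlr hlu ⊢
        have hxb : (x, b) ∈ A := by
          have := hR _ _ x b (Set.mem_insert _ _) le_rfl (by omega)
          simpa using this
        have hxa : x < a := by
          by_contra h
          exact hl (hA _ _ _ _ hxb (by omega) le_rfl)
        have hyb : y = b + 1 := by
          rcases lt_trichotomy y (b + 1) with h | h | h
          · exact absurd (hL _ _ (x + 1) y (Set.mem_insert _ _) (by omega) (by omega))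
              (by grind)
          · exact h
          · have h1 := hU _ _ (x + 1) (b + 1) (Set.mem_insert _ _) le_rfl h.le
            have h2 : (x + 1, b + 1) ∉ A := fun h => hr (hA _ _ _ _ h (by omega) le_rfl)
            grind
        subst hyb
        exact ⟨⟨_, _, hlu, hlu, rfl, Set.insert_comm _ _ _,
          Or.inr ⟨rfl, x + 1, hy, rfl⟩⟩,
          ⟨_, _, hu, hu, rfl, rfl, Or.inr ⟨rfl, _, Or.inl rfl, by grind⟩⟩⟩
      · have hU' : U = insert u (insert (x, l.2 + 1) (insert l A)) := by
          rcases h4 with ⟨-, h⟩ | ⟨h, -⟩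
          · exact h
          · exact absurd h hvu
        refine ⟨⟨_, _, hlu, hlu, rfl, Set.insert_comm _ _ _,
          Or.inr ⟨rfl, x, ?_, ?_⟩⟩,
          ⟨_, _, hv, hu, rfl, rfl, Or.inl ⟨fun h => hvu h.symm, ?_⟩⟩⟩
        · grind
        · grind
        · grind
    · obtain ⟨-, rfl⟩ | ⟨h, -⟩ := h3
      swap
      · exact absurd h hlt
      have hvt : v = t := inj2 hv (by rw [← ev, Set.insert_comm])
      subst hvt
      have hlv : l ∉ insert v A := by simp [hl, hlt]
      by_cases huv : u = v
      · subst huv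
        obtain ⟨hne, -⟩ | ⟨-, y, hy, rfl⟩ := h2
        · exact absurd rfl hne
        obtain ⟨hne, -⟩ | ⟨-, y', hy', rfl⟩ := h4
        · exact absurd rfl hne
        obtain ⟨a, b⟩ := u
        simp only at hr hv hy hy' hU hR hRT hLT hLR hu hlr hlu ⊢
        have hle : y ≤ y' := by
          by_contra h
          have := hRT _ _ (a + 1) y' (Set.mem_insert _ _) le_rfl (by omega)
          grind
        -- The only interference left is that the row bump over `A` lands on `l`; after adding `l`
        -- it then moves one step to the right.
        by_cases hly : l = (a + 1, y)
        · subst hly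
          have hyy : y' = y + 1 := by
            by_contra hne
            have h1 : y ≠ y' := by rintro rfl; simp at hy'
            have h2 := hU _ _ (a + 1) (y + 1) (Set.mem_insert _ _) le_rfl (by omega)
            have h3 : (a + 1, y + 1) ∉ A := fun h => hl (hA _ _ _ _ h le_rfl (by omega))
            grind
          subst hyy
          exact ⟨⟨_, _, hlu, hlu, rfl, rfl, Or.inr ⟨rfl, a + 1,
              hy', rfl⟩⟩,
            ⟨_, _, hlu, hlu, rfl, rfl, Or.inr ⟨rfl, _, Or.inr rfl, rfl⟩⟩⟩
        · have hyy : y' = y := by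
            by_contra hne
            have h2 := hU _ _ (a + 1) y (Set.mem_insert _ _) le_rfl hle
            grind
          subst hyy
          exact ⟨⟨l, _, hlu, hy, rfl, rfl, Or.inl ⟨hly, Set.insert_comm _ _ _⟩⟩,
            ⟨l, _, hlu, hy, rfl, rfl, Or.inl ⟨hly, Set.insert_comm _ _ _⟩⟩⟩
      · obtain ⟨-, rfl⟩ | ⟨h, -⟩ := h2
        swap
        · exact absurd h huv
        have hU' : U = insert u (insert v (insert l A)) := by
          rcases h4 with ⟨-, h⟩ | ⟨h, -⟩
          · exact h
          · exact absurd h huv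
        have h1 : v ∉ insert u A := by simp [ht, Ne.symm huv]
        have h2 : u ∉ insert v A := by simp [hr, huv]
        exact ⟨⟨l, v, hlu, h1, rfl, Set.insert_comm _ _ _, Or.inl ⟨hlt, by grind⟩⟩,
          ⟨l, u, hlv, h2, rfl, rfl, Or.inl ⟨hlr, by grind⟩⟩⟩

/-! ### Growth of shapes along finite sets of points with two orders -/

/-- The value of `f` at `p` is larger than its values on `S`. -/
def Above {ι α : Type} [LinearOrder α] (f : ι → α) (S : Finset ι) (p : ι) : Prop :=
  ∀ z ∈ S, f z < f p

/-- The value of `f` at `p` is smaller than its values on `S`. -/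
def Below {ι α : Type} [LinearOrder α] (f : ι → α) (S : Finset ι) (p : ι) : Prop :=
  ∀ z ∈ S, f p < f z

/-- A family of shapes indexed by finite sets of points, with the local properties of the
Robinson–Schensted shapes when `f` gives the positions and `g` the values of the points. -/
structure RowGrowth {ι α β : Type} [DecidableEq ι] [LinearOrder α] [LinearOrder β]
    (s : Finset ι → Set (ℕ × ℕ)) (f : ι → α) (g : ι → β) : Prop where
  inj_left : Function.Injective f
  inj_right : Function.Injective g
  shape : ∀ S, IsShape (s S)
  empty : s ∅ = ∅
  row : ∀ S p q, Above f (insert q S) p → Above g (insert p S) q →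
    RowRule (s S) (s (insert p S)) (s (insert q S)) (s (insert p (insert q S)))
  corner : ∀ S p, Above f S p → Above g S p →
    ∃ y, (0, y) ∉ s S ∧ s (insert p S) = insert (0, y) (s S)

theorem Above.mono {ι α : Type} [LinearOrder α] {f : ι → α} {S S' : Finset ι} {p : ι}
    (h : Above f S p) (hS : S' ⊆ S) : Above f S' p :=
  fun z hz => h z (hS hz)

theorem Below.mono {ι α : Type} [LinearOrder α] {f : ι → α} {S S' : Finset ι} {p : ι}
    (h : Below f S p) (hS : S' ⊆ S) : Below f S' p :=
  fun z hz => h z (hS hz)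

/-! ### Consequences of the row rule -/

section Growth

variable {ι α β : Type} [DecidableEq ι] [LinearOrder α] [LinearOrder β]
  {s : Finset ι → Set (ℕ × ℕ)} {f : ι → α} {g : ι → β}

theorem Above.insert {S : Finset ι} {p q : ι} (h : Above f S p) (hq : f q < f p) :
    Above f (insert q S) p := by
  intro z hz
  rcases Finset.mem_insert.1 hz with rfl | hz
  · exact hq
  · exact h z hz

theorem Below.insert {S : Finset ι} {p q : ι} (h : Below f S p) (hq : f p < f q) :
    Below f (insert q S) p := by
  intro z hz
  rcases Finset.mem_insert.1 hz with rfl | hz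
  · exact hq
  · exact h z hz

/-- The largest point of a nonempty finite set. -/
theorem exists_above (hf : Function.Injective f) {S : Finset ι} (hS : S.Nonempty) :
    ∃ p ∈ S, Above f (S.erase p) p := by
  obtain ⟨p, hp, h⟩ := S.exists_max_image f hS
  exact ⟨p, hp, fun z hz => lt_of_le_of_ne (h z (Finset.mem_of_mem_erase hz))
    fun e => Finset.ne_of_mem_erase hz (hf e)⟩

/-- The end of the first row either is not affected by `p`, or is `p` itself and then moves one step
to the right. This move is allowed both as a slide and as a bump into the next column, which covers
the boundary cases of the induction in `RowGrowth.jdt_col_aux`. -/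
theorem JdtRule.of_corner {A B : Set (ℕ × ℕ)} {C D : Set (ℕ × ℕ)} {p : ℕ × ℕ} (hp : p ∉ A)
    (hB : B = insert p A) {y y' : ℕ} (hy : (0, y) ∉ A) (hC : C = insert (0, y) A)
    (hy' : (0, y') ∉ B) (hD : D = insert (0, y') B) (sA : IsShape A) (sB : IsShape B)
    (sC : IsShape C) (sD : IsShape D) : JdtRule A B C D ∧ ColRule A B C D := by
  subst hB hC hD
  by_cases h : p = (0, y)
  · subst h
    have : y' = y + 1 := by
      rcases lt_trichotomy y' (y + 1) with h | h | h
      · exact absurd (sB _ _ 0 y' (Set.mem_insert _ _) le_rfl (by omega)) hy'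
      · exact h
      · have h1 := sD _ _ 0 (y + 1) (Set.mem_insert _ _) le_rfl h.le
        have h2 : (0, y + 1) ∉ A := fun h => hp (sA _ _ _ _ h le_rfl (by omega))
        grind
    subst this
    exact ⟨⟨_, _, hp, hp, rfl, rfl, Or.inr ⟨rfl, _, Or.inr rfl, rfl⟩⟩,
      ⟨_, _, hp, hp, rfl, rfl, Or.inr ⟨rfl, 0, hy', rfl⟩⟩⟩
  · have : y' = y := by
      rcases lt_trichotomy y' y with h | h | h
      · exact absurd (sC _ _ 0 y' (Set.mem_insert _ _) le_rfl (by omega)) (by grind)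
      · exact h
      · have h1 := sD _ _ 0 y (Set.mem_insert _ _) le_rfl h.le
        grind
    subst this
    exact ⟨⟨_, _, hp, hy, rfl, rfl, Or.inl ⟨h, Set.insert_comm _ _ _⟩⟩,
      ⟨_, _, hp, hy, rfl, rfl, Or.inl ⟨h, Set.insert_comm _ _ _⟩⟩⟩

theorem JdtRule.transpose {A B C D : Set (ℕ × ℕ)}
    (h : JdtRule (Prod.swap ⁻¹' A) (Prod.swap ⁻¹' B) (Prod.swap ⁻¹' C) (Prod.swap ⁻¹' D)) :
    JdtRule A B C D := by
  obtain ⟨p, q, hp, hq, h1, h2, h3⟩ := h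
  have e : ∀ {X Y : Set (ℕ × ℕ)}, Prod.swap ⁻¹' X = Y → X = Prod.swap ⁻¹' Y := by
    rintro X Y rfl; rfl
  refine ⟨p.swap, q.swap, hp, hq, ?_, ?_, ?_⟩
  · rw [e h1, preimage_swap_insert]; rfl
  · rw [e h2, preimage_swap_insert]; rfl
  · rcases h3 with ⟨hne, h3⟩ | ⟨rfl, d, hd, h3⟩
    · refine Or.inl ⟨fun e => hne (Prod.swap_injective e), ?_⟩
      rw [e h3, preimage_swap_insert, preimage_swap_insert]; rfl
    · refine Or.inr ⟨rfl, d.swap, ?_, ?_⟩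
      · rcases hd with rfl | rfl
        · exact Or.inr rfl
        · exact Or.inl rfl
      rw [e h3, preimage_swap_insert]; rfl

theorem JdtRule.symm {A B C D : Set (ℕ × ℕ)} (h : JdtRule A B C D) : JdtRule A C B D := by
  obtain ⟨p, q, hp, hq, rfl, rfl, ⟨hne, rfl⟩ | ⟨rfl, h⟩⟩ := h
  · exact ⟨q, p, hq, hp, rfl, rfl, Or.inl ⟨hne.symm, Set.insert_comm _ _ _⟩⟩
  · exact ⟨p, p, hp, hp, rfl, rfl, Or.inr ⟨rfl, h⟩⟩

theorem JdtRule.of_col_corner {A B C D : Set (ℕ × ℕ)} {p : ℕ × ℕ} (hp : p ∉ A)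
    (hB : B = insert p A) {x x' : ℕ} (hx : (x, 0) ∉ A) (hC : C = insert (x, 0) A)
    (hx' : (x', 0) ∉ B) (hD : D = insert (x', 0) B) (sA : IsShape A) (sB : IsShape B)
    (sC : IsShape C) (sD : IsShape D) : JdtRule A B C D :=
  JdtRule.transpose (JdtRule.of_corner (A := Prod.swap ⁻¹' A) (p := p.swap) (y := x) (y' := x')
    hp (by rw [hB, preimage_swap_insert]) hx (by rw [hC, preimage_swap_insert]; rfl)
    hx' (by rw [hD, preimage_swap_insert]; rfl) sA.transpose sB.transpose sC.transpose
    sD.transpose).1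

theorem ColRule.symm {A B C D : Set (ℕ × ℕ)} (h : ColRule A B C D) : ColRule A C B D :=
  RowRule.transpose h.transpose.symm

namespace RowGrowth

/-- Inversion: exchange of positions and values. -/
theorem inverse (h : RowGrowth s f g) : RowGrowth s g f where
  inj_left := h.inj_right
  inj_right := h.inj_left
  shape := h.shape
  empty := h.empty
  row S p q hp hq := by
    rw [Finset.insert_comm]
    exact (h.row S q p hq hp).symm
  corner S p hp hq := h.corner S p hq hp

/-- A point that comes first and has the largest value adds a square to the first column. -/
theorem col_corner (h : RowGrowth s f g) (S : Finset ι) (p : ι) (hf : Below f S p)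
    (hg : Above g S p) : ∃ x, (x, 0) ∉ s S ∧ s (insert p S) = insert (x, 0) (s S) := by
  induction S using Finset.induction_on_max_value f with
  | empty =>
    obtain ⟨y, hy, e⟩ := h.corner ∅ p (by simp [Above]) (by simp [Above])
    have hs := h.shape (insert p ∅)
    rw [e, h.empty] at hs
    have : (0, 0) ∈ insert (0, y) (∅ : Set (ℕ × ℕ)) :=
      hs 0 y 0 0 (Set.mem_insert _ _) le_rfl (by omega)
    obtain rfl : y = 0 := by simp at this; omega
    exact ⟨0, hy, e⟩
  | insert r S hr hmax ih =>
    obtain ⟨x, hx, e⟩ := ih (hf.mono (Finset.subset_insert _ _))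
      (hg.mono (Finset.subset_insert _ _))
    have hr' : Above f S r := fun z hz =>
      lt_of_le_of_ne (hmax z hz) fun e => hr (h.inj_left e ▸ hz)
    have hrow := h.row S r p (hr'.insert (hf r (Finset.mem_insert_self _ _))) hg
    obtain ⟨u, v, hu, hv, e1, e2, h3⟩ := hrow
    have huv : v = (x, 0) := by
      have : v ∈ insert (x, 0) (s S) := by rw [← e, e2]; exact Set.mem_insert _ _
      simpa [hv] using this
    subst huv
    rw [Finset.insert_comm, e1]
    rw [e1] at h3
    rcases h3 with ⟨hne, h3⟩ | ⟨rfl, y, hy, h3⟩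
    · refine ⟨x, ?_, by rw [h3, Set.insert_comm]⟩
      simp [hx, Ne.symm hne]
    · refine ⟨x + 1, ?_⟩
      -- The bump is into row `x + 1`. A column `y > 0` would require `(x, y)`, but row `x` contains
      -- only the square `(x, 0)` just added.
      have hy0 : y = 0 := by
        by_contra hy0
        have hs := h.shape (insert r (insert p S))
        rw [h3] at hs
        have h5 := hs _ _ x y (Set.mem_insert _ _) (by simp) le_rfl
        have h6 : (x, y) ∉ s S := fun hh => hx (h.shape S _ _ _ _ hh le_rfl (by omega))
        grind
      subst hy0
      exact ⟨hy, h3⟩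

/-- Compare `p` with the point of largest value: if it is `p` itself, the corner rule applies, and
otherwise either case of the row rule exhibits the single new square. -/
theorem box_above (h : RowGrowth s f g) (S : Finset ι) (p : ι) (hp : Above f S p) :
    ∃ c, c ∉ s S ∧ s (insert p S) = insert c (s S) := by
  obtain ⟨t, ht, hT⟩ := exists_above h.inj_right (Finset.insert_nonempty p S)
  by_cases htp : t = p
  · subst htp
    have : Above g S t := hT.mono fun z hz => Finset.mem_erase.2
      ⟨fun e => absurd (hp z hz) (by simp [e]), Finset.mem_insert_of_mem hz⟩
    obtain ⟨y, hy⟩ := h.corner S t hp this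
    exact ⟨_, hy⟩
  · have htS : t ∈ S := (Finset.mem_insert.1 ht).resolve_left htp
    have e := Finset.insert_erase htS
    have hpS : p ∉ S := fun hh => absurd (hp p hh) (lt_irrefl _)
    have hrow := h.row (S.erase t) p t (by rwa [e])
      (by rwa [← Finset.erase_insert_of_ne (Ne.symm htp)])
    rw [e] at hrow
    obtain ⟨u, v, hu, hv, e1, e2, ⟨hne, h3⟩ | ⟨rfl, y, hy, h3⟩⟩ := hrow
    · exact ⟨u, by simp [e2, hne, hu], by rw [h3, e2]⟩
    · rw [e1] at h3 hy
      exact ⟨_, by rwa [e2], by rw [h3, e2]⟩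

/-- The column rule (first point and largest value) and the jeu de taquin rule (first and last
point) follow from the row rule. -/
theorem jdt_col_aux (h : RowGrowth s f g) (S : Finset ι) :
    (∀ p q, Below f (insert q S) p → Above f (insert p S) q →
      JdtRule (s S) (s (insert p S)) (s (insert q S)) (s (insert p (insert q S)))) ∧
    (∀ p q, Below f (insert q S) p → Above g (insert p S) q →
      ColRule (s S) (s (insert p S)) (s (insert q S)) (s (insert p (insert q S)))) := by
  induction S using Finset.strongInduction with
  | H S ih =>
    -- Adding a first point is not covered by the axioms; that it adds one square follows from the
    -- jeu de taquin rule for `S` without its last point, known by induction.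
    have box_below : ∀ p, Below f S p → ∃ c, c ∉ s S ∧ s (insert p S) = insert c (s S) := by
      intro p hp
      rcases S.eq_empty_or_nonempty with rfl | hne
      · exact h.box_above ∅ p (by simp [Above])
      · obtain ⟨r, hr, hR⟩ := exists_above h.inj_left hne
        have e := Finset.insert_erase hr
        have hj := (ih (S.erase r) (Finset.erase_ssubset hr)).1 p r (by rwa [e])
          (hR.insert (hp r hr))
        rw [e] at hj
        obtain ⟨u, v, hu, hv, e1, e2, ⟨hne, h3⟩ | ⟨rfl, d, hd, h3⟩⟩ := hj
        · exact ⟨u, by simp [e2, hne, hu], by rw [h3, e2]⟩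
        · refine ⟨d, ?_, by rw [h3, e1, e2]⟩
          rw [e2]
          rintro (hh | hh)
          · rcases hd with rfl | rfl <;> simp [Prod.ext_iff] at hh
          · exact hu (h.shape _ _ _ _ _ hh (by rcases hd with rfl | rfl <;> simp)
              (by rcases hd with rfl | rfl <;> simp))
    constructor
    · intro p q hp hq
      obtain ⟨t, ht, hT⟩ := exists_above h.inj_right (Finset.insert_nonempty p (insert q S))
      have hpq : f p < f q := hp q (Finset.mem_insert_self _ _)
      have hqS : q ∉ S := fun hh => absurd (hq q (Finset.mem_insert_of_mem hh)) (lt_irrefl _)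
      have hpS : p ∉ insert q S := fun hh => absurd (hp p hh) (lt_irrefl _)
      have hqS' : q ∉ insert p S := fun hh => absurd (hq q hh) (lt_irrefl _)
      obtain ⟨c, hc, ec⟩ := box_below p (hp.mono (Finset.subset_insert _ _))
      obtain ⟨d, hd, ed⟩ := h.box_above S q (hq.mono (Finset.subset_insert _ _))
      by_cases htp : t = p
      · subst htp
        rw [Finset.erase_insert hpS] at hT
        obtain ⟨x, hx, ex⟩ := h.col_corner S t (hp.mono (Finset.subset_insert _ _))
          (hT.mono (Finset.subset_insert _ _))
        obtain ⟨x', hx', ex'⟩ := h.col_corner (insert q S) t hp hT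
        exact (JdtRule.of_col_corner hd ed hx ex hx' ex' (h.shape _) (h.shape _) (h.shape _)
          (h.shape _)).symm
      by_cases htq : t = q
      · subst htq
        rw [Finset.insert_comm, Finset.erase_insert hqS'] at hT
        obtain ⟨y, hy, ey⟩ := h.corner S t (hq.mono (Finset.subset_insert _ _))
          (hT.mono (Finset.subset_insert _ _))
        obtain ⟨y', hy', ey'⟩ := h.corner (insert p S) t hq hT
        rw [Finset.insert_comm]
        exact (JdtRule.of_corner hc ec hy ey hy' ey' (h.shape _) (h.shape _) (h.shape _)
          (h.shape _)).1
      -- Take out the point `t` of largest value. The cube over `S.erase t` in the directions `p`,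
      -- `q`, `t` has its jeu de taquin and column faces by induction and its row faces by the
      -- axiom; the face with `t` added is the claim.
      · have htS : t ∈ S := by simpa [htp, htq] using ht
        have e := Finset.insert_erase htS
        have hsub := Finset.erase_subset t S
        have hTp : Above g (insert p (S.erase t)) t := hT.mono (by
          intro z; simp only [Finset.mem_insert, Finset.mem_erase]; rintro (rfl | hz) <;> grind)
        have hTq : Above g (insert q (insert p (S.erase t))) t := hT.mono (by
          intro z; simp only [Finset.mem_insert, Finset.mem_erase]
          rintro (rfl | rfl | hz) <;> grind)
        obtain ⟨i1, i2⟩ := ih (S.erase t) (Finset.erase_ssubset htS)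
        have c1 := i1 p q (hp.mono (Finset.insert_subset_insert _ hsub))
          (hq.mono (Finset.insert_subset_insert _ hsub))
        have c2 := h.row (S.erase t) q t (by rw [e]; exact hq.mono (Finset.subset_insert _ _))
          (hTq.mono (Finset.insert_subset_insert _ (Finset.subset_insert _ _)))
        have c3 := i2 p t (by rw [e]; exact hp.mono (Finset.subset_insert _ _)) hTp
        have c4 := h.row (insert p (S.erase t)) q t (by rwa [Finset.insert_comm, e]) hTq
        rw [Finset.insert_comm q p, Finset.insert_comm t p] at c4
        have c5 := (cube_rules (h.shape _) (h.shape _) (h.shape _) (h.shape _) (h.shape _)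
          (h.shape _) (h.shape _) (h.shape _) c1 c2 c3 c4).2
        rwa [Finset.insert_comm q p, e] at c5
    · intro p q hp hq
      have hpq : f p < f q := hp q (Finset.mem_insert_self _ _)
      have hpS : p ∉ insert q S := fun hh => absurd (hp p hh) (lt_irrefl _)
      have hqS' : q ∉ insert p S := fun hh => absurd (hq q hh) (lt_irrefl _)
      obtain ⟨c, hc, ec⟩ := box_below p (hp.mono (Finset.subset_insert _ _))
      -- For the column rule it is the last point `r` that is taken out, and the cube has the
      -- directions `p`, `r`, `q`; the claim is then the other conclusion of `cube_rules`.
      obtain ⟨r, hr, hR⟩ := exists_above h.inj_left (Finset.insert_nonempty q S)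
      have hpr : f p < f r := hp r hr
      by_cases hrq : r = q
      · subst hrq
        rw [Finset.erase_insert (fun hh => hqS' (Finset.mem_insert_of_mem hh))] at hR
        obtain ⟨y, hy, ey⟩ := h.corner S r hR (hq.mono (Finset.subset_insert _ _))
        obtain ⟨y', hy', ey'⟩ := h.corner (insert p S) r (hR.insert hpr) hq
        rw [Finset.insert_comm]
        exact (JdtRule.of_corner hc ec hy ey hy' ey' (h.shape _) (h.shape _) (h.shape _)
          (h.shape _)).2
      · have hrS : r ∈ S := (Finset.mem_insert.1 hr).resolve_left hrq
        have e := Finset.insert_erase hrS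
        have hsub := Finset.erase_subset r S
        have hRq : Above f (insert q (S.erase r)) r := hR.mono (by
          intro z; simp only [Finset.mem_insert, Finset.mem_erase]; rintro (rfl | hz) <;> grind)
        obtain ⟨i1, i2⟩ := ih (S.erase r) (Finset.erase_ssubset hrS)
        have c1 := i1 p r (by rw [e]; exact hp.mono (Finset.subset_insert _ _))
          ((hRq.mono (Finset.subset_insert _ _)).insert hpr)
        have c2 := h.row (S.erase r) r q hRq
          (by rw [e]; exact hq.mono (Finset.subset_insert _ _))
        have c3 := i2 p q (hp.mono (Finset.insert_subset_insert _ hsub))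
          (hq.mono (Finset.insert_subset_insert _ hsub))
        have c4 := h.row (insert p (S.erase r)) r q
          (by rw [Finset.insert_comm]; exact hRq.insert hpr)
          (by rwa [Finset.insert_comm, e])
        rw [Finset.insert_comm r p, Finset.insert_comm q p] at c4
        have c5 := (cube_rules (h.shape _) (h.shape _) (h.shape _) (h.shape _) (h.shape _)
          (h.shape _) (h.shape _) (h.shape _) c1 c2 c3 c4).1
        rwa [Finset.insert_comm r p, Finset.insert_comm r q, e] at c5

theorem jdt (h : RowGrowth s f g) {S : Finset ι} {p q : ι} (hp : Below f (insert q S) p)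
    (hq : Above f (insert p S) q) :
    JdtRule (s S) (s (insert p S)) (s (insert q S)) (s (insert p (insert q S))) :=
  (h.jdt_col_aux S).1 p q hp hq

theorem col (h : RowGrowth s f g) {S : Finset ι} {p q : ι} (hp : Below f (insert q S) p)
    (hq : Above g (insert p S) q) :
    ColRule (s S) (s (insert p S)) (s (insert q S)) (s (insert p (insert q S))) :=
  (h.jdt_col_aux S).2 p q hp hq

/-- Reversal of the positions transposes the shapes. -/
theorem reverse (h : RowGrowth s f g) :
    RowGrowth (fun S => Prod.swap ⁻¹' s S) (fun z => OrderDual.toDual (f z)) g where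
  inj_left := OrderDual.toDual.injective.comp h.inj_left
  inj_right := h.inj_right
  shape S := (h.shape S).transpose
  empty := by rw [h.empty]; rfl
  row S p q hp hq := (h.col (p := p) (q := q) hp hq).transpose
  corner S p hp hq := by
    obtain ⟨x, hx, e⟩ := h.col_corner S p hp hq
    exact ⟨x, hx, by rw [e, preimage_swap_insert]; rfl⟩

/-- The column rule for the last point and the smallest value. -/
theorem col' (h : RowGrowth s f g) {S : Finset ι} {p q : ι} (hp : Above f (insert q S) p)
    (hq : Below g (insert p S) q) :
    ColRule (s S) (s (insert p S)) (s (insert q S)) (s (insert p (insert q S))) :=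
  by
  rw [Finset.insert_comm]
  exact (h.inverse.col (p := q) (q := p) hq hp).symm

/-- The row rule for the first point and the smallest value. -/
theorem row' (h : RowGrowth s f g) {S : Finset ι} {p q : ι} (hp : Below f (insert q S) p)
    (hq : Below g (insert p S) q) :
    RowRule (s S) (s (insert p S)) (s (insert q S)) (s (insert p (insert q S))) := by
  -- This composite reverses both orders. The shapes are transposed twice, which is the identity
  -- definitionally, so growth is invariant under rotation by a half turn.
  have := h.reverse.inverse.reverse.inverse.row S p q hp hq
  exact this

theorem corner' (h : RowGrowth s f g) (S : Finset ι) (p : ι) (hf : Below f S p)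
    (hg : Below g S p) : ∃ y, (0, y) ∉ s S ∧ s (insert p S) = insert (0, y) (s S) :=
  h.reverse.inverse.reverse.inverse.corner S p hf hg

end RowGrowth
end Growth
/-! ### Domino rules -/

theorem RowRule.same {A D : Set (ℕ × ℕ)} {p : ℕ × ℕ} (hp : p ∉ A)
    (h : RowRule A (insert p A) (insert p A) D) :
    ∃ y, (p.1 + 1, y) ∉ insert p A ∧ D = insert (p.1 + 1, y) (insert p A) := by
  obtain ⟨u, v, hu, hv, e1, e2, h⟩ := h
  have : p = u := by
    have : p ∈ insert u A := e1 ▸ Set.mem_insert p A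
    simpa [hp] using this
  subst this
  have : p = v := by
    have : p ∈ insert v A := e2 ▸ Set.mem_insert p A
    simpa [hp] using this
  subst this
  rcases h with ⟨h, -⟩ | ⟨-, h⟩
  · exact absurd rfl h
  · exact h

theorem ColRule.same {A D : Set (ℕ × ℕ)} {p : ℕ × ℕ} (hp : p ∉ A)
    (h : ColRule A (insert p A) (insert p A) D) :
    ∃ x, (x, p.2 + 1) ∉ insert p A ∧ D = insert (x, p.2 + 1) (insert p A) := by
  have h' := h.transpose
  simp only [preimage_swap_insert] at h'
  obtain ⟨x, hx, e⟩ := RowRule.same (p := p.swap) (A := Prod.swap ⁻¹' A) hp h'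
  refine ⟨x, fun hh => hx ?_, ?_⟩
  · rw [← preimage_swap_insert]
    exact hh
  · have e2 : D = Prod.swap ⁻¹' (Prod.swap ⁻¹' D) := rfl
    rw [e2, e, preimage_swap_insert, preimage_swap_insert]
    rfl

theorem eq_of_mem_insert {X D : Set (ℕ × ℕ)} {c d : ℕ × ℕ} (h : D = insert c X) (hd : d ∈ D)
    (hd' : d ∉ X) : d = c := by
  rw [h] at hd
  exact hd.resolve_right hd'

/-- The local rules on the faces of a four-dimensional cube, when the first two directions add a
horizontal domino and the other two start with the same square. -/
theorem horizontal_of_rules {A L R B T LR LB LT RB RT LRB LRT LBT U : Set (ℕ × ℕ)} {a b : ℕ}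
    (hp : (a, b) ∉ A) (eL : L = insert (a, b) A) (eR : R = insert (a, b) A)
    (eB : B = insert (a, b) A) (eT : T = insert (a, b) A)
    (eLR : LR = insert (a, b + 1) (insert (a, b) A))
    (sA : IsShape A) (sLR : IsShape LR) (sLB : IsShape LB) (sLT : IsShape LT) (sRB : IsShape RB)
    (sRT : IsShape RT) (sU : IsShape U)
    (r1 : RowRule A R T RT) (r2 : RowRule A L B LB) (r3 : ColRule A L T LT)
    (r4 : ColRule A R B RB) (r5 : RowRule L LR LT LRT) (r6 : RowRule R LR RB LRB)
    (r7 : ∃ c, LBT = insert c LT) (r8 : RowRule LB LRB LBT U)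
    (i1 : RT ⊆ LRT) (i2 : LB ⊆ LRB) (i3 : LB ⊆ LBT) :
    ∃ y, (a + 1, y) ∉ A ∧ (a + 1, y + 1) ∉ A ∧
      IsShape (insert (a + 1, y) (insert (a, b) A)) ∧
      U = insert (a + 1, y + 1) (insert (a + 1, y) LR) := by
  subst eL eR eB eT eLR
  -- All four directions add `(a, b)` to `A`. So the two row faces bump into row `a + 1`, where only
  -- one column `y` is possible, and the two column faces bump into column `b + 1`.
  obtain ⟨y, hy, rfl⟩ := r1.same hp
  obtain ⟨y', hy', rfl⟩ := r2.same hp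
  obtain rfl : y = y' := eq_of_same_row hy hy' sRT sLB
  have hp' : (a, b + 1) ∉ insert (a, b) A := by
    have : (a, b + 1) ∉ A := fun h => hp (sA _ _ _ _ h le_rfl (by omega))
    simp [this]
  -- Since `LR` is a shape, `(a, b + 1)` can be added; as it lies in column `b + 1`, the column bump
  -- lands there.
  obtain ⟨x, hx, rfl⟩ := r3.same hp
  obtain rfl : x = a := eq_of_same_col hx hp' sLT sLR
  obtain ⟨x', hx', rfl⟩ := r4.same hp
  obtain rfl : x' = x := eq_of_same_col hx' hp' sRB sLR
  obtain ⟨y1, hy1, rfl⟩ := r5.same hp'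
  obtain ⟨y2, hy2, rfl⟩ := r6.same hp'
  simp only at *
  have hq : (x' + 1, y) ∉ insert (x', b + 1) (insert (x', b) A) := by simpa using hy
  have e1 := eq_of_mem_insert rfl (i1 (Set.mem_insert _ _)) hq
  obtain rfl : y = y1 := by simpa using e1
  have e2 := eq_of_mem_insert rfl (i2 (Set.mem_insert _ _)) hq
  obtain rfl : y = y2 := by simpa using e2
  obtain ⟨c, rfl⟩ := r7
  obtain rfl : (x' + 1, y) = c := eq_of_mem_insert rfl (i3 (Set.mem_insert _ _)) hq
  have hp2 : (x', b + 1) ∉ insert (x' + 1, y) (insert (x', b) A) := by simpa using hp'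
  rw [Set.insert_comm (x' + 1, y) (x', b + 1)] at r8
  -- Over `LB`, both sides add `(a, b + 1)`, so there is a second bump into row `a + 1`, necessarily
  -- just after the first one. This makes the new domino horizontal.
  obtain ⟨y3, hy3, rfl⟩ := r8.same hp2
  simp only at hy3 sU
  obtain rfl : y3 = y + 1 := by
    rcases lt_trichotomy y3 (y + 1) with h | h | h
    · exact absurd (sRT _ _ (x' + 1) y3 (Set.mem_insert _ _) le_rfl (by omega)) (by grind)
    · exact h
    · have h1 := sU _ _ (x' + 1) (y + 1) (Set.mem_insert _ _) le_rfl h.le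
      have h2 : (x' + 1, y + 1) ∉ A := fun h =>
        hy (Set.mem_insert_of_mem _ (sA _ _ _ _ h le_rfl (by omega)))
      grind
  refine ⟨y, fun h => hy (Set.mem_insert_of_mem _ h), by grind, sRT, ?_⟩
  rw [Set.insert_comm (x', b + 1)]

/-- `B` is obtained from `A` by adding a horizontal domino starting at `p`. -/
def AddHorizontal (A : Set (ℕ × ℕ)) (p : ℕ × ℕ) (B : Set (ℕ × ℕ)) : Prop :=
  p ∉ A ∧ B = insert (p.1, p.2 + 1) (insert p A)

/-- `B` is obtained from `A` by adding a vertical domino starting at `p`. -/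
def AddVertical (A : Set (ℕ × ℕ)) (p : ℕ × ℕ) (B : Set (ℕ × ℕ)) : Prop :=
  p ∉ A ∧ B = insert (p.1 + 1, p.2) (insert p A)

/-- `B` is obtained from `A` by adding a domino starting at `p`. -/
def AddDomino (A : Set (ℕ × ℕ)) (p : ℕ × ℕ) (B : Set (ℕ × ℕ)) : Prop :=
  AddHorizontal A p B ∨ AddVertical A p B

theorem AddVertical.transpose {A B : Set (ℕ × ℕ)} {p : ℕ × ℕ} (h : AddVertical A p B) :
    AddHorizontal (Prod.swap ⁻¹' A) p.swap (Prod.swap ⁻¹' B) :=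
  ⟨h.1, by rw [h.2, preimage_swap_insert, preimage_swap_insert]; rfl⟩

/-- A shape between two shapes that differ by a domino. -/
theorem AddDomino.eq_of_between {A B X : Set (ℕ × ℕ)} {p u v : ℕ × ℕ} (h : AddDomino A p B)
    (sX : IsShape X) (hu : u ∉ A) (hX : X = insert u A)
    (hB : B = insert v X) : u = p := by
  have hpB : p ∈ insert v (insert u A) := by
    rw [← hX, ← hB]
    rcases h with ⟨-, h⟩ | ⟨-, h⟩ <;> simp [h]
  have hpA : p ∉ A := by rcases h with ⟨h, -⟩ | ⟨h, -⟩ <;> exact h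
  have huB : u ∈ B := by rw [hB, hX]; simp
  by_contra hne
  have : p ∈ X := by
    have : (u = (p.1, p.2 + 1) ∨ u = (p.1 + 1, p.2)) := by
      rcases h with ⟨-, h⟩ | ⟨-, h⟩ <;> rw [h] at huB <;>
        simp only [Set.mem_insert_iff, hu, hne, or_false] at huB <;> simp [huB]
    rw [hX] at sX ⊢
    rcases this with rfl | rfl
    · exact sX _ _ _ _ (Set.mem_insert _ _) le_rfl (by simp)
    · exact sX _ _ _ _ (Set.mem_insert _ _) (by simp) le_rfl
  rw [hX] at this
  rcases this with h | h
  · exact hne h.symm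
  · exact hpA h

/-! ### Frames of four points and domino bumping -/

section Growth

variable {ι α β : Type} [DecidableEq ι] [LinearOrder α] [LinearOrder β]
  {s : Finset ι → Set (ℕ × ℕ)} {f : ι → α} {g : ι → β}

/-- Four points that are, besides `S`, first and last for `f`, and first and last for `g`. -/
structure Frame (f : ι → α) (g : ι → β) (S : Finset ι) (l r b t : ι) : Prop where
  left : Below f (insert r (insert b (insert t S))) l
  right : Above f (insert l (insert b (insert t S))) r
  bot : Below g (insert l (insert r (insert t S))) b
  top : Above g (insert l (insert r (insert b S))) t

theorem RowGrowth.box_below (h : RowGrowth s f g) (S : Finset ι) (p : ι) (hp : Below f S p) :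
    ∃ c, c ∉ s S ∧ s (insert p S) = insert c (s S) := by
  obtain ⟨c, hc, e⟩ := h.reverse.box_above S p hp
  refine ⟨c.swap, hc, ?_⟩
  have : s (insert p S) = Prod.swap ⁻¹' (Prod.swap ⁻¹' s (insert p S)) := rfl
  rw [this, e, preimage_swap_insert]
  rfl

theorem Frame.inverse {S : Finset ι} {l r b t : ι} (F : Frame f g S l r b t) :
    Frame g f S b t l r where
  left := F.bot.mono (by intro z; simp only [Finset.mem_insert]; tauto)
  right := F.top.mono (by intro z; simp only [Finset.mem_insert]; tauto)
  bot := F.left.mono (by intro z; simp only [Finset.mem_insert]; tauto)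
  top := F.right.mono (by intro z; simp only [Finset.mem_insert]; tauto)

theorem Frame.reverse {S : Finset ι} {l r b t : ι} (F : Frame f g S l r b t) :
    Frame (fun z => OrderDual.toDual (f z)) g S r l b t where
  left := F.right
  right := F.left
  bot := F.bot.mono (by intro z; simp only [Finset.mem_insert]; tauto)
  top := F.top.mono (by intro z; simp only [Finset.mem_insert]; tauto)

namespace RowGrowth

/-- If the first two points add a horizontal domino and the other two points start with the same
square, then the four points add in addition a horizontal domino in the next row. -/
theorem frame_horizontal (h : RowGrowth s f g) {S : Finset ι} {l r b t : ι}
    (F : Frame f g S l r b t) {p : ℕ × ℕ}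
    (h1 : AddHorizontal (s S) p (s (insert l (insert r S))))
    (h2 : AddDomino (s S) p (s (insert b (insert t S)))) :
    ∃ y, (p.1 + 1, y) ∉ s S ∧ (p.1 + 1, y + 1) ∉ s S ∧
      IsShape (insert (p.1 + 1, y) (insert p (s S))) ∧
      s (insert l (insert r (insert b (insert t S)))) =
        insert (p.1 + 1, y + 1) (insert (p.1 + 1, y) (s (insert l (insert r S)))) := by
  have sub : ∀ {X Y : Finset ι}, (∀ z, z ∈ X → z ∈ Y) → X ⊆ Y := fun h => h
  obtain ⟨fl, fr, fb, ft⟩ := F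
  obtain ⟨cl, hcl, el⟩ := h.box_below S l (fl.mono (sub (by simp +contextual)))
  obtain ⟨cr, hcr, er⟩ := h.box_above S r (fr.mono (sub (by simp +contextual)))
  obtain ⟨cb, hcb, eb⟩ := h.inverse.box_below S b (fb.mono (sub (by simp +contextual)))
  obtain ⟨ct, hct, et⟩ := h.inverse.box_above S t (ft.mono (sub (by simp +contextual)))
  obtain ⟨cl', -, el'⟩ := h.box_below (insert r S) l
    (fl.mono (sub (by simp only [Finset.mem_insert]; tauto)))
  obtain ⟨cr', -, er'⟩ := h.box_above (insert l S) r
    (fr.mono (sub (by simp only [Finset.mem_insert]; tauto)))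
  obtain ⟨cb', -, eb'⟩ := h.inverse.box_below (insert t S) b
    (fb.mono (sub (by simp only [Finset.mem_insert]; tauto)))
  obtain ⟨ct', -, et'⟩ := h.inverse.box_above (insert b S) t
    (ft.mono (sub (by simp only [Finset.mem_insert]; tauto)))
  -- The two points of a pair add the domino one square at a time, in either order, and the
  -- intermediate shape must contain the inner square `p`. So each of the four points alone adds
  -- `p`.
  obtain rfl := AddDomino.eq_of_between (Or.inl h1) (h.shape _) hcr er el'
  obtain rfl := AddDomino.eq_of_between h2 (h.shape _) hct et eb'
  rw [Finset.insert_comm] at h1 h2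
  obtain rfl := AddDomino.eq_of_between (Or.inl h1) (h.shape _) hcl el er'
  obtain rfl := AddDomino.eq_of_between h2 (h.shape _) hcb eb et'
  obtain ⟨a, b'⟩ := cb
  obtain ⟨c1, -, e1⟩ := h.box_below (insert r (insert t S)) l
    (fl.mono (sub (by simp only [Finset.mem_insert]; tauto)))
  obtain ⟨c2, -, e2⟩ := h.box_above (insert l (insert b S)) r
    (fr.mono (sub (by simp only [Finset.mem_insert]; tauto)))
  obtain ⟨c3, -, e3⟩ := h.inverse.box_above (insert l (insert b S)) t
    (ft.mono (sub (by simp only [Finset.mem_insert]; tauto)))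
  obtain ⟨c4, -, e4⟩ := h.inverse.box_below (insert l (insert t S)) b
    (fb.mono (sub (by simp only [Finset.mem_insert]; tauto)))
  have perm : ∀ {X Y : Finset ι}, (∀ z, z ∈ X ↔ z ∈ Y) → s X = s Y := fun h => by
    rw [Finset.ext h]
  refine horizontal_of_rules (LRT := s (insert l (insert r (insert t S))))
    (LBT := s (insert b (insert l (insert t S)))) hcb el er eb et ?_ (h.shape _) (h.shape _)
    (h.shape (insert l (insert b S))) (h.shape (insert l (insert t S)))
    (h.shape (insert r (insert b S))) (h.shape (insert r (insert t S))) (h.shape _)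
    (h.row S r t (fr.mono (sub (by simp only [Finset.mem_insert]; tauto)))
      (ft.mono (sub (by simp only [Finset.mem_insert]; tauto))))
    (h.row' (fl.mono (sub (by simp only [Finset.mem_insert]; tauto)))
      (fb.mono (sub (by simp only [Finset.mem_insert]; tauto))))
    (h.col (fl.mono (sub (by simp only [Finset.mem_insert]; tauto)))
      (ft.mono (sub (by simp only [Finset.mem_insert]; tauto))))
    (h.col' (fr.mono (sub (by simp only [Finset.mem_insert]; tauto)))
      (fb.mono (sub (by simp only [Finset.mem_insert]; tauto)))) ?_ ?_ ⟨_, e4⟩ ?_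
      (e1 ▸ Set.subset_insert _ _) (LRB := s (insert r (insert l (insert b S))))
      (e2 ▸ Set.subset_insert _ _) ?_
  · rw [← h1.2]
    exact perm (by intro z; simp only [Finset.mem_insert]; tauto)
  · have := h.row (insert l S) r t (fr.mono (sub (by simp only [Finset.mem_insert]; tauto)))
      (ft.mono (sub (by simp only [Finset.mem_insert]; tauto)))
    convert this using 1 <;> exact perm (by intro z; simp only [Finset.mem_insert]; tauto)
  · have := h.row' (S := insert r S) (p := l) (q := b)
      (fl.mono (sub (by simp only [Finset.mem_insert]; tauto)))
      (fb.mono (sub (by simp only [Finset.mem_insert]; tauto)))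
    convert this using 1 <;> exact perm (by intro z; simp only [Finset.mem_insert]; tauto)
  · have := h.row (insert l (insert b S)) r t
      (fr.mono (sub (by simp only [Finset.mem_insert]; tauto)))
      (ft.mono (sub (by simp only [Finset.mem_insert]; tauto)))
    convert this using 1 <;> exact perm (by intro z; simp only [Finset.mem_insert]; tauto)
  · have : s (insert b (insert l (insert t S))) = s (insert t (insert l (insert b S))) :=
      perm (by intro z; simp only [Finset.mem_insert]; tauto)
    rw [this, e3]
    exact Set.subset_insert _ _

end RowGrowth

theorem IsShape.union {A B : Set (ℕ × ℕ)} (hA : IsShape A) (hB : IsShape B) : IsShape (A ∪ B) :=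
  fun a b a' b' h h1 h2 => h.imp (fun h => hA a b a' b' h h1 h2) fun h => hB a b a' b' h h1 h2

theorem mem_row_iff {A : Set (ℕ × ℕ)} {a y : ℕ} (hA : IsShape A)
    (hI : IsShape (insert (a, y) A)) (hy : (a, y) ∉ A) (z : ℕ) : (a, z) ∈ A ↔ z < y := by
  constructor
  · intro h
    by_contra hz
    exact hy (hA _ _ _ _ h le_rfl (by omega))
  · intro h
    have := hI _ _ a z (Set.mem_insert _ _) le_rfl h.le
    simp only [Set.mem_insert_iff, Prod.mk.injEq, true_and] at this
    exact this.resolve_left (by omega)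

/-- As `(a, y)` can be added to the shape, row `a` is the interval `[0, y)`, so the cardinality in
`horizontalAt` is `y`. -/
theorem horizontalAt_eq {μ : Finset (ℕ × ℕ)} {a y : ℕ} (hA : IsShape (μ : Set (ℕ × ℕ)))
    (hI : IsShape (insert (a, y) (μ : Set (ℕ × ℕ)))) (hy : (a, y) ∉ μ) :
    horizontalAt μ a = {(a, y), (a, y + 1)} := by
  have : μ.filter (fun c => c.1 = a) = (Finset.range y).image (fun z => (a, z)) := by
    ext ⟨u, v⟩
    have := mem_row_iff hA hI (by simpa using hy) v
    simp only [Finset.mem_coe] at this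
    simp only [Finset.mem_filter, Finset.mem_image, Finset.mem_range, Prod.mk.injEq]
    constructor
    · rintro ⟨h, rfl⟩
      exact ⟨v, this.1 h, rfl, rfl⟩
    · rintro ⟨v', h, rfl, rfl⟩
      exact ⟨this.2 h, rfl⟩
  simp [horizontalAt, this, Finset.card_image_of_injective _ (Prod.mk_right_injective a)]

theorem verticalAt_eq {μ : Finset (ℕ × ℕ)} {b x : ℕ} (hA : IsShape (μ : Set (ℕ × ℕ)))
    (hI : IsShape (insert (x, b) (μ : Set (ℕ × ℕ)))) (hx : (x, b) ∉ μ) :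
    verticalAt μ b = {(x, b), (x + 1, b)} := by
  have : μ.filter (fun c => c.2 = b) = (Finset.range x).image (fun z => (z, b)) := by
    ext ⟨u, v⟩
    have := mem_row_iff hA.transpose
      (by rw [← Prod.swap_prod_mk, ← preimage_swap_insert]; exact hI.transpose)
      (by simpa using hx) u
    simp only [Set.mem_preimage, Prod.swap_prod_mk, Finset.mem_coe] at this
    simp only [Finset.mem_filter, Finset.mem_image, Finset.mem_range, Prod.mk.injEq]
    constructor
    · rintro ⟨h, rfl⟩
      exact ⟨u, this.1 h, rfl, rfl⟩
    · rintro ⟨v', h, rfl, rfl⟩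
      exact ⟨this.2 h, rfl⟩
  simp [verticalAt, this, Finset.card_image_of_injective _ (Prod.mk_left_injective b)]

theorem AddDomino.mem_iff {A B : Set (ℕ × ℕ)} {p : ℕ × ℕ} (h : AddDomino A p B) (sA : IsShape A) :
    p ∉ A ∧ ∃ p', (p' = (p.1, p.2 + 1) ∨ p' = (p.1 + 1, p.2)) ∧ p' ∉ A ∧
      B = insert p' (insert p A) := by
  rcases h with ⟨h, rfl⟩ | ⟨h, rfl⟩
  · exact ⟨h, _, Or.inl rfl, fun hh => h (sA _ _ _ _ hh le_rfl (by simp)), rfl⟩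
  · exact ⟨h, _, Or.inr rfl, fun hh => h (sA _ _ _ _ hh (by simp) le_rfl), rfl⟩

/-- Two dominoes added to a shape at different squares are disjoint. -/
theorem AddDomino.notMem_of_ne {A B C : Set (ℕ × ℕ)} {p q : ℕ × ℕ} (hB : AddDomino A p B)
    (hC : AddDomino A q C) (sA : IsShape A) (sB : IsShape B) (sC : IsShape C) (hpq : p ≠ q)
    {z : ℕ × ℕ} (hz : z ∈ C) (hzA : z ∉ A) : z ∉ B := by
  intro hzB
  obtain ⟨hp, p', hp', hpA', rfl⟩ := hB.mem_iff sA
  obtain ⟨hq, q', hq', hqA', rfl⟩ := hC.mem_iff sA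
  have h1 : q.1 ≤ z.1 ∧ q.2 ≤ z.2 := by
    rcases hz with rfl | rfl | hz
    · rcases hq' with rfl | rfl <;> simp
    · simp
    · exact absurd hz hzA
  have h2 : p.1 ≤ z.1 ∧ p.2 ≤ z.2 := by
    rcases hzB with rfl | rfl | hz
    · rcases hp' with rfl | rfl <;> simp
    · simp
    · exact absurd hz hzA
  have h3 : p ∈ insert q' (insert q A) := sC _ _ _ _ hz h2.1 h2.2
  have h4 : q ∈ insert p' (insert p A) := sB _ _ _ _ hzB h1.1 h1.2
  have h5 : p = q' := by simpa [hpq, hp] using h3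
  have h6 : q = p' := by simpa [hpq.symm, hq] using h4
  subst h5 h6
  rcases hp' with h | h <;> rcases hq' with h' | h' <;> simp [Prod.ext_iff] at h h' <;> omega

/-- If the first two points of a frame add a domino to the shape, then the effect of the four
points on the domino added by the last two is described by `bump`. -/
theorem RowGrowth.frame_bump (h : RowGrowth s f g) {S : Finset ι} {l r b t : ι}
    (F : Frame f g S l r b t) {p q : ℕ × ℕ}
    (h1 : AddDomino (s S) p (s (insert l (insert r S))))
    (h2 : AddDomino (s S) q (s (insert b (insert t S)))) :
    (∃ c, AddDomino (s (insert l (insert r S))) c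
      (s (insert l (insert r (insert b (insert t S)))))) ∧
    ∀ μ d : Finset (ℕ × ℕ), (μ : Set (ℕ × ℕ)) = s (insert l (insert r S)) →
      (d : Set (ℕ × ℕ)) = s (insert b (insert t S)) \ s S →
      (bump μ d : Set (ℕ × ℕ)) =
        s (insert l (insert r (insert b (insert t S)))) \ s (insert l (insert r S)) := by
  have sS := h.shape S
  have sM := h.shape (insert l (insert r S))
  have sN := h.shape (insert b (insert t S))
  -- If the two dominoes start at the same square, the first one forces the bump; if not, they are
  -- disjoint and nothing moves.
  by_cases hpq : p = q
  · subst hpq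
    rcases h1 with h1 | h1
    · obtain ⟨y, hy, hy', sy, eU⟩ := h.frame_horizontal F h1 h2
      obtain ⟨a, b'⟩ := p
      obtain ⟨hp, e1⟩ := h1
      simp only at *
      have sy' : IsShape (insert (a + 1, y) (s (insert l (insert r S)))) := by
        convert sy.union sM using 1
        rw [e1]
        grind
      have hyM : (a + 1, y) ∉ s (insert l (insert r S)) := by rw [e1]; simp [hy]
      have hyM' : (a + 1, y + 1) ∉ s (insert l (insert r S)) := by rw [e1]; simp [hy']
      refine ⟨⟨(a + 1, y), Or.inl ⟨hyM, eU⟩⟩, fun μ d hμ hd => ?_⟩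
      rw [← hμ] at hyM hyM' eU sy' sM e1 ⊢
      have eD : s (insert l (insert r (insert b (insert t S)))) \ μ =
          {(a + 1, y), (a + 1, y + 1)} := by
        rw [eU]; ext z; simp only [Set.mem_sdiff, Set.mem_insert_iff, Set.mem_singleton_iff]
        grind
      rw [eD]
      -- A horizontal `d` coincides with the new domino and goes to the next row. A vertical `d`
      -- meets it in one square, which is replaced by its diagonal successor.
      rcases h2 with ⟨-, e2⟩ | ⟨-, e2⟩
      · have hb1 : (a, b' + 1) ∉ s S := fun hh => hp (sS _ _ _ _ hh le_rfl (by simp))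
        have ed : d = {(a, b'), (a, b' + 1)} := by
          rw [← Finset.coe_inj, hd, e2]; ext z
          simp only [Set.mem_sdiff, Set.mem_insert_iff, Finset.coe_insert, Finset.coe_singleton,
            Set.mem_singleton_iff]
          grind
        have hsub : d ⊆ μ := by
          rw [ed, ← Finset.coe_subset, e1]
          intro z; simp; tauto
        have hne : d ∩ μ ≠ ∅ := by
          rw [Finset.inter_eq_left.2 hsub, ed]; simp
        have f1 : d.filter (fun c => (c.1, c.2 + 1) ∈ d) = {(a, b')} := by
          rw [ed]; ext ⟨u, v⟩; simp; omega
        have f2 : d.filter (fun c => (c.1 + 1, c.2) ∈ d) = ∅ := by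
          rw [ed]; ext ⟨u, v⟩; simp; omega
        rw [bump, if_neg hne, if_pos hsub, f1, f2]
        simp [horizontalAt_eq sM sy' (by simpa using hyM)]
      · have hb1 : (a + 1, b') ∉ s S := fun hh => hp (sS _ _ _ _ hh (by simp) le_rfl)
        have hyb : y = b' := by
          refine eq_of_same_row (A := insert (a, b') (s S)) (a := a + 1) (by simp [hy])
            (by simp [hb1]) sy (e2 ▸ sN)
        subst hyb
        have ed : d = {(a, y), (a + 1, y)} := by
          rw [← Finset.coe_inj, hd, e2]; ext z
          simp only [Set.mem_sdiff, Set.mem_insert_iff, Finset.coe_insert, Finset.coe_singleton,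
            Set.mem_singleton_iff]
          grind
        have hm1 : (a, y) ∈ μ := by rw [← Finset.mem_coe, e1]; simp
        have hm2 : (a + 1, y) ∉ μ := by simpa using hyM
        have i1 : d ∩ μ = {(a, y)} := by rw [ed]; ext z; simp; grind
        have i2 : d \ μ = {(a + 1, y)} := by rw [ed]; ext z; simp; grind
        have hsub : ¬ d ⊆ μ := fun hh => hm2 (hh (by rw [ed]; simp))
        rw [bump, i1, if_neg (by simp), if_neg hsub, i2]
        simp
    -- The vertical case is the horizontal one after reversing the positions, which transposes
    -- shapes and exchanges `l` and `r`.
    · have h2' : AddDomino (Prod.swap ⁻¹' s S) p.swap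
          (Prod.swap ⁻¹' (s (insert b (insert t S)))) := by
        rcases h2 with h2 | h2
        · exact Or.inr ⟨h2.1, by rw [h2.2, preimage_swap_insert, preimage_swap_insert]; rfl⟩
        · exact Or.inl h2.transpose
      obtain ⟨x, hx, hx', sx, eU⟩ := h.reverse.frame_horizontal F.reverse
        (by rw [Finset.insert_comm]; exact h1.transpose) h2'
      obtain ⟨a, b'⟩ := p
      obtain ⟨hp, e1⟩ := h1
      rw [Finset.insert_comm r l, Finset.insert_comm r l] at eU
      replace eU : s (insert l (insert r (insert b (insert t S)))) =
          insert (x + 1, b' + 1) (insert (x, b' + 1) (s (insert l (insert r S)))) := by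
        have : s (insert l (insert r (insert b (insert t S)))) = Prod.swap ⁻¹'
          (Prod.swap ⁻¹' s (insert l (insert r (insert b (insert t S))))) := rfl
        rw [this, eU, preimage_swap_insert, preimage_swap_insert]; rfl
      replace sx := sx.transpose
      rw [preimage_swap_insert, preimage_swap_insert] at sx
      change IsShape (insert (x, b' + 1) (insert (a, b') (s S))) at sx
      change (x, b' + 1) ∉ s S at hx
      change (x + 1, b' + 1) ∉ s S at hx'
      simp only at *
      have sy' : IsShape (insert (x, b' + 1) (s (insert l (insert r S)))) := by
        convert sx.union sM using 1
        rw [e1]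
        grind
      have hyM : (x, b' + 1) ∉ s (insert l (insert r S)) := by rw [e1]; simp [hx]
      have hyM' : (x + 1, b' + 1) ∉ s (insert l (insert r S)) := by rw [e1]; simp [hx']
      refine ⟨⟨(x, b' + 1), Or.inr ⟨hyM, eU⟩⟩, fun μ d hμ hd => ?_⟩
      rw [← hμ] at hyM hyM' eU sy' sM e1 ⊢
      have eD : s (insert l (insert r (insert b (insert t S)))) \ μ =
          {(x, b' + 1), (x + 1, b' + 1)} := by
        rw [eU]; ext z; simp only [Set.mem_sdiff, Set.mem_insert_iff, Set.mem_singleton_iff]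
        grind
      rw [eD]
      rcases h2 with ⟨-, e2⟩ | ⟨-, e2⟩
      · have hb1 : (a, b' + 1) ∉ s S := fun hh => hp (sS _ _ _ _ hh le_rfl (by simp))
        have hyb : x = a := by
          refine eq_of_same_col (A := insert (a, b') (s S)) (a := b' + 1) (by simp [hx])
            (by simp [hb1]) sx (e2 ▸ sN)
        subst hyb
        have ed : d = {(x, b'), (x, b' + 1)} := by
          rw [← Finset.coe_inj, hd, e2]; ext z
          simp only [Set.mem_sdiff, Set.mem_insert_iff, Finset.coe_insert, Finset.coe_singleton,
            Set.mem_singleton_iff]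
          grind
        have hm1 : (x, b') ∈ μ := by rw [← Finset.mem_coe, e1]; simp
        have hm2 : (x, b' + 1) ∉ μ := by simpa using hyM
        have i1 : d ∩ μ = {(x, b')} := by rw [ed]; ext z; simp; grind
        have i2 : d \ μ = {(x, b' + 1)} := by rw [ed]; ext z; simp; grind
        have hsub : ¬ d ⊆ μ := fun hh => hm2 (hh (by rw [ed]; simp))
        rw [bump, i1, if_neg (by simp), if_neg hsub, i2]
        simp
      · have hb1 : (a + 1, b') ∉ s S := fun hh => hp (sS _ _ _ _ hh (by simp) le_rfl)
        have ed : d = {(a, b'), (a + 1, b')} := by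
          rw [← Finset.coe_inj, hd, e2]; ext z
          simp only [Set.mem_sdiff, Set.mem_insert_iff, Finset.coe_insert, Finset.coe_singleton,
            Set.mem_singleton_iff]
          grind
        have hsub : d ⊆ μ := by
          rw [ed, ← Finset.coe_subset, e1]
          intro z; simp; tauto
        have hne : d ∩ μ ≠ ∅ := by
          rw [Finset.inter_eq_left.2 hsub, ed]; simp
        have f1 : d.filter (fun c => (c.1, c.2 + 1) ∈ d) = ∅ := by
          rw [ed]; ext ⟨u, v⟩; simp; omega
        have f2 : d.filter (fun c => (c.1 + 1, c.2) ∈ d) = {(a, b')} := by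
          rw [ed]; ext ⟨u, v⟩; simp; omega
        rw [bump, if_neg hne, if_pos hsub, f1, f2]
        simp [verticalAt_eq sM sy' (by simpa using hyM)]
  · obtain ⟨fl, fr, fb, ft⟩ := F
    have hdis : ∀ z, z ∈ s (insert b (insert t S)) → z ∉ s S → z ∉ s (insert l (insert r S)) :=
      fun z => h1.notMem_of_ne h2 sS sM sN hpq
    have sub : ∀ {X Y : Finset ι}, (∀ z, z ∈ X → z ∈ Y) → X ⊆ Y := fun h => h
    obtain ⟨c1, -, e1⟩ := h.inverse.box_above (insert l (insert r S)) t
      (ft.mono (sub (by simp only [Finset.mem_insert]; tauto)))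
    obtain ⟨c2, -, e2⟩ := h.inverse.box_below (insert t (insert l (insert r S))) b
      (fb.mono (sub (by simp only [Finset.mem_insert]; tauto)))
    obtain ⟨c3, -, e3⟩ := h.box_above (insert b (insert t S)) r
      (fr.mono (sub (by simp only [Finset.mem_insert]; tauto)))
    obtain ⟨c4, -, e4⟩ := h.box_below (insert r (insert b (insert t S))) l fl
    have perm : insert b (insert t (insert l (insert r S))) =
        insert l (insert r (insert b (insert t S))) := by
      ext z; simp only [Finset.mem_insert]; tauto
    rw [perm, e1] at e2
    rw [e3] at e4
    obtain ⟨hq, q', hq', hqA', e⟩ := h2.mem_iff sS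
    have hqq : q ≠ q' := by rcases hq' with rfl | rfl <;> simp [Prod.ext_iff]
    have m1 := hdis q (by rw [e]; simp) hq
    have m2 := hdis q' (by rw [e]; simp) hqA'
    have n1 : q ∈ s (insert l (insert r (insert b (insert t S)))) := by rw [e4, e]; simp
    have n2 : q' ∈ s (insert l (insert r (insert b (insert t S)))) := by rw [e4, e]; simp
    -- The last two points add just two squares, and the squares `q`, `q'` of the old domino are
    -- present in the large shape and missing before.
    have eU : s (insert l (insert r (insert b (insert t S)))) =
        insert q' (insert q (s (insert l (insert r S)))) := by
      rw [e2] at n1 n2 ⊢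
      grind
    constructor
    · refine ⟨q, ?_⟩
      rcases hq' with rfl | rfl
      · exact Or.inl ⟨m1, eU⟩
      · exact Or.inr ⟨m1, eU⟩
    · intro μ d hμ hd
      have hd0 : d ∩ μ = ∅ := by
        rw [← Finset.disjoint_iff_inter_eq_empty, ← Finset.disjoint_coe, hd, hμ]
        exact Set.disjoint_left.2 fun z hz => hdis z hz.1 hz.2
      rw [bump, if_pos hd0, hd, eU, e]
      ext z
      simp only [Set.mem_sdiff, Set.mem_insert_iff]
      grind

end Growth
/-! ### Schensted insertion and the largest letter -/

section Schensted

variable {α : Type} [LinearOrder α]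

/-- Add the letter `t` at the end of row `i`. -/
def addEnd {γ : Type} (t : γ) : ℕ → List (List γ) → List (List γ)
  | _, [] => [[t]]
  | 0, R :: Rs => (R ++ [t]) :: Rs
  | i + 1, R :: Rs => R :: addEnd t i Rs

/-- The row in which the insertion of `a` ends. -/
def insRow : α → List (List α) → ℕ
  | _, [] => 0
  | a, R :: Rs =>
    match (rowInsert a R).2 with
    | none => 0
    | some b => insRow b Rs + 1

theorem rowInsert_none {a : α} {R : List α} (h : (rowInsert a R).2 = none) :
    (rowInsert a R).1 = R ++ [a] ∧ ∀ x ∈ R, x ≤ a := by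
  induction R with
  | nil => simp [rowInsert]
  | cons b R ih =>
    simp only [rowInsert] at h ⊢
    split_ifs at h ⊢ with hab
    simp only at h ⊢
    obtain ⟨h1, h2⟩ := ih h
    simpa [h1, not_lt.1 hab] using h2

/-- If `a` would come at the end of `R`, it meets `t` there and bumps it; otherwise it is stopped
earlier and does not reach `t`. -/
theorem rowInsert_append {a t : α} (hat : a < t) {R : List α} :
    rowInsert a (R ++ [t]) =
      match (rowInsert a R).2 with
      | none => (R ++ [a], some t)
      | some b => ((rowInsert a R).1 ++ [t], some b) := by
  induction R with
  | nil => simp [rowInsert, hat]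
  | cons b R ih =>
    simp only [List.cons_append, rowInsert]
    split_ifs with hab
    · rfl
    · rw [ih]
      rcases h : (rowInsert a R).2 with _ | c <;> simp

theorem rowInsert_some_mem {a b : α} {R : List α} (h : (rowInsert a R).2 = some b) : b ∈ R := by
  induction R with
  | nil => simp [rowInsert] at h
  | cons c R ih =>
    simp only [rowInsert] at h
    split_ifs at h with hac
    · simp only [Option.some.injEq] at h
      simp [h]
    · exact List.mem_cons_of_mem _ (ih h)

theorem length_rowInsert_some {a b : α} {R : List α} (h : (rowInsert a R).2 = some b) :
    (rowInsert a R).1.length = R.length := by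
  induction R with
  | nil => simp [rowInsert] at h
  | cons c R ih =>
    simp only [rowInsert] at h ⊢
    split_ifs at h ⊢ with hac
    · rfl
    · simpa using ih h

theorem mem_rowInsert {a x : α} {R : List α} (h : x ∈ (rowInsert a R).1) : x = a ∨ x ∈ R := by
  induction R with
  | nil => simpa [rowInsert] using h
  | cons c R ih =>
    simp only [rowInsert] at h
    split_ifs at h with hac
    · simp only [List.mem_cons] at h ⊢; tauto
    · simp only [List.mem_cons] at h ⊢; tauto

theorem schenstedInsert_none {a : α} {R : List α} (Rs : List (List α))
    (h : (rowInsert a R).2 = none) : schenstedInsert a (R :: Rs) = (R ++ [a]) :: Rs := by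
  have h1 := (rowInsert_none h).1
  rw [schenstedInsert]
  rcases e : rowInsert a R with ⟨R', o⟩
  rw [e] at h h1
  simp only at h h1
  subst h h1
  rfl

theorem schenstedInsert_some {a b : α} {R : List α} (Rs : List (List α))
    (h : (rowInsert a R).2 = some b) :
    schenstedInsert a (R :: Rs) = (rowInsert a R).1 :: schenstedInsert b Rs := by
  rw [schenstedInsert]
  rcases e : rowInsert a R with ⟨R', o⟩
  rw [e] at h
  simp only at h
  subst h
  rfl

theorem mem_schenstedInsert {Rs : List (List α)} {a x : α} {R : List α}
    (hR : R ∈ schenstedInsert a Rs) (hx : x ∈ R) : x = a ∨ ∃ R ∈ Rs, x ∈ R := by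
  induction Rs generalizing a R with
  | nil =>
    simp only [schenstedInsert, List.mem_singleton] at hR
    subst hR
    simpa using hx
  | cons R0 Rs ih =>
    rcases h : (rowInsert a R0).2 with _ | b
    · rw [schenstedInsert_none _ h] at hR
      rcases List.mem_cons.1 hR with rfl | hR
      · rcases List.mem_append.1 hx with hx | hx
        · exact Or.inr ⟨R0, by simp, hx⟩
        · exact Or.inl (by simpa using hx)
      · exact Or.inr ⟨R, by simp [hR], hx⟩
    · rw [schenstedInsert_some _ h] at hR
      rcases List.mem_cons.1 hR with rfl | hR
      · rcases mem_rowInsert hx with hx | hx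
        · exact Or.inl hx
        · exact Or.inr ⟨R0, by simp, hx⟩
      · rcases ih hR hx with rfl | ⟨R', hR', hx'⟩
        · exact Or.inr ⟨R0, by simp, rowInsert_some_mem h⟩
        · exact Or.inr ⟨R', by simp [hR'], hx'⟩

/-- A letter larger than all the others is inserted at the end of the first row. -/
theorem schenstedInsert_top {t : α} {Rs : List (List α)} (h : ∀ R ∈ Rs, ∀ x ∈ R, x < t) :
    schenstedInsert t Rs = addEnd t 0 Rs := by
  cases Rs with
  | nil => rfl
  | cons R Rs =>
    rw [schenstedInsert_none]
    · rfl
    rcases hn : (rowInsert t R).2 with _ | b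
    · rfl
    · exfalso
      have hR := h R (by simp)
      clear h
      induction R with
      | nil => simp [rowInsert] at hn
      | cons c R ih =>
        simp only [rowInsert, if_neg (hR c (by simp)).not_gt] at hn
        exact ih hn fun x hx => hR x (by simp [hx])

/-- Insertion of `a` in a tableau with an additional largest letter `t`. -/
theorem schenstedInsert_addEnd {a t : α} {Rs : List (List α)} (i : ℕ) (hi : i ≤ Rs.length)
    (hat : a < t) (h : ∀ R ∈ Rs, ∀ x ∈ R, x < t) :
    schenstedInsert a (addEnd t i Rs) =
      addEnd t (if insRow a Rs = i then i + 1 else i) (schenstedInsert a Rs) := by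
  induction Rs generalizing a i with
  | nil =>
    obtain rfl : i = 0 := by simpa using hi
    simp [addEnd, schenstedInsert, insRow, rowInsert, hat]
  | cons R Rs ih =>
    have hRs : ∀ R ∈ Rs, ∀ x ∈ R, x < t := fun R' hR' => h R' (by simp [hR'])
    cases i with
    -- If the insertion ends in the row of `t`, it bumps `t`, which goes to the end of the next row,
    -- being largest. This is the coincidence case of the row rule.
    | zero =>
      have hap := rowInsert_append hat (R := R)
      rcases hn : (rowInsert a R).2 with _ | b
      · simp only [hn] at hap
        rw [schenstedInsert_none _ hn, addEnd, schenstedInsert_some (b := t) _ (by rw [hap]),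
          hap, schenstedInsert_top hRs]
        simp [insRow, hn, addEnd]
      · simp only [hn] at hap
        rw [schenstedInsert_some _ hn, addEnd, schenstedInsert_some (b := b) _ (by rw [hap]), hap]
        simp [insRow, hn, addEnd]
    | succ i =>
      rcases hn : (rowInsert a R).2 with _ | b
      · rw [schenstedInsert_none _ hn, addEnd, schenstedInsert_none _ hn]
        simp [insRow, hn, addEnd]
      · have hbt : b < t := h R (by simp) b (rowInsert_some_mem hn)
        rw [schenstedInsert_some _ hn, addEnd, schenstedInsert_some _ hn,
          ih i (by simpa using hi) hbt hRs]
        simp only [insRow, hn, Nat.add_right_cancel_iff]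
        split_ifs <;> rfl

/-- The length of row `i`. -/
def rowLength {γ : Type} (Rs : List (List γ)) (i : ℕ) : ℕ := (Rs.getD i []).length

/-- The set of squares of a filling. -/
def Filling.support {γ : Type} (F : Filling γ) : Set (ℕ × ℕ) := {c | F c ≠ ⊥}

theorem mem_support_fillingOfRows {γ : Type} (Rs : List (List γ)) (i j : ℕ) :
    (i, j) ∈ Filling.support (fillingOfRows Rs) ↔ j < rowLength Rs i := by
  simp only [Filling.support, fillingOfRows, rowLength, Set.mem_ofPred_eq, List.getD]
  rcases h : Rs[i]? with _ | R
  · simp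
  · rcases h' : R[j]? with _ | x
    · simpa [h'] using List.getElem?_eq_none_iff.1 h'
    · simpa [h'] using (List.getElem?_eq_some_iff.1 h').1

theorem rowLength_schenstedInsert (a : α) (Rs : List (List α)) (i : ℕ) :
    rowLength (schenstedInsert a Rs) i =
      if i = insRow a Rs then rowLength Rs i + 1 else rowLength Rs i := by
  induction Rs generalizing a i with
  | nil => cases i <;> simp [rowLength, schenstedInsert, insRow]
  | cons R Rs ih =>
    rcases hn : (rowInsert a R).2 with _ | b
    · rw [schenstedInsert_none _ hn]
      cases i <;> simp [rowLength, insRow, hn]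
    · rw [schenstedInsert_some _ hn]
      cases i with
      | zero => simp [rowLength, insRow, hn, length_rowInsert_some hn]
      | succ i => simpa [rowLength, insRow, hn] using ih b i

/-- These bounds keep the row index in `addEnd` at most the number of rows; for a larger index
`addEnd` would create its new row too early. -/
theorem length_schenstedInsert (a : α) (Rs : List (List α)) :
    Rs.length ≤ (schenstedInsert a Rs).length ∧
      (insRow a Rs = Rs.length → Rs.length + 1 ≤ (schenstedInsert a Rs).length) := by
  induction Rs generalizing a with
  | nil => simp [schenstedInsert]
  | cons R Rs ih =>
    rcases hn : (rowInsert a R).2 with _ | b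
    · rw [schenstedInsert_none _ hn]
      simp [insRow, hn]
    · rw [schenstedInsert_some _ hn]
      simpa [insRow, hn] using ih b

theorem fillingOfRows_addEnd {γ : Type} (t : γ) (i : ℕ) (Rs : List (List γ)) (hi : i ≤ Rs.length) :
    fillingOfRows (addEnd t i Rs) =
      Function.update (fillingOfRows Rs) (i, rowLength Rs i) (t : WithBot γ) := by
  induction Rs generalizing i with
  | nil =>
    obtain rfl : i = 0 := by simpa using hi
    ext ⟨x, y⟩ : 1
    simp only [Function.update_apply, fillingOfRows, addEnd, rowLength]
    cases x <;> cases y <;> simp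
  | cons R Rs ih =>
    cases i with
    | zero =>
      ext ⟨x, y⟩ : 1
      simp only [Function.update_apply, fillingOfRows, addEnd, rowLength]
      cases x with
      | zero =>
        simp only [List.getElem?_cons_zero, Option.bind_some, List.getD_cons_zero]
        rcases lt_trichotomy y R.length with h | h | h
        · rw [List.getElem?_append_left h, if_neg (by simp; omega)]
        · subst h; simp
        · rw [List.getElem?_eq_none (by simp; omega), List.getElem?_eq_none (by omega),
            if_neg (by simp; omega)]
      | succ x => simp
    | succ i =>
      have := ih i (by simpa using hi)
      ext ⟨x, y⟩ : 1
      cases x with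
      | zero => simp [fillingOfRows, addEnd]
      | succ x =>
        have h2 := congrFun this (x, y)
        simp only [fillingOfRows, addEnd, rowLength, Function.update_apply, Prod.mk.injEq,
          List.getElem?_cons_succ, List.getD_cons_succ, Nat.add_right_cancel_iff] at h2 ⊢
        exact h2

end Schensted

/-! ### Robinson–Schensted shapes of subwords -/

section Points

variable {ι α : Type} [LinearOrder ι] [LinearOrder α]

/-- The rows of the insertion tableau of a word. -/
def rsRows (u : List α) : List (List α) := u.foldl (fun Rs a => schenstedInsert a Rs) []

/-- The word of the values of `v` on a finite set, in increasing order of the positions. -/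
def wordOn (v : ι → α) (S : Finset ι) : List α := (S.sort (· ≤ ·)).map v

/-- The Robinson–Schensted shape of the word of `v` on a finite set of positions. -/
def rsShape (v : ι → α) (S : Finset ι) : Set (ℕ × ℕ) :=
  Filling.support (schensted (wordOn v S))

theorem sort_insert_of_above {S : Finset ι} {p : ι} (h : Above id S p) :
    (insert p S).sort (· ≤ ·) = S.sort (· ≤ ·) ++ [p] := by
  have hp : p ∉ S := fun hh => lt_irrefl _ (h p hh)
  refine List.Perm.eq_of_pairwise (le := (· ≤ ·)) (fun a b _ _ => le_antisymm)
    (Finset.pairwise_sort _ _) ?_ ?_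
  · rw [List.pairwise_append]
    refine ⟨Finset.pairwise_sort _ _, by simp, ?_⟩
    intro a ha b hb
    simp only [List.mem_singleton] at hb
    subst hb
    exact (h a (by simpa using ha)).le
  · rw [← Multiset.coe_eq_coe, Finset.sort_eq, Finset.insert_val_of_notMem hp,
      ← Multiset.coe_add, Finset.sort_eq, Multiset.coe_singleton, Multiset.add_comm]
    rfl

theorem rsRows_insert (v : ι → α) {S : Finset ι} {p : ι} (h : Above id S p) :
    rsRows (wordOn v (insert p S)) = schenstedInsert (v p) (rsRows (wordOn v S)) := by
  simp [rsRows, wordOn, sort_insert_of_above h]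

theorem mem_rsRows {u : List α} {R : List α} {x : α} (hR : R ∈ rsRows u) (hx : x ∈ R) :
    x ∈ u := by
  induction u using List.reverseRecOn generalizing R with
  | nil => simp [rsRows] at hR
  | append_singleton u a ih =>
    simp only [rsRows, List.foldl_append, List.foldl_cons, List.foldl_nil] at hR
    rcases mem_schenstedInsert hR hx with rfl | ⟨R', hR', hx'⟩
    · simp
    · simp [ih hR' hx']

theorem rsRows_lt {v : ι → α} {S : Finset ι} {q : ι} (hq : Above v S q) :
    ∀ R ∈ rsRows (wordOn v S), ∀ x ∈ R, x < v q := by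
  intro R hR x hx
  have := mem_rsRows hR hx
  simp only [wordOn, List.mem_map, Finset.mem_sort] at this
  obtain ⟨z, hz, rfl⟩ := this
  exact hq z hz

/-- The largest letter of a word is at the end of a row of the insertion tableau, and the rest
of the tableau is the insertion tableau of the word without it. -/
theorem exists_rsRows_insert_top {v : ι → α} {S : Finset ι} {q : ι} (hq : Above v S q) :
    ∃ i ≤ (rsRows (wordOn v S)).length,
      rsRows (wordOn v (insert q S)) = addEnd (v q) i (rsRows (wordOn v S)) := by
  induction S using Finset.induction_on_max with
  | empty => exact ⟨0, by simp, by simp [wordOn, rsRows, schenstedInsert, addEnd]⟩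
  | insert p S hp ih =>
    have hpq : p ≠ q := by
      rintro rfl
      exact lt_irrefl _ (hq p (Finset.mem_insert_self _ _))
    have hpS : Above id S p := hp
    have hq' : Above v S q := hq.mono (Finset.subset_insert _ _)
    have hvp : v p < v q := hq p (Finset.mem_insert_self _ _)
    by_cases hlast : Above id (insert p S) q
    · refine ⟨0, by simp, ?_⟩
      rw [rsRows_insert v hlast, schenstedInsert_top (rsRows_lt hq)]
    · have hqp : q < p := by
        rcases lt_or_gt_of_ne hpq with h | h
        · refine absurd (fun z hz => ?_) hlast
          rcases Finset.mem_insert.1 hz with rfl | hz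
          · exact h
          · exact (hp z hz).trans h
        · exact h
      obtain ⟨i, hi, e⟩ := ih hq'
      have hab : Above id (insert q S) p := hpS.insert hqp
      rw [Finset.insert_comm, rsRows_insert v hab, e, rsRows_insert v hpS,
        schenstedInsert_addEnd i hi hvp (rsRows_lt hq')]
      refine ⟨_, ?_, rfl⟩
      have h1 := length_schenstedInsert (v p) (rsRows (wordOn v S))
      split_ifs with h
      · rcases hi.lt_or_eq with h2 | h2
        · omega
        · have := h1.2 (h.trans h2); omega
      · omega

/-- One step of the chain of shapes ordered by value: the largest letter occupies exactly the new
square, and all other entries are unchanged. -/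
theorem rsShape_insert_top {v : ι → α} {S : Finset ι} {q : ι} (hq : Above v S q) :
    ∃ c, c ∉ rsShape v S ∧ rsShape v (insert q S) = insert c (rsShape v S) ∧
      schensted (wordOn v (insert q S)) =
        Function.update (schensted (wordOn v S)) c (v q : WithBot α) := by
  obtain ⟨i, hi, e⟩ := exists_rsRows_insert_top hq
  have e2 : schensted (wordOn v (insert q S)) =
      Function.update (schensted (wordOn v S)) (i, rowLength (rsRows (wordOn v S)) i)
        (v q : WithBot α) := by
    change fillingOfRows (rsRows _) = Function.update (fillingOfRows (rsRows _)) _ _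
    rw [e, fillingOfRows_addEnd _ _ _ hi]
  refine ⟨_, ?_, ?_, e2⟩
  · exact fun hh => lt_irrefl _ ((mem_support_fillingOfRows (rsRows (wordOn v S)) _ _).1 hh)
  · ext c
    simp only [rsShape, Filling.support, e2, Set.mem_ofPred_eq, Function.update_apply,
      Set.mem_insert_iff]
    split_ifs with h <;> simp [h]

theorem support_schenstedInsert (a : α) (Rs : List (List α)) :
    Filling.support (fillingOfRows (schenstedInsert a Rs)) =
      insert (insRow a Rs, rowLength Rs (insRow a Rs)) (Filling.support (fillingOfRows Rs)) := by
  ext ⟨i, j⟩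
  simp only [Set.mem_insert_iff, mem_support_fillingOfRows, rowLength_schenstedInsert,
    Prod.mk.injEq]
  split_ifs with h
  · subst h; simp; omega
  · simp [h]

theorem support_addEnd {γ : Type} (t : γ) (i : ℕ) (Rs : List (List γ)) (hi : i ≤ Rs.length) :
    Filling.support (fillingOfRows (addEnd t i Rs)) =
      insert (i, rowLength Rs i) (Filling.support (fillingOfRows Rs)) := by
  ext c
  simp only [Filling.support, fillingOfRows_addEnd t i Rs hi, Set.mem_ofPred_eq,
    Function.update_apply, Set.mem_insert_iff]
  split_ifs with h <;> simp [h]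

/-- The row rule for Robinson–Schensted shapes, with a precise form of the second case. -/
theorem rsShape_row {v : ι → α} {S : Finset ι} {p q : ι} (hp : Above id (insert q S) p)
    (hq : Above v (insert p S) q) :
    ∃ c d, c ∉ rsShape v S ∧ d ∉ rsShape v S ∧ rsShape v (insert p S) = insert c (rsShape v S) ∧
      rsShape v (insert q S) = insert d (rsShape v S) ∧
      ((c ≠ d ∧ rsShape v (insert p (insert q S)) = insert c (insert d (rsShape v S))) ∨
        (c = d ∧ ∃ y, (∀ z, (c.1 + 1, z) ∈ rsShape v (insert p S) ↔ z < y) ∧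
          rsShape v (insert p (insert q S)) =
            insert (c.1 + 1, y) (rsShape v (insert p S)))) := by
  have hp' : Above id S p := hp.mono (Finset.subset_insert _ _)
  have hq' : Above v S q := hq.mono (Finset.subset_insert _ _)
  obtain ⟨i, hi, e⟩ := exists_rsRows_insert_top hq'
  have ep := rsRows_insert v hp'
  have epq := rsRows_insert v hp
  have hvp : v p < v q := hq p (Finset.mem_insert_self _ _)
  have eadd := schenstedInsert_addEnd i hi hvp (rsRows_lt hq')
  rw [e] at epq
  have hdef : ∀ X, rsShape v X = Filling.support (fillingOfRows (rsRows (wordOn v X))) :=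
    fun _ => rfl
  simp only [hdef]
  rw [epq, ep, e]
  set Rs := rsRows (wordOn v S)
  have hl := length_schenstedInsert (v p) Rs
  refine ⟨_, _, ?_, ?_, support_schenstedInsert (v p) Rs, support_addEnd _ _ _ hi, ?_⟩
  · simp [mem_support_fillingOfRows]
  · simp [mem_support_fillingOfRows]
  by_cases h : insRow (v p) Rs = i
  · right
    refine ⟨by rw [h], rowLength (schenstedInsert (v p) Rs) (i + 1), ?_, ?_⟩
    · intro z
      rw [mem_support_fillingOfRows, h]
    · rw [eadd, if_pos h, support_addEnd _ _ _ (by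
        rcases hi.lt_or_eq with h2 | h2
        · omega
        · exact (h2 ▸ hl.2 (h.trans h2))), h]
  · left
    refine ⟨by simp [h], ?_⟩
    rw [eadd, if_neg h, support_addEnd _ _ _ (by omega), support_schenstedInsert,
      rowLength_schenstedInsert, if_neg (Ne.symm h), Set.insert_comm]

theorem rsShape_empty (v : ι → α) : rsShape v ∅ = ∅ := by
  ext c
  simp [rsShape, wordOn, schensted, Filling.support, fillingOfRows]

theorem rsShape_corner {v : ι → α} {S : Finset ι} {p : ι} (hp : Above id S p)
    (hq : Above v S p) : ∃ y, (∀ z, (0, z) ∈ rsShape v S ↔ z < y) ∧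
      rsShape v (insert p S) = insert (0, y) (rsShape v S) := by
  refine ⟨rowLength (rsRows (wordOn v S)) 0, fun z => mem_support_fillingOfRows _ _ _, ?_⟩
  change Filling.support (fillingOfRows (rsRows _)) =
    insert _ (Filling.support (fillingOfRows (rsRows _)))
  rw [rsRows_insert v hp, schenstedInsert_top (rsRows_lt hq), support_addEnd _ _ _ (by simp)]

/-- Remove the last point and the point of largest value. If they add different squares, the shape
is a union of two smaller ones. If they add the same square `c`, the bumped square ends the next row
and cannot lie to the right of `c`, since the square below `c` is not yet there. -/
theorem isShape_rsShape {v : ι → α} (hv : Function.Injective v) (S : Finset ι) :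
    IsShape (rsShape v S) := by
  induction S using Finset.strongInduction with
  | H S ih =>
    rcases S.eq_empty_or_nonempty with rfl | hS
    · rw [rsShape_empty]
      intro a b a' b' h
      exact absurd h (by simp)
    obtain ⟨p, hp, hP⟩ := exists_above (Function.injective_id (α := ι)) hS
    obtain ⟨q, hq, hQ⟩ := exists_above hv hS
    by_cases hpq : p = q
    · subst hpq
      obtain ⟨y, hy, e⟩ := rsShape_corner hP hQ
      have h0 := ih _ (Finset.erase_ssubset hp)
      rw [Finset.insert_erase hp] at e
      rw [e]
      intro a b a' b' h ha hb
      rcases h with h | h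
      · obtain ⟨rfl, rfl⟩ := Prod.mk.inj h
        obtain rfl : a' = 0 := by omega
        rcases hb.lt_or_eq with hb | rfl
        · exact Or.inr ((hy b').2 hb)
        · exact Or.inl rfl
      · exact Or.inr (h0 _ _ _ _ h ha hb)
    · have hqp : q ∈ S.erase p := Finset.mem_erase.2 ⟨Ne.symm hpq, hq⟩
      have e1 : insert q ((S.erase p).erase q) = S.erase p := Finset.insert_erase hqp
      have e2 : insert p ((S.erase p).erase q) = S.erase q := by
        rw [Finset.erase_right_comm]
        exact Finset.insert_erase (Finset.mem_erase.2 ⟨hpq, hp⟩)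
      obtain ⟨c, d, hc, hd, f1, f2, h⟩ := rsShape_row (v := v) (S := (S.erase p).erase q)
        (p := p) (q := q) (by rwa [e1]) (by rwa [e2])
      rw [e1, Finset.insert_erase hp, e2] at h
      rw [e1] at f2
      rw [e2] at f1
      have i0 := ih _ ((Finset.erase_ssubset hqp).trans (Finset.erase_ssubset hp))
      have i1 := ih _ (Finset.erase_ssubset hp)
      have i2 := ih _ (Finset.erase_ssubset hq)
      rcases h with ⟨-, h⟩ | ⟨rfl, y, hy, h⟩
      · have : rsShape v S = rsShape v (S.erase q) ∪ rsShape v (S.erase p) := by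
          rw [h, f1, f2]; grind
        rw [this]
        exact i2.union i1
      · rw [h]
        obtain ⟨a0, b0⟩ := c
        simp only at hy h ⊢
        intro a b a' b' hm ha hb
        rcases hm with hm | hm
        · obtain ⟨rfl, rfl⟩ := Prod.mk.inj hm
          rcases hb.lt_or_eq with hb' | rfl
          · exact Or.inr (i2 _ _ _ _ ((hy b').2 hb') ha le_rfl)
          · rcases ha.lt_or_eq with ha' | rfl
            · right
              have hb0 : b' ≤ b0 := by
                by_contra hcon
                have h3 := (hy b0).2 (by omega)
                rw [f1] at h3
                exact hc (i0 _ _ a0 b0 (h3.resolve_left (by simp)) (by omega) le_rfl)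
              exact i2 a0 b0 a' b' (by rw [f1]; simp) (by omega) hb0
            · exact Or.inl rfl
        · exact Or.inr (i2 _ _ _ _ hm ha hb)

/-- Robinson–Schensted shapes grow according to the local rules. -/
theorem rowGrowth_rsShape {v : ι → α} (hv : Function.Injective v) :
    RowGrowth (rsShape v) id v where
  inj_left := Function.injective_id
  inj_right := hv
  shape := isShape_rsShape hv
  empty := rsShape_empty v
  row S p q hp hq := by
    obtain ⟨c, d, hc, hd, e1, e2, h⟩ := rsShape_row hp hq
    refine ⟨c, d, hc, hd, e1, e2, h.imp id ?_⟩
    rintro ⟨rfl, y, hy, e⟩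
    exact ⟨rfl, y, fun hh => lt_irrefl _ ((hy y).1 hh), e⟩
  corner S p hp hq := by
    obtain ⟨y, hy, e⟩ := rsShape_corner hp hq
    exact ⟨y, fun hh => lt_irrefl _ ((hy y).1 hh), e⟩

end Points
/-! ### Tableaux as chains of shapes -/

/-- The tableau attached to the chain of the shapes of the lower parts of a finite set of points
(with respect to `g`), where the square added by the point `p` is filled by `lab p`. -/
inductive IsTab {ι β γ : Type} [DecidableEq ι] [LinearOrder β] (s : Finset ι → Set (ℕ × ℕ))
    (g : ι → β) (lab : ι → γ) : Finset ι → Filling γ → Prop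
  | nil : IsTab s g lab ∅ (fun _ => ⊥)
  | step {S : Finset ι} {F : Filling γ} (p : ι) (c : ℕ × ℕ) (hF : IsTab s g lab S F)
      (hp : Above g S p) (hc : c ∉ s S) (hs : s (insert p S) = insert c (s S)) :
      IsTab s g lab (insert p S) (Function.update F c (lab p : WithBot γ))

section Tab

variable {ι β γ : Type} [DecidableEq ι] [LinearOrder β] {s s' : Finset ι → Set (ℕ × ℕ)}
  {g : ι → β} {lab : ι → γ}

theorem IsTab.support_eq {S : Finset ι} {F : Filling γ} (h : IsTab s g lab S F) (h0 : s ∅ = ∅) :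
    F.support = s S := by
  induction h with
  | nil => rw [h0]; ext c; simp [Filling.support]
  | step p c hF hp hc hs ih =>
    rw [hs, ← ih]
    ext d
    simp only [Filling.support, Set.mem_ofPred_eq, Function.update_apply, Set.mem_insert_iff]
    split_ifs with h <;> simp [h]

theorem IsTab.eq_bot {S : Finset ι} {F : Filling γ} (h : IsTab s g lab S F) (h0 : s ∅ = ∅)
    {c : ℕ × ℕ} (hc : c ∉ s S) : F c = ⊥ := by
  rw [← h.support_eq h0] at hc
  simpa [Filling.support] using hc

theorem IsTab.exists_of_eq {S : Finset ι} {F : Filling γ} (h : IsTab s g lab S F) {c : ℕ × ℕ}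
    {x : γ} (hx : F c = x) : ∃ p ∈ S, x = lab p := by
  induction h with
  | nil => simp at hx
  | step p d hF hp hc hs ih =>
    rw [Function.update_apply] at hx
    split_ifs at hx with h
    · exact ⟨p, Finset.mem_insert_self _ _, (WithBot.coe_injective hx).symm⟩
    · obtain ⟨q, hq, e⟩ := ih hx
      exact ⟨q, Finset.mem_insert_of_mem hq, e⟩

theorem insert_inj_of_above {S S' : Finset ι} {p p' : ι} (h : Above g S p) (h' : Above g S' p')
    (e : insert p S = insert p' S') : p = p' ∧ S = S' := by
  have hp : p ∉ S := fun hh => lt_irrefl _ (h p hh)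
  have hp' : p' ∉ S' := fun hh => lt_irrefl _ (h' p' hh)
  have hpp : p = p' := by
    by_contra hne
    have h1 : p ∈ insert p' S' := e ▸ Finset.mem_insert_self _ _
    have h2 : p' ∈ insert p S := e ▸ Finset.mem_insert_self _ _
    have h3 := h p' ((Finset.mem_insert.1 h2).resolve_left (Ne.symm hne))
    have h4 := h' p ((Finset.mem_insert.1 h1).resolve_left hne)
    exact lt_asymm h3 h4
  subst hpp
  refine ⟨rfl, ?_⟩
  rw [← Finset.erase_insert hp, e, Finset.erase_insert hp']

theorem IsTab.of_insert {S : Finset ι} {F : Filling γ} {p : ι}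
    (h : IsTab s g lab (insert p S) F) (hp : Above g S p) :
    ∃ c F', IsTab s g lab S F' ∧ c ∉ s S ∧ s (insert p S) = insert c (s S) ∧
      F = Function.update F' c (lab p : WithBot γ) := by
  generalize hX : insert p S = X at h
  cases h with
  | nil => exact absurd hX (Finset.insert_ne_empty _ _)
  | step q c hF hq hc hs =>
    obtain ⟨rfl, rfl⟩ := insert_inj_of_above hp hq hX
    exact ⟨c, _, hF, hc, hs, rfl⟩

/-- Reduces an equality of tableaux to the statement that both belong to the same chain of shapes.
-/
theorem IsTab.unique {S : Finset ι} {F F' : Filling γ} (h : IsTab s g lab S F)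
    (h' : IsTab s g lab S F') : F = F' := by
  induction h generalizing F' with
  | nil =>
    generalize hX : (∅ : Finset ι) = X at h'
    cases h' with
    | nil => rfl
    | step q c hF hq hc hs => exact absurd hX.symm (Finset.insert_ne_empty _ _)
  | step p c hF hp hc hs ih =>
    obtain ⟨d, F1, h1, hd, hs', rfl⟩ := h'.of_insert hp
    rw [ih h1]
    rw [eq_of_mem_insert hs' (by rw [hs]; exact Set.mem_insert _ _) hc]

/-! ### Conversion of letters -/

section Swap

variable {γ : Type} [LinearOrder γ]

theorem entryAbove_update {γ : Type} (T : Filling γ) {t c : ℕ × ℕ} (h : ¬ t ≤ c)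
    (v : WithBot γ) : entryAbove (Function.update T t v) c = entryAbove T c := by
  rcases c with ⟨_ | a, b⟩
  · rfl
  · refine Function.update_of_ne ?_ _ _
    rintro rfl
    exact h (by simp)

theorem entryLeft_update {γ : Type} (T : Filling γ) {t c : ℕ × ℕ} (h : ¬ t ≤ c)
    (v : WithBot γ) : entryLeft (Function.update T t v) c = entryLeft T c := by
  rcases c with ⟨a, _ | b⟩
  · rfl
  · refine Function.update_of_ne ?_ _ _
    rintro rfl
    exact h (by simp)

theorem swapStep_snd_le (T : Filling γ) (c : ℕ × ℕ) : (swapStep (T, c)).2 ≤ c := by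
  simp only [swapStep]
  split_ifs <;> simp [Prod.le_def]

theorem swapStep_update (T : Filling γ) {t c : ℕ × ℕ} (h : ¬ t ≤ c) (v : WithBot γ) :
    swapStep (Function.update T t v, c) =
      (Function.update (swapStep (T, c)).1 t v, (swapStep (T, c)).2) := by
  have hct : c ≠ t := by rintro rfl; exact h le_rfl
  have h1 : (c.1 - 1, c.2) ≠ t := by rintro rfl; exact h (by simp [Prod.le_def])
  have h2 : (c.1, c.2 - 1) ≠ t := by rintro rfl; exact h (by simp [Prod.le_def])
  simp only [swapStep, entryAbove_update T h, entryLeft_update T h, Function.update_of_ne hct]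
  split_ifs
  · rfl
  · simp only [Prod.mk.injEq, and_true]
    rw [Function.update_comm hct.symm, Function.update_comm h1.symm]
  · simp only [Prod.mk.injEq, and_true]
    rw [Function.update_comm hct.symm, Function.update_comm h2.symm]

theorem swapStep_iterate_update (n : ℕ) (T : Filling γ) {t c : ℕ × ℕ} (h : ¬ t ≤ c)
    (v : WithBot γ) : (swapStep^[n] (Function.update T t v, c)) =
      (Function.update (swapStep^[n] (T, c)).1 t v, (swapStep^[n] (T, c)).2) := by
  induction n generalizing T c with
  | zero => rfl
  | succ n ih =>
    rw [Function.iterate_succ_apply, Function.iterate_succ_apply, swapStep_update T h,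
      ih _ fun hh => h (hh.trans (swapStep_snd_le T c))]

/-- A letter outside of the part above and to the left of `c` is not affected. -/
theorem replaceAndSwap_update (T : Filling γ) {t c : ℕ × ℕ} (h : ¬ t ≤ c) (v : WithBot γ)
    (b : γ) : replaceAndSwap (Function.update T t v) c b =
      Function.update (replaceAndSwap T c b) t v := by
  have hct : c ≠ t := by rintro rfl; exact h le_rfl
  rw [replaceAndSwap, Function.update_comm hct.symm, swapStep_iterate_update _ _ h]
  rfl

/-- The first swap, with the largest letter. -/
theorem replaceAndSwap_swap (T : Filling γ) {t e : ℕ × ℕ}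
    (he : e = (t.1 + 1, t.2) ∨ e = (t.1, t.2 + 1)) {a b : γ} (hT : ∀ c, T c < (a : WithBot γ))
    (hb : b < a) :
    replaceAndSwap (Function.update T t (a : WithBot γ)) e b =
      Function.update (replaceAndSwap T t b) e (a : WithBot γ) := by
  have het : ¬ e ≤ t := by rcases he with rfl | rfl <;> simp [Prod.le_def]
  have hne : e ≠ t := by rintro rfl; exact het le_rfl
  have hba : (b : WithBot γ) < a := WithBot.coe_lt_coe.2 hb
  have hsum : e.1 + e.2 = (t.1 + t.2) + 1 := by rcases he with rfl | rfl <;> simp <;> omega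
  have hbelow : ∀ d x, x ≠ e → x ≠ t → d = x →
      Function.update (Function.update T t (a : WithBot γ)) e (b : WithBot γ) d < a := by
    rintro d x h1 h2 rfl
    rw [Function.update_of_ne h1, Function.update_of_ne h2]
    exact hT d
  -- The letter `a` at `t` exceeds all entries of `T`, so it is the larger of the two neighbours of
  -- `e`, and the first swap goes to `t`.
  have key : swapStep (Function.update (Function.update T t (a : WithBot γ)) e
      (b : WithBot γ), e) = (Function.update (Function.update T t (b : WithBot γ)) e
        (a : WithBot γ), t) := by
    rcases he with rfl | rfl
    · have h1 : entryAbove (Function.update (Function.update T t (a : WithBot γ)) (t.1 + 1, t.2)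
          (b : WithBot γ)) (t.1 + 1, t.2) = a := by
        simp only [entryAbove]
        rw [Function.update_of_ne (by exact hne.symm)]
        exact Function.update_self _ _ _
      have h2 : entryLeft (Function.update (Function.update T t (a : WithBot γ)) (t.1 + 1, t.2)
          (b : WithBot γ)) (t.1 + 1, t.2) < a := by
        obtain ⟨x, y⟩ := t
        cases y with
        | zero => exact WithBot.bot_lt_coe a
        | succ y => exact hbelow _ _ (by simp) (by simp) rfl
      rw [swapStep]
      simp only [h1, Function.update_self]
      rw [if_neg (not_le.2 (hba.trans_le (le_max_left _ _))), if_pos h2]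
      simp only [Nat.add_sub_cancel, Prod.mk.eta, Function.update_idem, Prod.mk.injEq, and_true]
      rw [Function.update_comm hne, Function.update_idem]
    · have h1 : entryLeft (Function.update (Function.update T t (a : WithBot γ)) (t.1, t.2 + 1)
          (b : WithBot γ)) (t.1, t.2 + 1) = a := by
        simp only [entryLeft]
        rw [Function.update_of_ne (by exact hne.symm)]
        exact Function.update_self _ _ _
      have h2 : entryAbove (Function.update (Function.update T t (a : WithBot γ)) (t.1, t.2 + 1)
          (b : WithBot γ)) (t.1, t.2 + 1) < a := by
        obtain ⟨x, y⟩ := t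
        cases x with
        | zero => exact WithBot.bot_lt_coe a
        | succ x => exact hbelow _ _ (by simp) (by simp) rfl
      rw [swapStep]
      simp only [h1, Function.update_self]
      rw [if_neg (not_le.2 (hba.trans_le (le_max_right _ _))), if_neg h2.le.not_gt]
      simp only [Nat.add_sub_cancel, Prod.mk.eta, Function.update_idem, Prod.mk.injEq, and_true]
      rw [Function.update_comm hne, Function.update_idem]
  -- The square `e` is allotted one step more than `t`; this step is the swap just computed.
  rw [replaceAndSwap, hsum, Function.iterate_succ_apply, key, swapStep_iterate_update _ _ het]
  rfl

end Swap

/-- Converting the additional square of the shape of `insert b S` to the smallest letter `lab b`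
yields the tableau of `insert b S` from the tableau of `S`. -/
theorem IsTab.convert {α γ : Type} [LinearOrder α] [LinearOrder γ] {f : ι → α} {lab : ι → γ}
    (h : RowGrowth s g f) (hlab : ∀ p q, g p < g q → lab p < lab q) {S : Finset ι}
    {F : Filling γ} (hF : IsTab s g lab S F) {b : ι} (hb : Below g S b) {c : ℕ × ℕ}
    (hc : c ∉ s S) (hs : s (insert b S) = insert c (s S)) :
    IsTab s g lab (insert b S) (replaceAndSwap F c (lab b)) := by
  induction hF generalizing c with
  | nil =>
    have hc0 : c = (0, 0) := by
      have h1 := h.shape (insert b ∅)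
      rw [hs, h.empty] at h1
      have h2 := h1 c.1 c.2 0 0 (Set.mem_insert _ _) (by simp) (by simp)
      simpa [eq_comm] using h2
    subst hc0
    exact IsTab.step b _ IsTab.nil (by simp [Above]) hc hs
  | @step S F p t hF hp ht hst ih =>
    have hb' : Below g S b := hb.mono (Finset.subset_insert _ _)
    have hbp : g b < g p := hb p (Finset.mem_insert_self _ _)
    have hp' : Above g (insert b S) p := hp.insert hbp
    obtain ⟨c0, t', hc0, ht', e1, e2, h3⟩ := h.jdt hb hp'
    obtain rfl : t' = t :=
      eq_of_mem_insert (X := s S) (D := s (insert p S)) hst (by rw [e2]; simp) ht'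
    have hFp : ∀ d, F d < (lab p : WithBot γ) := by
      intro d
      rcases hd : F d with _ | x
      · exact WithBot.bot_lt_coe _
      · obtain ⟨q, hq, rfl⟩ := hF.exists_of_eq hd
        exact WithBot.coe_lt_coe.2 (hlab q p (hp q hq))
    have hT := ih hb' hc0 e1
    rw [Finset.insert_comm]
    rw [hst] at hc
    -- If `b` and the largest point `p` add different squares, the letter of `p` is out of reach of
    -- the swaps. If they add the same square, the conversion starts at the adjacent square `e`, and
    -- its first swap moves the letter of `p` there.
    rcases h3 with ⟨hne, h3⟩ | ⟨rfl, e, he, h3⟩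
    · have hcc : c0 = c := by
        rw [h3, ← hst] at hs
        have : c0 ∈ insert c (s (insert p S)) := by rw [← hs]; exact Set.mem_insert _ _
        refine this.resolve_right ?_
        rw [hst]
        simp [hne, hc0]
      subst hcc
      have htc : ¬ t' ≤ c0 := by
        intro hle
        have h4 := h.shape (insert b S)
        rw [e1] at h4
        have := h4 c0.1 c0.2 t'.1 t'.2 (Set.mem_insert _ _) hle.1 hle.2
        exact ht (this.resolve_left (Ne.symm hne))
      rw [replaceAndSwap_update _ htc]
      refine IsTab.step p t' hT hp' ?_ ?_
      · rw [e1]; simp [Ne.symm hne, ht]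
      · rw [Finset.insert_comm, h3, e1, Set.insert_comm]
    · have hec : e = c := by
        rw [h3, e1] at hs
        have hmem : c ∈ insert e (insert c0 (s S)) := by rw [hs]; exact Set.mem_insert _ _
        exact (hmem.resolve_right hc).symm
      subst hec
      rw [replaceAndSwap_swap F he hFp (hlab b p hbp)]
      refine IsTab.step p e hT hp' ?_ ?_
      · rw [e1]; exact hc
      · rw [Finset.insert_comm, h3]

/-- The second square of `D` tells which case occurred. A square that can be added to `A` by itself
cannot be adjacent to `p` on the right or below, as it would then require `p`. So slides are
reversible. -/
theorem JdtRule.unique {A B C C' D : Set (ℕ × ℕ)} (h : JdtRule A B C D) (h' : JdtRule A B C' D)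
    (sC : IsShape C) (sC' : IsShape C') : C = C' := by
  obtain ⟨p, q, hp, hq, rfl, rfl, h⟩ := h
  obtain ⟨p', q', hp', hq', e1, rfl, h'⟩ := h'
  obtain rfl : p = p' := eq_of_mem_insert e1 (Set.mem_insert _ _) hp
  have key : ∀ {q e : ℕ × ℕ}, q ∉ A → p ≠ q → IsShape (insert q A) →
      (e = (p.1 + 1, p.2) ∨ e = (p.1, p.2 + 1)) →
      insert p (insert q A) ≠ insert e (insert p A) := by
    intro q e hq hne sq he h
    have h1 : q = e := eq_of_mem_insert (X := insert p A) h (by simp) (by simp [Ne.symm hne, hq])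
    subst h1
    have : p ∈ insert q A := sq q.1 q.2 p.1 p.2 (Set.mem_insert _ _)
      (by rcases he with rfl | rfl <;> simp) (by rcases he with rfl | rfl <;> simp)
    exact hp (this.resolve_left hne)
  rcases h with ⟨hne, rfl⟩ | ⟨rfl, e, he, rfl⟩ <;>
    rcases h' with ⟨hne', h'⟩ | ⟨rfl, e', he', h'⟩
  · have : q = q' := by
      have h1 : q ∈ insert p (insert q' A) := by rw [← h']; simp
      simpa [Ne.symm hne, hq] using h1
    rw [this]
  · exact absurd h' (key hq hne sC he')
  · exact absurd h'.symm (key hq' hne' sC' he)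
  · rfl

/-- If two families of shapes have the same tableau on `insert p S`, where `p` is the largest
point, then they have the same tableau on `S`. -/
theorem IsTab.common_of_insert_above (h0 : s ∅ = ∅) (h0' : s' ∅ = ∅) {S : Finset ι} {p : ι}
    (hlab : ∀ p q, g p < g q → lab p ≠ lab q) (hp : Above g S p) {F : Filling γ}
    (hF : IsTab s g lab (insert p S) F) (hF' : IsTab s' g lab (insert p S) F) :
    ∃ F' c, IsTab s g lab S F' ∧ IsTab s' g lab S F' ∧ s (insert p S) = insert c (s S) ∧
      s' (insert p S) = insert c (s' S) := by
  obtain ⟨c, F1, h1, hc, e, rfl⟩ := hF.of_insert hp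
  obtain ⟨c', F1', h1', hc', e', hFF⟩ := hF'.of_insert hp
  -- The label of the largest point occurs only once, so in the common filling it marks the same
  -- square for both families.
  have hcc : c = c' := by
    by_contra hne
    have h2 : Function.update F1 c (lab p : WithBot γ) c = lab p := Function.update_self _ _ _
    rw [hFF, Function.update_of_ne hne] at h2
    obtain ⟨q, hq, e⟩ := h1'.exists_of_eq h2
    exact hlab q p (hp q hq) e.symm
  subst hcc
  have hF1 : F1 = F1' := by
    ext d : 1
    by_cases hd : d = c
    · subst hd
      rw [h1.eq_bot h0 hc, h1'.eq_bot h0' hc']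
    · have := congrFun hFF d
      rwa [Function.update_of_ne hd, Function.update_of_ne hd] at this
  subst hF1
  exact ⟨F1, c, h1, h1', e, e'⟩

/-- If two families of shapes have the same tableau on `insert b S`, where `b` is the smallest
point, then they have the same tableau on `S`. -/
theorem IsTab.common_of_insert {α α' : Type} [LinearOrder α] [LinearOrder α'] {f : ι → α}
    {f' : ι → α'} (h : RowGrowth s g f) (h' : RowGrowth s' g f') {S : Finset ι} {b : ι}
    (hlab : ∀ p q, g p < g q → lab p ≠ lab q) (hb : Below g S b) {F : Filling γ} (hF : IsTab s g lab (insert b S) F)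
    (hF' : IsTab s' g lab (insert b S) F) :
    ∃ F', IsTab s g lab S F' ∧ IsTab s' g lab S F' := by
  obtain ⟨m, hm⟩ : ∃ m, S.card = m := ⟨_, rfl⟩
  induction m generalizing S F with
  | zero =>
    obtain rfl := Finset.card_eq_zero.1 hm
    exact ⟨_, IsTab.nil, IsTab.nil⟩
  | succ m ih =>
    obtain ⟨p, hp, hP⟩ := exists_above h.inj_left (Finset.card_pos.1 (by omega : 0 < S.card))
    obtain ⟨S, hpS, rfl⟩ : ∃ S', p ∉ S' ∧ insert p S' = S :=
      ⟨S.erase p, Finset.notMem_erase _ _, Finset.insert_erase hp⟩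
    rw [Finset.erase_insert hpS] at hP
    have hbp : g b < g p := hb p hp
    have hP' : Above g (insert b S) p := hP.insert hbp
    rw [Finset.insert_comm] at hF hF'
    obtain ⟨F1, c, h1, h1', e, e'⟩ :=
      hF.common_of_insert_above h.empty h'.empty hlab hP' hF'
    have hcard : S.card = m := by
      rw [Finset.card_insert_of_notMem hpS] at hm
      omega
    have hbS : Below g S b := hb.mono (Finset.subset_insert _ _)
    obtain ⟨F2, h2, h2'⟩ := ih hbS h1 h1' hcard
    have eS : s S = s' S := by rw [← h2.support_eq h.empty, h2'.support_eq h'.empty]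
    have eB : s (insert b S) = s' (insert b S) := by
      rw [← h1.support_eq h.empty, h1'.support_eq h'.empty]
    have eD : s (insert b (insert p S)) = s' (insert b (insert p S)) := by
      rw [Finset.insert_comm, e, e', eB]
    -- Three corners of the jeu de taquin square agree for the two families, hence so does the
    -- fourth, the shape of `insert p S`.
    have j1 := h.jdt hb hP'
    have j2 := h'.jdt hb hP'
    rw [← eS, ← eB, ← eD] at j2
    have eC := j1.unique j2 (h.shape _) (h'.shape _)
    obtain ⟨-, t, -, ht, -, et, -⟩ := j1
    exact ⟨_, IsTab.step p t h2 hP ht et, IsTab.step p t h2' hP (by rwa [← eS])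
      (by rw [← eC, ← eS, et])⟩

end Tab
/-! ### The Robinson–Schensted tableaux as chains of shapes -/

section Points

variable {ι α : Type} [LinearOrder ι] [LinearOrder α]

/-- The points are peeled off by decreasing value: the insertion tableau is the chain ordered by
value. -/
theorem isTab_schensted {v : ι → α} (hv : Function.Injective v) (S : Finset ι) :
    IsTab (rsShape v) v v S (schensted (wordOn v S)) := by
  induction S using Finset.induction_on_max_value v with
  | empty =>
    have e : schensted (wordOn v ∅) = fun _ => ⊥ := by
      ext c : 1
      simp [wordOn, schensted, fillingOfRows]
    rw [e]
    exact IsTab.nil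
  | insert q S hq hmax ih =>
    have hQ : Above v S q := fun z hz => lt_of_le_of_ne (hmax z hz) fun e => hq (hv e ▸ hz)
    obtain ⟨c, hc, e, h⟩ := rsShape_insert_top hQ
    rw [h]
    exact IsTab.step q c ih hQ hc e

/-- The recording tableau of the word of `v` on a finite set of positions. -/
def recording (v : ι → α) (S : Finset ι) : Filling ι := fun c =>
  ((S.sort (· ≤ ·)).find? fun a =>
    decide (schensted (wordOn v (S.filter (· ≤ a))) c ≠ ⊥)).elim ⊥ (fun a => (a : WithBot ι))

/-- The points are peeled off from the last position: a new last point leaves the earlier labels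
unchanged and labels its own square. -/
theorem isTab_recording {v : ι → α} (hv : Function.Injective v) {γ : Type} (lab : ι → γ)
    (S : Finset ι) : IsTab (rsShape v) id lab S ((recording v S).map lab) := by
  have h := rowGrowth_rsShape hv
  induction S using Finset.induction_on_max with
  | empty =>
    have e : (recording v ∅).map lab = fun _ => ⊥ := by
      ext c : 1
      simp [recording, Filling.map]
    rw [e]
    exact IsTab.nil
  | insert p S hp ih =>
    have hP : Above id S p := hp
    obtain ⟨c, hc, e⟩ := h.box_above S p hP
    convert IsTab.step p c ih hP hc e using 1
    have hsupp : ∀ d, (recording v S).map lab d ≠ ⊥ ↔ d ∈ rsShape v S := fun d => by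
      rw [← ih.support_eq h.empty]; rfl
    have hrec : recording v (insert p S) = Function.update (recording v S) c (p : WithBot ι) := by
      have h1 : (insert p S).filter (· ≤ p) = insert p S := by
        refine Finset.filter_true_of_mem fun z hz => ?_
        rcases Finset.mem_insert.1 hz with rfl | hz
        · exact le_rfl
        · exact (hp z hz).le
      have h2 : ∀ a ∈ S, (insert p S).filter (· ≤ a) = S.filter (· ≤ a) := fun a ha => by
        rw [Finset.filter_insert, if_neg (hp a ha).not_ge]
      ext d : 1
      have hfind : (S.sort (· ≤ ·)).find? (fun a =>
          decide (schensted (wordOn v ((insert p S).filter (· ≤ a))) d ≠ ⊥)) =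
          (S.sort (· ≤ ·)).find? (fun a =>
            decide (schensted (wordOn v (S.filter (· ≤ a))) d ≠ ⊥)) := by
        refine List.find?_congr fun a ha => ?_
        rw [h2 a (by simpa using ha)]
      have hd := hsupp d
      simp only [recording, Filling.map, sort_insert_of_above hP, List.find?_append, hfind,
        List.find?_singleton, h1, Function.update_apply] at hd ⊢
      have hpd : schensted (wordOn v (insert p S)) d ≠ ⊥ ↔ d = c ∨ d ∈ rsShape v S := by
        rw [← Set.mem_insert_iff, ← e]; rfl
      rcases hf : (S.sort (· ≤ ·)).find? (fun a =>
          decide (schensted (wordOn v (S.filter (· ≤ a))) d ≠ ⊥)) with _ | a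
      · rw [hf] at hd
        have hdS : d ∉ rsShape v S := by rw [← hd]; simp
        by_cases hdc : d = c
        · have := hpd.2 (Or.inl hdc)
          subst hdc
          simp [this]
        · have : ¬ schensted (wordOn v (insert p S)) d ≠ ⊥ := by
            rw [hpd]; tauto
          simp only [ne_eq, not_not] at this
          simp [hdc, this]
      · rw [hf] at hd
        have hdS : d ∈ rsShape v S := by rw [← hd]; simp
        have hdc : d ≠ c := by rintro rfl; exact hc hdS
        simp [hdc]
    rw [hrec]
    ext d : 1
    simp only [Filling.map, Function.update_apply]
    split_ifs <;> simp

end Points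

/-! ### Change of letters -/

section Map

variable {α β : Type} [LinearOrder α] [LinearOrder β] {φ : α → β}

theorem rowInsert_map (hφ : StrictMono φ) (a : α) (R : List α) :
    rowInsert (φ a) (R.map φ) = ((rowInsert a R).1.map φ, (rowInsert a R).2.map φ) := by
  induction R with
  | nil => simp [rowInsert]
  | cons b R ih =>
    simp only [List.map_cons, rowInsert, hφ.lt_iff_lt, ih]
    split_ifs <;> simp

theorem schenstedInsert_map (hφ : StrictMono φ) (a : α) (Rs : List (List α)) :
    schenstedInsert (φ a) (Rs.map (List.map φ)) = (schenstedInsert a Rs).map (List.map φ) := by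
  induction Rs generalizing a with
  | nil => simp [schenstedInsert]
  | cons R Rs ih =>
    have h := rowInsert_map hφ a R
    rcases hn : (rowInsert a R).2 with _ | b
    · rw [schenstedInsert_none _ hn, List.map_cons, schenstedInsert_none _ (by rw [h, hn]; rfl)]
      simp
    · rw [schenstedInsert_some _ hn, List.map_cons,
        schenstedInsert_some (b := φ b) _ (by rw [h, hn]; rfl), ih, h]
      simp

theorem schensted_map (hφ : StrictMono φ) (u : List α) :
    schensted (u.map φ) = (schensted u).map φ := by
  have h : rsRows (u.map φ) = (rsRows u).map (List.map φ) := by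
    induction u using List.reverseRecOn with
    | nil => rfl
    | append_singleton u a ih =>
      simp only [rsRows, List.map_append, List.foldl_append, List.map_cons, List.map_nil,
        List.foldl_cons, List.foldl_nil] at ih ⊢
      rw [ih, schenstedInsert_map hφ]
  change fillingOfRows (rsRows _) = Filling.map φ (fillingOfRows (rsRows _))
  rw [h]
  ext ⟨i, j⟩ : 1
  simp only [fillingOfRows, Filling.map, List.getElem?_map]
  rcases (rsRows u)[i]? with _ | R
  · simp
  · simp only [Option.map_some, Option.bind_some, List.getElem?_map]
    rcases R[j]? with _ | x <;> simp

end Map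

section Embed

variable {ι κ α β : Type} [LinearOrder ι] [LinearOrder κ] [LinearOrder α] [LinearOrder β]

theorem sort_map_of_strictMono {e : κ ↪ ι} (he : StrictMono e) (S : Finset κ) :
    (S.map e).sort (· ≤ ·) = (S.sort (· ≤ ·)).map e := by
  refine List.Perm.eq_of_pairwise (le := (· ≤ ·)) (fun a b _ _ => le_antisymm)
    (Finset.pairwise_sort _ _) ?_ ?_
  · rw [List.pairwise_map]
    exact (Finset.pairwise_sort _ _).imp fun h => he.monotone h
  · rw [← Multiset.coe_eq_coe, Finset.sort_eq, ← Multiset.map_coe, Finset.sort_eq,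
      Finset.map_val]

theorem wordOn_map {γ : Type} {e : κ ↪ ι} (he : StrictMono e) (v : ι → γ) (S : Finset κ) :
    wordOn v (S.map e) = wordOn (v ∘ e) S := by
  simp [wordOn, sort_map_of_strictMono he]

theorem wordOn_comp {γ δ : Type} (φ : γ → δ) (v : ι → γ) (S : Finset ι) :
    wordOn (φ ∘ v) S = (wordOn v S).map φ := by
  simp [wordOn]

theorem recording_map {e : κ ↪ ι} (he : StrictMono e) (v : ι → α) (S : Finset κ) :
    recording v (S.map e) = (recording (v ∘ e) S).map e := by
  ext c : 1
  have h : ∀ a, (S.map e).filter (· ≤ e a) = (S.filter (· ≤ a)).map e := by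
    intro a
    rw [Finset.filter_map]
    congr 1
    ext b
    simp [he.le_iff_le]
  simp only [recording, Filling.map, sort_map_of_strictMono he, List.find?_map,
    Function.comp_def]
  have h2 : (fun a => decide (schensted (wordOn v ((S.map e).filter (· ≤ e a))) c ≠ ⊥)) =
      fun a => decide (schensted (wordOn (v ∘ e) (S.filter (· ≤ a))) c ≠ ⊥) := by
    ext a
    rw [h, wordOn_map he]
  simp only [ne_eq, Function.comp_def] at h2 ⊢
  rw [h2]
  rcases List.find? _ _ with _ | a <;> simp

theorem Filling.map_ne_bot {γ δ : Type} (φ : γ → δ) (F : Filling γ) (c : ℕ × ℕ) :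
    F.map φ c ≠ ⊥ ↔ F c ≠ ⊥ := by
  simp [Filling.map]

theorem recording_comp {φ : α → β} (hφ : StrictMono φ) (v : ι → α) (S : Finset ι) :
    recording (φ ∘ v) S = recording v S := by
  ext c : 1
  simp only [recording, wordOn_comp, schensted_map hφ, Filling.map_ne_bot]

theorem rsP_eq [Fintype ι] (π : Equiv.Perm ι) : rsP π = schensted (wordOn π Finset.univ) := rfl

theorem rsQ_eq [Fintype ι] (π : Equiv.Perm ι) : rsQ π = recording π Finset.univ := by
  have h : ∀ a : ι, (increasingList ι).filter (· ≤ a) =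
      (Finset.univ.filter (· ≤ a)).sort (· ≤ ·) := by
    intro a
    refine List.Perm.eq_of_pairwise (le := (· ≤ ·)) (fun a b _ _ => le_antisymm)
      ((Finset.pairwise_sort _ _).filter _) (Finset.pairwise_sort _ _) ?_
    rw [← Multiset.coe_eq_coe, Finset.sort_eq, ← Multiset.filter_coe, increasingList,
      Finset.sort_eq, Finset.filter_val]
  ext c : 1
  simp only [rsQ, recording, h]
  rfl

end Embed
/-! ### Points and signs -/

theorem Letter.lt_iff (a b : Letter) : a < b ↔ a.key < b.key := Iff.rfl

theorem Letter.zero_strictMono : StrictMono Letter.zero := by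
  intro a b h
  simpa [Letter.lt_iff, Letter.key, Prod.Lex.toLex_lt_toLex] using h

theorem zeroLetter_strictMono {k : ℕ} : StrictMono (zeroLetter (k := k)) :=
  fun _ _ h => Letter.zero_strictMono h

namespace Points

variable {n k : ℕ}

theorem letter_strictMono : StrictMono (Points.letter : Points n k → Letter) := fun _ _ h => h

/-- The absolute value of a point. -/
def abs : Points n k → ℕ
  | .inl z => (z : ℤ).natAbs
  | .inr _ => 0

/-- The point `i + 1`. -/
def pos (i : Fin n) : Points n k := .inl (posPoint i)

/-- The point `-(i + 1)`. -/
def neg (i : Fin n) : Points n k := .inl (posPoint i).opp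

/-- The point `0_j`. -/
def zero (j : Fin k) : Points n k := .inr j

theorem abs_pos (i : Fin n) : (pos i : Points n k).abs = i + 1 := by
  simp only [pos, abs, posPoint]; omega

theorem abs_neg (i : Fin n) : (neg i : Points n k).abs = i + 1 := by
  simp only [neg, abs, posPoint, Signed.opp]; omega

theorem letter_pos (i : Fin n) : (pos i : Points n k).letter = .num ((i : ℤ) + 1) := rfl

theorem letter_neg (i : Fin n) : (neg i : Points n k).letter = .num (-((i : ℤ) + 1)) := rfl

theorem abs_eq_iff (p : Points n k) (i : Fin n) : p.abs = i + 1 ↔ p = neg i ∨ p = pos i := by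
  constructor
  · intro h
    rcases p with z | j
    · simp only [abs] at h
      rcases Int.natAbs_eq (z : ℤ) with hz | hz
      · exact Or.inr (congrArg Sum.inl (Subtype.ext (by simp only [posPoint]; omega)))
      · exact Or.inl (congrArg Sum.inl (Subtype.ext (by simp only [posPoint, Signed.opp]; omega)))
    · simp [abs] at h
  · rintro (rfl | rfl)
    · exact abs_neg i
    · exact abs_pos i

/-- This makes the points of a new pair extreme in a window: all points of smaller absolute value,
including the `0_j`, lie between them. -/
theorem letter_lt_of_abs_lt {p : Points n k} {a : ℕ} (h : p.abs < a) :
    p.letter < .num a ∧ .num (-(a : ℤ)) < p.letter := by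
  rcases p with z | j <;>
    simp only [abs] at h <;>
    simp only [letter, Letter.lt_iff, Letter.key] <;> split_ifs <;>
    simp only [Prod.Lex.toLex_lt_toLex] <;> first | omega | (simp; omega)

theorem lt_pos {p : Points n k} {i : Fin n} (h : p.abs ≤ i) : p < pos i := by
  have := (letter_lt_of_abs_lt (Nat.lt_succ_of_le h)).1
  exact_mod_cast this

theorem neg_lt {p : Points n k} {i : Fin n} (h : p.abs ≤ i) : neg i < p := by
  have := (letter_lt_of_abs_lt (Nat.lt_succ_of_le h)).2
  exact_mod_cast this

theorem neg_lt_pos (i : Fin n) : (neg i : Points n k) < pos i := by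
  change (neg i : Points n k).letter < (pos i : Points n k).letter
  rw [letter_neg, letter_pos, Letter.lt_iff, Letter.key, Letter.key]
  rw [if_pos (by omega), if_neg (by omega), Prod.Lex.toLex_lt_toLex]
  omega

/-- The opposite point (the points `0_j` are fixed). -/
def opp : Points n k → Points n k
  | .inl z => .inl z.opp
  | .inr j => .inr j

theorem opp_pos (i : Fin n) : (pos i : Points n k).opp = neg i := rfl

theorem opp_neg (i : Fin n) : (neg i : Points n k).opp = pos i :=
  congrArg Sum.inl (Subtype.ext (by simp [Signed.opp]))

theorem abs_opp (p : Points n k) : p.opp.abs = p.abs := by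
  rcases p with z | j
  · simp [opp, abs, Signed.opp]
  · rfl

theorem abs_le (p : Points n k) : p.abs ≤ n := by
  rcases p with z | j
  · exact z.2.2
  · exact Nat.zero_le _

end Points

/-! ### Signed permutations and symmetric windows -/

section SignedPerm

variable {n k : ℕ}

/-- The permutation of the points given by a signed permutation and a permutation of the
points `0_j`. -/
def pointPerm (w : W n) (x : Equiv.Perm (Fin k)) : Equiv.Perm (Points n k) :=
  Equiv.sumCongr w.1 x

theorem iota_mul_inclI {r : ℕ} (w : W n) (x : Equiv.Perm (Fin (coreSize r))) :
    iota r w * inclI n x = pointPerm w x := by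
  ext p
  rcases p with z | j <;> rfl

theorem pointPerm_opp (w : W n) (x : Equiv.Perm (Fin k)) (i : Fin n) :
    pointPerm w x (.neg i) = (pointPerm w x (.pos i)).opp :=
  congrArg Sum.inl (w.2 (posPoint i))

theorem pointPerm_symm (w : W n) (x : Equiv.Perm (Fin k)) :
    (pointPerm w x).symm = pointPerm w⁻¹ x⁻¹ := by
  ext p
  rcases p with z | j <;> rfl

theorem abs_pointPerm_eq_zero (w : W n) (x : Equiv.Perm (Fin k)) (p : Points n k) :
    (pointPerm w x p).abs = 0 ↔ p.abs = 0 := by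
  rcases p with z | j
  · have h1 := z.2.1
    have h2 := (w.1 z).2.1
    change ((w.1 z : Signed n) : ℤ).natAbs = 0 ↔ (z : ℤ).natAbs = 0
    omega
  · exact iff_of_true rfl rfl

/-- The points with absolute value at most `m` at which `π` has absolute value at most `i`. -/
noncomputable def window (π : Equiv.Perm (Points n k)) (i m : ℕ) : Finset (Points n k) :=
  Finset.univ.filter fun p => p.abs ≤ m ∧ (π p).abs ≤ i

theorem mem_window {π : Equiv.Perm (Points n k)} {i m : ℕ} {p : Points n k} :
    p ∈ window π i m ↔ p.abs ≤ m ∧ (π p).abs ≤ i := by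
  simp [window]

/-- The word of a permutation, in letters. -/
def letters (π : Equiv.Perm (Points n k)) (p : Points n k) : Letter := (π p).letter

theorem letters_injective (π : Equiv.Perm (Points n k)) : Function.Injective (letters π) :=
  Points.letter_injective.comp π.injective

/-- The Robinson–Schensted shape of the part of `π` in a symmetric window. -/
def windowShape (π : Equiv.Perm (Points n k)) (i m : ℕ) : Set (ℕ × ℕ) :=
  rsShape (letters π) (window π i m)

variable (w : W n) (x : Equiv.Perm (Fin k))

theorem abs_le_succ_iff {p : Points n k} (m : Fin n) :
    p.abs ≤ m + 1 ↔ p.abs ≤ m ∨ p = .neg m ∨ p = .pos m := by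
  rw [← p.abs_eq_iff]; omega

theorem abs_pointPerm_le_succ_iff {p : Points n k} (i : Fin n) :
    (pointPerm w x p).abs ≤ i + 1 ↔ (pointPerm w x p).abs ≤ i ∨ p = (pointPerm w x).symm (.neg i) ∨ p = (pointPerm w x).symm (.pos i) := by
  rw [abs_le_succ_iff, Equiv.eq_symm_apply, Equiv.eq_symm_apply]

theorem abs_pointPerm_neg (m : Fin n) : (pointPerm w x (.neg m)).abs = (pointPerm w x (.pos m)).abs := by
  rw [pointPerm_opp, Points.abs_opp]

theorem abs_pointPerm_symm_neg (i : Fin n) : ((pointPerm w x).symm (.neg i)).abs = ((pointPerm w x).symm (.pos i)).abs := by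
  rw [pointPerm_symm]
  exact abs_pointPerm_neg _ _ i

/-- The positions `±(m + 1)` carry opposite values, so their points enter a window together or not
at all. -/
theorem window_succ_right {i : ℕ} {m : Fin n} (h : (pointPerm w x (.pos m)).abs ≤ i) :
    window (pointPerm w x) i (m + 1) = insert (.neg m) (insert (.pos m) (window (pointPerm w x) i m)) := by
  ext p
  have h1 := abs_le_succ_iff (p := p) m
  have h2 := abs_pointPerm_neg w x m
  simp only [mem_window, Finset.mem_insert]
  constructor
  · rintro ⟨h3, h4⟩
    rcases h1.1 h3 with h5 | h5 | h5 <;> tauto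
  · rintro (rfl | rfl | h3)
    · exact ⟨h1.2 (by tauto), by omega⟩
    · exact ⟨h1.2 (by tauto), by omega⟩
    · exact ⟨by omega, h3.2⟩

theorem window_succ_right_of_lt {i : ℕ} {m : Fin n} (h : i < (pointPerm w x (.pos m)).abs) :
    window (pointPerm w x) i (m + 1) = window (pointPerm w x) i m := by
  ext p
  have h1 := abs_le_succ_iff (p := p) m
  have h2 := abs_pointPerm_neg w x m
  simp only [mem_window]
  constructor
  · rintro ⟨h3, h4⟩
    rcases h1.1 h3 with h5 | rfl | rfl
    · exact ⟨h5, h4⟩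
    · omega
    · omega
  · exact fun h => ⟨by omega, h.2⟩

theorem window_succ_left {i : Fin n} {m : ℕ} (h : ((pointPerm w x).symm (.pos i)).abs ≤ m) :
    window (pointPerm w x) (i + 1) m =
      insert ((pointPerm w x).symm (.neg i)) (insert ((pointPerm w x).symm (.pos i)) (window (pointPerm w x) i m)) := by
  ext p
  have h1 := abs_pointPerm_le_succ_iff w x (p := p) i
  have h2 := abs_pointPerm_symm_neg w x i
  simp only [mem_window, Finset.mem_insert]
  constructor
  · rintro ⟨h3, h4⟩
    rcases h1.1 h4 with h5 | h5 | h5 <;> tauto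
  · rintro (rfl | rfl | h3)
    · exact ⟨by omega, h1.2 (by tauto)⟩
    · exact ⟨by omega, h1.2 (by tauto)⟩
    · exact ⟨h3.1, by omega⟩

theorem window_succ_left_of_lt {i : Fin n} {m : ℕ} (h : m < ((pointPerm w x).symm (.pos i)).abs) :
    window (pointPerm w x) (i + 1) m = window (pointPerm w x) i m := by
  ext p
  have h1 := abs_pointPerm_le_succ_iff w x (p := p) i
  have h2 := abs_pointPerm_symm_neg w x i
  simp only [mem_window]
  constructor
  · rintro ⟨h3, h4⟩
    rcases h1.1 h4 with h5 | rfl | rfl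
    · exact ⟨h3, h5⟩
    · omega
    · omega
  · exact fun h => ⟨h.1, by omega⟩

theorem abs_symm_eq_iff (i m : Fin n) :
    ((pointPerm w x).symm (.pos i)).abs = m + 1 ↔ (pointPerm w x (.pos m)).abs = i + 1 := by
  rw [Points.abs_eq_iff, Points.abs_eq_iff, Equiv.symm_apply_eq, Equiv.symm_apply_eq,
    pointPerm_opp]
  constructor
  · rintro (h | h)
    · left
      rw [← Points.opp_pos, h]
      rcases pointPerm w x (.pos m) with z | j
      · exact congrArg Sum.inl (Subtype.ext (by simp [Signed.opp]))
      · rfl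
    · exact Or.inr h.symm
  · rintro (h | h)
    · left; rw [h, Points.opp_neg]
    · exact Or.inr h.symm

theorem rowGrowth_letters (σ : Equiv.Perm (Points n k)) :
    RowGrowth (rsShape (letters σ)) id (letters σ) :=
  rowGrowth_rsShape (letters_injective σ)

/-- The hypotheses say that the pair of new positions and the pair of new values are different, so
the four points are outermost in one order each and lie inside the frame in the other. -/
theorem window_frame {i m : Fin n} (hi : (pointPerm w x (.pos m)).abs ≤ i) (hm : ((pointPerm w x).symm (.pos i)).abs ≤ m) :
    Frame id (letters (pointPerm w x)) (window (pointPerm w x) i m) (.neg m) (.pos m) ((pointPerm w x).symm (.neg i))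
      ((pointPerm w x).symm (.pos i)) := by
  have h1 := abs_pointPerm_neg w x m
  have h2 := abs_pointPerm_symm_neg w x i
  have e1 : pointPerm w x ((pointPerm w x).symm (.neg i)) = .neg i := Equiv.apply_symm_apply _ _
  have e2 : pointPerm w x ((pointPerm w x).symm (.pos i)) = .pos i := Equiv.apply_symm_apply _ _
  constructor
  · intro z hz
    simp only [Finset.mem_insert, mem_window] at hz
    change Points.neg m < z
    rcases hz with rfl | rfl | rfl | hz
    · exact Points.neg_lt_pos m
    · exact Points.neg_lt (by omega)
    · exact Points.neg_lt (by omega)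
    · exact Points.neg_lt (by omega)
  · intro z hz
    simp only [Finset.mem_insert, mem_window] at hz
    change z < Points.pos m
    rcases hz with rfl | rfl | rfl | hz
    · exact Points.neg_lt_pos m
    · exact Points.lt_pos (by omega)
    · exact Points.lt_pos (by omega)
    · exact Points.lt_pos (by omega)
  · intro z hz
    simp only [Finset.mem_insert, mem_window] at hz
    change pointPerm w x _ < pointPerm w x z
    rw [e1]
    rcases hz with rfl | rfl | rfl | hz
    · exact Points.neg_lt (by omega)
    · exact Points.neg_lt (by omega)
    · rw [e2]; exact Points.neg_lt_pos i
    · exact Points.neg_lt (by omega)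
  · intro z hz
    simp only [Finset.mem_insert, mem_window] at hz
    change pointPerm w x z < pointPerm w x _
    rw [e2]
    rcases hz with rfl | rfl | rfl | hz
    · exact Points.lt_pos (by omega)
    · exact Points.lt_pos (by omega)
    · rw [e1]; exact Points.neg_lt_pos i
    · exact Points.lt_pos (by omega)

end SignedPerm

/-! ### Dominoes created at the corners -/

section Corner

variable {ι α β : Type} [DecidableEq ι] [LinearOrder α] [LinearOrder β]
  {s : Finset ι → Set (ℕ × ℕ)} {f : ι → α} {g : ι → β}

/-- A last point with the largest value and a first point with the smallest value add a
horizontal domino to the first row. -/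
theorem RowGrowth.corner_domino (h : RowGrowth s f g) {S : Finset ι} {l r : ι}
    (h1 : Above f S r) (h2 : Above g S r) (h3 : Below f (insert r S) l)
    (h4 : Below g (insert r S) l) :
    ∃ y, (0, y) ∉ s S ∧ IsShape (insert (0, y) (s S)) ∧
      s (insert l (insert r S)) = insert (0, y + 1) (insert (0, y) (s S)) := by
  obtain ⟨y, hy, e⟩ := h.corner S r h1 h2
  obtain ⟨y', hy', e'⟩ := h.corner' (insert r S) l h3 h4
  have s1 := h.shape (insert r S)
  have s2 := h.shape (insert l (insert r S))
  have s0 := h.shape S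
  rw [e'] at s2 ⊢
  rw [e] at s1 s2 hy' ⊢
  obtain rfl : y' = y + 1 := by
    rcases lt_trichotomy y' (y + 1) with h | h | h
    · exact absurd (s1 _ _ 0 y' (Set.mem_insert _ _) le_rfl (by omega)) hy'
    · exact h
    · have h1 := s2 _ _ 0 (y + 1) (Set.mem_insert _ _) le_rfl h.le
      have h2 : (0, y + 1) ∉ s S := fun h => hy (s0 _ _ _ _ h le_rfl (by omega))
      grind
  exact ⟨y, hy, s1, rfl⟩

theorem RowGrowth.col_corner_domino (h : RowGrowth s f g) {S : Finset ι} {l r : ι}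
    (h1 : Below f S l) (h2 : Above g S l) (h3 : Above f (insert l S) r)
    (h4 : Below g (insert l S) r) :
    ∃ x, (x, 0) ∉ s S ∧ IsShape (insert (x, 0) (s S)) ∧
      s (insert l (insert r S)) = insert (x + 1, 0) (insert (x, 0) (s S)) := by
  obtain ⟨x, hx, s1, e⟩ := h.reverse.corner_domino h1 h2 h3 h4
  refine ⟨x, hx, ?_, ?_⟩
  · have := s1.transpose
    rwa [preimage_swap_insert] at this
  · rw [Finset.insert_comm]
    have : s (insert r (insert l S)) =
      Prod.swap ⁻¹' (Prod.swap ⁻¹' s (insert r (insert l S))) := rfl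
    rw [this, e, preimage_swap_insert, preimage_swap_insert]
    rfl

end Corner

/-! ### The growth of window shapes -/

section SignedPerm

variable {n k : ℕ} (w : W n) (x : Equiv.Perm (Fin k))

theorem windowShape_corner_pos {i m : Fin n} (h : pointPerm w x (.pos m) = .pos i) :
    ∃ y, (0, y) ∉ windowShape (pointPerm w x) i m ∧ IsShape (insert (0, y) (windowShape (pointPerm w x) i m)) ∧
      windowShape (pointPerm w x) (i + 1) (m + 1) =
        insert (0, y + 1) (insert (0, y) (windowShape (pointPerm w x) i m)) := by
  have h' : pointPerm w x (.neg m) = .neg i := by rw [pointPerm_opp, h]; rfl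
  have e : window (pointPerm w x) (i + 1) (m + 1) = insert (.neg m) (insert (.pos m) (window (pointPerm w x) i m)) := by
    rw [window_succ_right w x (by rw [h, Points.abs_pos]), window_succ_left_of_lt]
    have := (abs_symm_eq_iff w x i m).2 (by rw [h, Points.abs_pos])
    omega
  rw [windowShape, windowShape, e]
  refine (rowGrowth_letters (pointPerm w x)).corner_domino ?_ ?_ ?_ ?_
  · exact fun z hz => Points.lt_pos (mem_window.1 hz).1
  · intro z hz
    change pointPerm w x z < pointPerm w x _
    rw [h]
    exact Points.lt_pos (mem_window.1 hz).2
  · intro z hz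
    rcases Finset.mem_insert.1 hz with rfl | hz
    · exact Points.neg_lt_pos m
    · exact Points.neg_lt (mem_window.1 hz).1
  · intro z hz
    change pointPerm w x _ < pointPerm w x z
    rw [h']
    rcases Finset.mem_insert.1 hz with rfl | hz
    · rw [h]; exact Points.neg_lt_pos i
    · exact Points.neg_lt (mem_window.1 hz).2

theorem windowShape_corner_neg {i m : Fin n} (h : pointPerm w x (.pos m) = .neg i) :
    ∃ y, (y, 0) ∉ windowShape (pointPerm w x) i m ∧ IsShape (insert (y, 0) (windowShape (pointPerm w x) i m)) ∧
      windowShape (pointPerm w x) (i + 1) (m + 1) =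
        insert (y + 1, 0) (insert (y, 0) (windowShape (pointPerm w x) i m)) := by
  have h' : pointPerm w x (.neg m) = .pos i := by rw [pointPerm_opp, h, Points.opp_neg]
  have e : window (pointPerm w x) (i + 1) (m + 1) = insert (.neg m) (insert (.pos m) (window (pointPerm w x) i m)) := by
    rw [window_succ_right w x (by rw [h, Points.abs_neg]), window_succ_left_of_lt]
    have := (abs_symm_eq_iff w x i m).2 (by rw [h, Points.abs_neg])
    omega
  rw [windowShape, windowShape, e]
  refine (rowGrowth_letters (pointPerm w x)).col_corner_domino ?_ ?_ ?_ ?_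
  · exact fun z hz => Points.neg_lt (mem_window.1 hz).1
  · intro z hz
    change pointPerm w x z < pointPerm w x _
    rw [h']
    exact Points.lt_pos (mem_window.1 hz).2
  · intro z hz
    rcases Finset.mem_insert.1 hz with rfl | hz
    · exact Points.neg_lt_pos m
    · exact Points.lt_pos (mem_window.1 hz).1
  · intro z hz
    change pointPerm w x _ < pointPerm w x z
    rw [h]
    rcases Finset.mem_insert.1 hz with rfl | hz
    · rw [h']; exact Points.neg_lt_pos i
    · exact Points.neg_lt (mem_window.1 hz).2

theorem windowShape_corner {i m : Fin n} (h : (pointPerm w x (.pos m)).abs = i + 1) :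
    ∃ c, AddDomino (windowShape (pointPerm w x) i m) c (windowShape (pointPerm w x) (i + 1) (m + 1)) := by
  rcases ((pointPerm w x (.pos m)).abs_eq_iff i).1 h with h | h
  · obtain ⟨y, hy, -, e⟩ := windowShape_corner_neg w x h
    exact ⟨_, Or.inr ⟨hy, e⟩⟩
  · obtain ⟨y, hy, -, e⟩ := windowShape_corner_pos w x h
    exact ⟨_, Or.inl ⟨hy, e⟩⟩

/-- `RowGrowth.frame_bump` is used twice, once for the inverse growth, so that dominoes propagate in
both directions. -/
theorem windowShape_frame {i m : Fin n} (hi : (pointPerm w x (.pos m)).abs ≤ i)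
    (hm : ((pointPerm w x).symm (.pos i)).abs ≤ m) {p q : ℕ × ℕ}
    (h1 : AddDomino (windowShape (pointPerm w x) i m) p (windowShape (pointPerm w x) i (m + 1)))
    (h2 : AddDomino (windowShape (pointPerm w x) i m) q (windowShape (pointPerm w x) (i + 1) m)) :
    (∃ c, AddDomino (windowShape (pointPerm w x) i (m + 1)) c (windowShape (pointPerm w x) (i + 1) (m + 1))) ∧
    (∃ c, AddDomino (windowShape (pointPerm w x) (i + 1) m) c (windowShape (pointPerm w x) (i + 1) (m + 1))) ∧
    ∀ μ d : Finset (ℕ × ℕ), (μ : Set (ℕ × ℕ)) = windowShape (pointPerm w x) i (m + 1) →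
      (d : Set (ℕ × ℕ)) = windowShape (pointPerm w x) (i + 1) m \ windowShape (pointPerm w x) i m →
      (bump μ d : Set (ℕ × ℕ)) =
        windowShape (pointPerm w x) (i + 1) (m + 1) \ windowShape (pointPerm w x) i (m + 1) := by
  have F := window_frame w x hi hm
  have e1 := window_succ_right w x hi
  have e2 := window_succ_left w x hm
  have e3 := window_succ_right w x (show (pointPerm w x (.pos m)).abs ≤ i + 1 by omega)
  rw [e2] at e3
  rw [windowShape, windowShape] at h1 h2
  have e4 : insert ((pointPerm w x).symm (.neg i)) (insert ((pointPerm w x).symm (.pos i))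
      (insert (.neg m) (insert (.pos m) (window (pointPerm w x) i m)))) =
      window (pointPerm w x) (i + 1) (m + 1) := by
    rw [e3]
    ext z
    simp only [Finset.mem_insert]
    tauto
  rw [e1] at h1
  rw [e2] at h2
  have hr := rowGrowth_letters (pointPerm w x)
  have a1 := hr.frame_bump F h1 h2
  have a3 := (hr.inverse.frame_bump F.inverse h2 h1).1
  rw [e4, ← e2] at a3
  rw [← e3, ← e1, ← e2] at a1
  exact ⟨a1.1, a3, a1.2⟩

/-- Induction on `i + m` over the cells of the growth diagram. A cell either contains the common
pair of new points, which creates a domino, or transports dominoes from its inner sides to its outer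
ones. Both directions must be proved together. -/
theorem windowShape_dominoes (i m : ℕ) : (∀ (hi : i < n), m ≤ n → ((pointPerm w x).symm (.pos ⟨i, hi⟩)).abs ≤ m →
      ∃ c, AddDomino (windowShape (pointPerm w x) i m) c (windowShape (pointPerm w x) (i + 1) m)) ∧
    (∀ (hm : m < n), i ≤ n → (pointPerm w x (.pos ⟨m, hm⟩)).abs ≤ i →
      ∃ c, AddDomino (windowShape (pointPerm w x) i m) c (windowShape (pointPerm w x) i (m + 1))) := by
  obtain ⟨N, hN⟩ : ∃ N, i + m = N := ⟨_, rfl⟩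
  induction N using Nat.strong_induction_on generalizing i m with
  | _ N ih =>
    subst hN
    constructor
    · intro hi hm h
      -- A nonzero value sits at a nonzero position, so there is a cell to step back to.
      have hpos : 0 < m := by
        have h0 := abs_pointPerm_eq_zero w⁻¹ x⁻¹ (.pos ⟨i, hi⟩)
        rw [← pointPerm_symm, Points.abs_pos] at h0
        simp only at h0
        omega
      obtain ⟨m, rfl⟩ := Nat.exists_eq_succ_of_ne_zero hpos.ne'
      simp only [Nat.succ_eq_add_one] at *
      have heq := abs_symm_eq_iff w x ⟨i, hi⟩ ⟨m, hm⟩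
      simp only at heq
      by_cases hcase : (pointPerm w x (.pos ⟨m, hm⟩)).abs = i + 1
      · have e : windowShape (pointPerm w x) i (m + 1) = windowShape (pointPerm w x) i m := by
          rw [windowShape, windowShape, window_succ_right_of_lt w x (m := ⟨m, hm⟩) (by omega)]
        rw [e]
        exact windowShape_corner w x (i := ⟨i, hi⟩) (m := ⟨m, hm⟩) hcase
      · have hle : ((pointPerm w x).symm (.pos ⟨i, hi⟩)).abs ≤ m := by
          have := mt heq.1 hcase
          omega
        obtain ⟨c, hc⟩ := (ih (i + m) (by omega) i m rfl).1 hi (by omega) hle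
        -- Either the positions `±(m + 1)` have values too large for both windows and the domino is
        -- carried over unchanged, or both pairs are present and form a frame.
        rcases lt_or_ge (i + 1) (pointPerm w x (.pos ⟨m, hm⟩)).abs with hlt | hge
        · have e1 : windowShape (pointPerm w x) i (m + 1) = windowShape (pointPerm w x) i m := by
            rw [windowShape, windowShape, window_succ_right_of_lt w x (m := ⟨m, hm⟩) (by omega)]
          have e2 : windowShape (pointPerm w x) (i + 1) (m + 1) = windowShape (pointPerm w x) (i + 1) m := by
            rw [windowShape, windowShape, window_succ_right_of_lt w x (m := ⟨m, hm⟩) (by omega)]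
          rw [e1, e2]
          exact ⟨c, hc⟩
        · obtain ⟨d, hd⟩ := (ih (i + m) (by omega) i m rfl).2 hm (by omega) (by omega)
          exact (windowShape_frame w x (i := ⟨i, hi⟩) (m := ⟨m, hm⟩) (by simp only; omega)
            hle hd hc).1
    · intro hm hi h
      have hpos : 0 < i := by
        have h0 := abs_pointPerm_eq_zero w x (.pos ⟨m, hm⟩)
        rw [Points.abs_pos] at h0
        simp only at h0
        omega
      obtain ⟨i, rfl⟩ := Nat.exists_eq_succ_of_ne_zero hpos.ne'
      simp only [Nat.succ_eq_add_one] at *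
      have heq := abs_symm_eq_iff w x ⟨i, hi⟩ ⟨m, hm⟩
      simp only at heq
      by_cases hcase : ((pointPerm w x).symm (.pos ⟨i, hi⟩)).abs = m + 1
      · have e : windowShape (pointPerm w x) (i + 1) m = windowShape (pointPerm w x) i m := by
          rw [windowShape, windowShape, window_succ_left_of_lt w x (i := ⟨i, hi⟩) (by omega)]
        rw [e]
        exact windowShape_corner w x (i := ⟨i, hi⟩) (m := ⟨m, hm⟩) (heq.1 hcase)
      · have hle : (pointPerm w x (.pos ⟨m, hm⟩)).abs ≤ i := by
          have := mt heq.2 hcase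
          omega
        obtain ⟨c, hc⟩ := (ih (i + m) (by omega) i m rfl).2 hm (by omega) hle
        rcases lt_or_ge (m + 1) ((pointPerm w x).symm (.pos ⟨i, hi⟩)).abs with hlt | hge
        · have e1 : windowShape (pointPerm w x) (i + 1) m = windowShape (pointPerm w x) i m := by
            rw [windowShape, windowShape, window_succ_left_of_lt w x (i := ⟨i, hi⟩) (by omega)]
          have e2 : windowShape (pointPerm w x) (i + 1) (m + 1) = windowShape (pointPerm w x) i (m + 1) := by
            rw [windowShape, windowShape, window_succ_left_of_lt w x (i := ⟨i, hi⟩) (by omega)]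
          rw [e1, e2]
          exact ⟨c, hc⟩
        · obtain ⟨d, hd⟩ := (ih (i + m) (by omega) i m rfl).1 hi (by omega) (by omega)
          exact (windowShape_frame w x (i := ⟨i, hi⟩) (m := ⟨m, hm⟩) hle (by simp only; omega)
            hc hd).2.1

end SignedPerm
/-! ### Domino insertion and shapes of windows -/

section Core

variable {n k : ℕ} (w : W n) (x : Equiv.Perm (Fin k))

/-- The points `0_j`, as an embedding. -/
def zeroEmb (n k : ℕ) : Fin k ↪ Points n k := ⟨Points.zero, fun _ _ h => Sum.inr_injective h⟩

theorem zeroEmb_strictMono : StrictMono (zeroEmb n k) :=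
  fun _ _ h => Letter.zero_strictMono h

theorem window_eq_zeros {i m : ℕ} (h : i = 0 ∨ m = 0) :
    window (pointPerm w x) i m = Finset.univ.map (zeroEmb n k) := by
  ext p
  have h0 := abs_pointPerm_eq_zero w x p
  have hp : p ∈ Finset.univ.map (zeroEmb n k) ↔ p.abs = 0 := by
    rcases p with z | j
    · have := z.2.1
      constructor
      · intro h
        obtain ⟨j, -, hj⟩ := Finset.mem_map.1 h
        exact absurd hj Sum.inr_ne_inl
      · intro h; simp only [Points.abs] at h; omega
    · exact iff_of_true (Finset.mem_map_of_mem _ (Finset.mem_univ j)) rfl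
  rw [hp, mem_window]
  rcases h with rfl | rfl <;> omega

theorem letters_comp_zeroEmb :
    letters (pointPerm w x) ∘ zeroEmb n k = zeroLetter ∘ x := rfl

theorem schensted_zeros : schensted (wordOn (letters (pointPerm w x))
    (Finset.univ.map (zeroEmb n k))) = (rsP x).map zeroLetter := by
  rw [wordOn_map zeroEmb_strictMono, letters_comp_zeroEmb, wordOn_comp,
    schensted_map zeroLetter_strictMono, rsP_eq]

theorem recording_zeros : recording (letters (pointPerm w x)) (Finset.univ.map (zeroEmb n k)) =
    (rsQ x).map (zeroEmb n k) := by
  rw [recording_map zeroEmb_strictMono, letters_comp_zeroEmb,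
    recording_comp zeroLetter_strictMono, rsQ_eq]

/-- The boundary condition of the growth diagram. Membership of `x` in the cell makes the constant
shape on both axes the core. -/
theorem windowShape_zeros {r : ℕ} {x : Equiv.Perm (Fin (coreSize r))} (hx : x ∈ cellZero r)
    {i m : ℕ} (h : i = 0 ∨ m = 0) :
    windowShape (pointPerm w x) i m = (staircase r : Set (ℕ × ℕ)) := by
  rw [windowShape, window_eq_zeros w x h, rsShape, schensted_zeros]
  ext c
  simp only [Filling.support, Set.mem_ofPred_eq, Filling.map_ne_bot]
  exact hx c

theorem windowShape_mono_left (i : Fin n) (m : ℕ) (hm : m ≤ n) :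
    windowShape (pointPerm w x) i m ⊆ windowShape (pointPerm w x) (i + 1) m := by
  rcases le_or_gt ((pointPerm w x).symm (.pos i)).abs m with h | h
  · obtain ⟨c, ⟨-, hc⟩ | ⟨-, hc⟩⟩ := (windowShape_dominoes w x i m).1 i.2 hm h <;>
    · rw [hc]
      exact (Set.subset_insert _ _).trans (Set.subset_insert _ _)
  · rw [windowShape, windowShape, window_succ_left_of_lt w x h]

end Core

theorem shapeUpTo_zero {κ : Finset (ℕ × ℕ)} {D : Dominoes} (h0 : D 0 = ∅) :
    shapeUpTo κ 0 D = κ := by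
  simp [shapeUpTo, h0]

theorem shapeUpTo_succ (κ : Finset (ℕ × ℕ)) (j : ℕ) (D : Dominoes) :
    shapeUpTo κ (j + 1) D = shapeUpTo κ j D ∪ D (j + 1) := by
  ext c
  simp only [shapeUpTo, Finset.mem_union, Finset.mem_biUnion, Finset.mem_range]
  constructor
  · rintro (h | ⟨i, hi, h⟩)
    · exact Or.inl (Or.inl h)
    · rcases Nat.lt_succ_iff_lt_or_eq.1 hi with hi | rfl
      · exact Or.inl (Or.inr ⟨i, hi, h⟩)
      · exact Or.inr h
  · rintro ((h | ⟨i, hi, h⟩) | h)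
    · exact Or.inl h
    · exact Or.inr ⟨i, by omega, h⟩
    · exact Or.inr ⟨j + 1, by omega, h⟩

/-- The shape of a domino tableau whose dominoes are the differences of a chain of shapes. -/
theorem coe_shapeUpTo {κ : Finset (ℕ × ℕ)} {D : Dominoes} {Λ : ℕ → Set (ℕ × ℕ)} (h0 : D 0 = ∅)
    (hκ : (κ : Set (ℕ × ℕ)) = Λ 0) {j : ℕ} (hΛ : ∀ i < j, Λ i ⊆ Λ (i + 1))
    (hD : ∀ i < j, (D (i + 1) : Set (ℕ × ℕ)) = Λ (i + 1) \ Λ i) :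
    (shapeUpTo κ j D : Set (ℕ × ℕ)) = Λ j := by
  induction j with
  | zero => rw [shapeUpTo_zero h0, hκ]
  | succ j ih =>
    rw [shapeUpTo_succ, Finset.coe_union, ih (fun i hi => hΛ i (by omega))
      (fun i hi => hD i (by omega)), hD j (by omega), Set.union_sdiff_cancel (hΛ j (by omega))]

/-! ### Domino insertion as growth of window shapes -/

section Main

variable {n r : ℕ} (w : W n) {x : Equiv.Perm (Fin (coreSize r))}

/-- The domino tableau `D` describes the shapes of the windows with positions up to `m`. -/
structure IsWindowTableau (x : Equiv.Perm (Fin (coreSize r))) (m : ℕ) (D : Dominoes) : Prop where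
  zero : D 0 = ∅
  succ : ∀ i < n, (D (i + 1) : Set (ℕ × ℕ)) =
    windowShape (pointPerm w x) (i + 1) m \ windowShape (pointPerm w x) i m

/-- Inserting the letter at position `m + 1` runs through the column of cells between the windows
for `m` and those for `m + 1`. The branches of the algorithm correspond to the types of cells, and
`μ` is the shape of the window already treated. -/
theorem insertUpTo_window (hx : x ∈ cellZero r) {D : Dominoes} (m : Fin n)
    (hD : IsWindowTableau w x m D) (j : ℕ) (hj : j ≤ n) :
    insertUpTo (staircase r) D (w.1 (posPoint m) : Signed n) j 0 = ∅ ∧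
    ∀ i < j, (insertUpTo (staircase r) D (w.1 (posPoint m) : Signed n) j (i + 1) :
      Set (ℕ × ℕ)) =
        windowShape (pointPerm w x) (i + 1) (m + 1) \ windowShape (pointPerm w x) i (m + 1) := by
  set z : ℤ := ((w.1 (posPoint m) : Signed n) : ℤ) with hz
  have hzabs : (pointPerm w x (.pos m)).abs = z.natAbs := rfl
  induction j with
  | zero => exact ⟨rfl, fun i hi => absurd hi (by omega)⟩
  | succ j ih =>
    obtain ⟨ih0, ih⟩ := ih (by omega)
    have hμ : (shapeUpTo (staircase r) j (insertUpTo (staircase r) D z j) : Set (ℕ × ℕ)) =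
        windowShape (pointPerm w x) j (m + 1) :=
      coe_shapeUpTo (Λ := fun i => windowShape (pointPerm w x) i (m + 1)) ih0
        (windowShape_zeros w hx (Or.inl rfl)).symm
        (fun i hi => windowShape_mono_left w x ⟨i, by omega⟩ (m + 1) m.2) ih
    refine ⟨by simp [insertUpTo, ih0], fun i hi => ?_⟩
    rcases Nat.lt_succ_iff_lt_or_eq.1 hi with hi | rfl
    · simp only [insertUpTo]
      rw [Function.update_of_ne (by omega)]
      exact ih i hi
    simp only [insertUpTo, Function.update_self]
    set μ := shapeUpTo (staircase r) i (insertUpTo (staircase r) D z i) with hμdef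
    have hsh : IsShape (windowShape (pointPerm w x) i (m + 1)) :=
      isShape_rsShape (letters_injective _) _
    have heq := abs_symm_eq_iff w x ⟨i, hj⟩ m
    simp only at heq
    split_ifs with h1 h2 h3
    -- Values below the inserted one: the new positions do not lie in these windows, so the domino
    -- stays.
    · rw [hD.succ i hj]
      simp only [windowShape]
      rw [window_succ_right_of_lt w x (by omega), window_succ_right_of_lt w x (by omega)]
    -- The cell containing the new pair, with equal signs: a horizontal domino in the first row. The
    -- opposite sign, treated next, gives the first column.
    · have hp : pointPerm w x (.pos m) = .pos ⟨i, hj⟩ :=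
        congrArg Sum.inl (Subtype.ext (by change z = (i : ℤ) + 1; omega))
      obtain ⟨y, hy, sy, e⟩ := windowShape_corner_pos w x hp
      have e0 : windowShape (pointPerm w x) i (m + 1) = windowShape (pointPerm w x) i m := by
        rw [windowShape, windowShape, window_succ_right_of_lt w x (by omega)]
      simp only at hy sy e
      rw [← e0, ← hμ] at hy sy e
      rw [← hμ] at hsh ⊢
      rw [horizontalAt_eq hsh sy (by simpa using hy), e]
      ext c
      have h5 : (0, y + 1) ∉ (μ : Set (ℕ × ℕ)) := fun h => hy (hsh _ _ _ _ h le_rfl (by omega))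
      simp only [Finset.coe_insert, Finset.coe_singleton, Set.mem_insert_iff,
        Set.mem_singleton_iff, Set.mem_sdiff]
      grind
    · have hp : pointPerm w x (.pos m) = .neg ⟨i, hj⟩ :=
        congrArg Sum.inl (Subtype.ext (by change z = -((i : ℤ) + 1); omega))
      obtain ⟨y, hy, sy, e⟩ := windowShape_corner_neg w x hp
      have e0 : windowShape (pointPerm w x) i (m + 1) = windowShape (pointPerm w x) i m := by
        rw [windowShape, windowShape, window_succ_right_of_lt w x (by omega)]
      simp only at hy sy e
      rw [← e0, ← hμ] at hy sy e
      rw [← hμ] at hsh ⊢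
      rw [verticalAt_eq hsh sy (by simpa using hy), e]
      ext c
      have h5 : (y + 1, 0) ∉ (μ : Set (ℕ × ℕ)) := fun h => hy (hsh _ _ _ _ h (by omega) le_rfl)
      simp only [Finset.coe_insert, Finset.coe_singleton, Set.mem_insert_iff,
        Set.mem_singleton_iff, Set.mem_sdiff]
      grind
    · have hle : (pointPerm w x (.pos m)).abs ≤ i := by omega
      -- If the value `i + 1` has been inserted before, the cell is a frame and `bump` applies.
      -- Otherwise the domino is empty before and after, and `bump` fixes the empty set.
      rcases le_or_gt ((pointPerm w x).symm (.pos ⟨i, hj⟩)).abs m with hm | hm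
      · obtain ⟨c, hc⟩ := (windowShape_dominoes w x i m).2 m.2 (by omega) hle
        obtain ⟨d, hd⟩ := (windowShape_dominoes w x i m).1 hj m.2.le hm
        exact (windowShape_frame w x (i := ⟨i, hj⟩) hle hm hc hd).2.2 μ _ hμ (hD.succ i hj)
      · have hd : D (i + 1) = ∅ := by
          rw [← Finset.coe_eq_empty, hD.succ i hj, windowShape, windowShape,
            window_succ_left_of_lt w x (i := ⟨i, hj⟩) hm, Set.sdiff_self]
        have hm' : (m : ℕ) + 1 < ((pointPerm w x).symm (.pos ⟨i, hj⟩)).abs := by omega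
        rw [hd, windowShape, windowShape, window_succ_left_of_lt w x (i := ⟨i, hj⟩) hm',
          Set.sdiff_self]
        simp [bump]

/-- Domino insertion computes the shapes of the windows. -/
theorem isWindowTableau_dominoInsertWord (hx : x ∈ cellZero r) (m : ℕ) (hm : m ≤ n) :
    IsWindowTableau w x m (dominoInsertWord (staircase r) ((oneLine w).take m)) := by
  induction m with
  | zero =>
    refine ⟨rfl, fun i hi => ?_⟩
    rw [windowShape_zeros w hx (Or.inr rfl), windowShape_zeros w hx (Or.inr rfl)]
    simp [dominoInsertWord]
  | succ m ih =>
    have h := ih (by omega)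
    have hlen : m < (oneLine w).length := by simp [oneLine]; omega
    have e : dominoInsertWord (staircase r) ((oneLine w).take (m + 1)) =
        dominoInsert (staircase r) (dominoInsertWord (staircase r) ((oneLine w).take m))
          (w.1 (posPoint ⟨m, hm⟩) : Signed n) := by
      rw [← List.take_concat_get' _ _ hlen]
      simp [dominoInsertWord, oneLine]
    rw [e]
    constructor
    · rfl
    · intro i hi
      exact (insertUpTo_window w hx ⟨m, hm⟩ h (i + 1) hi).2 i (by omega)

theorem coe_shapeUpTo_dominoInsertWord (hx : x ∈ cellZero r) {i m : ℕ} (hi : i ≤ n)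
    (hm : m ≤ n) :
    (shapeUpTo (staircase r) i (dominoInsertWord (staircase r) ((oneLine w).take m)) :
      Set (ℕ × ℕ)) = windowShape (pointPerm w x) i m := by
  have h := isWindowTableau_dominoInsertWord w hx m hm
  exact coe_shapeUpTo (Λ := fun i => windowShape (pointPerm w x) i m) h.zero
    (windowShape_zeros w hx (Or.inl rfl)).symm
    (fun i hj => windowShape_mono_left w x ⟨i, by omega⟩ m hm)
    (fun i hj => h.succ i (by omega))

theorem dominoP_zero (hx : x ∈ cellZero r) : dominoP r w 0 = ∅ := by
  have h := isWindowTableau_dominoInsertWord w hx n le_rfl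
  rw [List.take_of_length_le (by simp [oneLine])] at h
  exact h.zero

theorem dominoP_succ (hx : x ∈ cellZero r) {i : ℕ} (hi : i < n) :
    (dominoP r w (i + 1) : Set (ℕ × ℕ)) =
      windowShape (pointPerm w x) (i + 1) n \ windowShape (pointPerm w x) i n := by
  have h := isWindowTableau_dominoInsertWord w hx n le_rfl
  rw [List.take_of_length_le (by simp [oneLine])] at h
  exact h.succ i hi

theorem dominoQ_zero : dominoQ r w 0 = ∅ := by
  simp [dominoQ]

theorem dominoQ_succ (hx : x ∈ cellZero r) {m : ℕ} (hm : m < n) :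
    (dominoQ r w (m + 1) : Set (ℕ × ℕ)) =
      windowShape (pointPerm w x) n (m + 1) \ windowShape (pointPerm w x) n m := by
  rw [dominoQ, Finset.coe_sdiff, coe_shapeUpTo_dominoInsertWord w hx le_rfl (by omega),
    Nat.add_sub_cancel, coe_shapeUpTo_dominoInsertWord w hx le_rfl hm.le]

/-- Both truncations give the whole word. Needed because recording tableaux are compared as
functions on all of `ℕ`. -/
theorem dominoQ_of_lt {m : ℕ} (hm : n < m) : dominoQ r w m = ∅ := by
  rw [dominoQ, List.take_of_length_le (by simp [oneLine]; omega),
    List.take_of_length_le (by simp [oneLine]; omega), Finset.sdiff_self]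

end Main
/-! ### Conversion of all the barred letters -/

open Classical in
/-- The filling that agrees with `T` on `P` and with `G` outside of `P`. -/
noncomputable def overlay {γ : Type} (P : Set (ℕ × ℕ)) (T G : Filling γ) : Filling γ :=
  fun c => if c ∈ P then T c else G c

section Overlay

variable {γ : Type} {P : Set (ℕ × ℕ)}

theorem overlay_of_mem {T G : Filling γ} {c : ℕ × ℕ} (h : c ∈ P) : overlay P T G c = T c :=
  if_pos h

theorem overlay_of_notMem {T G : Filling γ} {c : ℕ × ℕ} (h : c ∉ P) : overlay P T G c = G c :=
  if_neg h

theorem overlay_insert {T G : Filling γ} {c d : ℕ × ℕ} (h : c ≠ d) :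
    overlay (insert d P) T G c = overlay P T G c := by
  by_cases hc : c ∈ P
  · rw [overlay_of_mem hc, overlay_of_mem (Set.mem_insert_of_mem _ hc)]
  · rw [overlay_of_notMem hc, overlay_of_notMem (by simp [h, hc])]

theorem overlay_update {T G : Filling γ} {c : ℕ × ℕ} (h : c ∈ P) (v : WithBot γ) :
    Function.update (overlay P T G) c v = overlay P (Function.update T c v) G := by
  ext d : 1
  by_cases hd : d ∈ P
  · simp only [Function.update_apply, overlay_of_mem hd]
  · have : d ≠ c := by rintro rfl; exact hd h
    rw [Function.update_of_ne this, overlay_of_notMem hd, overlay_of_notMem hd]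

variable [LinearOrder γ]

/-- Swaps only look and move up or left, so they never leave the shape `P`, and the letters not yet
converted outside play no role. -/
theorem swapStep_overlay (hP : IsShape P) {T G : Filling γ} {c : ℕ × ℕ} (h : c ∈ P) :
    swapStep (overlay P T G, c) = (overlay P (swapStep (T, c)).1 G, (swapStep (T, c)).2) := by
  have h1 : (c.1 - 1, c.2) ∈ P := hP _ _ _ _ h (by simp) le_rfl
  have h2 : (c.1, c.2 - 1) ∈ P := hP _ _ _ _ h le_rfl (by simp)
  have e1 : entryAbove (overlay P T G) c = entryAbove T c := by
    rcases c with ⟨_ | a, b⟩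
    · rfl
    · exact overlay_of_mem h1
  have e2 : entryLeft (overlay P T G) c = entryLeft T c := by
    rcases c with ⟨a, _ | b⟩
    · rfl
    · exact overlay_of_mem h2
  simp only [swapStep, e1, e2, overlay_of_mem h]
  split_ifs
  · rfl
  · rw [overlay_update h, overlay_update h1]
  · rw [overlay_update h, overlay_update h2]

theorem replaceAndSwap_overlay (hP : IsShape P) {T G : Filling γ} {c : ℕ × ℕ} (h : c ∈ P)
    (b : γ) : replaceAndSwap (overlay P T G) c b = overlay P (replaceAndSwap T c b) G := by
  have key : ∀ m (T : Filling γ) c, c ∈ P → swapStep^[m] (overlay P T G, c) =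
      (overlay P (swapStep^[m] (T, c)).1 G, (swapStep^[m] (T, c)).2) := by
    intro m
    induction m with
    | zero => intro T c _; rfl
    | succ m ih =>
      intro T c hc
      rw [Function.iterate_succ_apply, Function.iterate_succ_apply, swapStep_overlay hP hc]
      have hle := swapStep_snd_le T c
      rw [ih _ _ (hP _ _ _ _ hc hle.1 hle.2)]
  rw [replaceAndSwap, overlay_update h, key _ _ _ h]
  rfl

end Overlay

/-- Removes the choice from the definition, since the letter occurs in a single square. -/
theorem convertLetter_eq {γ : Type} [LinearOrder γ] {T : Filling γ} {a b : γ} {c : ℕ × ℕ}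
    (h : ∀ d, T d = (a : WithBot γ) ↔ d = c) : convertLetter T a b = replaceAndSwap T c b := by
  have hex : ∃ d, T d = (a : WithBot γ) := ⟨c, (h c).2 rfl⟩
  rw [convertLetter, dif_pos hex, (h _).1 hex.choose_spec]

/-- A chain of finite sets of points, each obtained from the previous one by adding a smallest
point with letter `-(i + 1)` and a largest point with letter `i + 1`, such that the shapes grow
by the dominoes of `D`. -/
structure DominoChain {ι β : Type} [DecidableEq ι] [LinearOrder β] (n : ℕ)
    (s : Finset ι → Set (ℕ × ℕ)) (g : ι → β) (lab : ι → Letter) (S : ℕ → Finset ι)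
    (D : Dominoes) : Prop where
  strictMono : ∀ p q, g p < g q → lab p < lab q
  ne_bar : ∀ p i, lab p ≠ .bar i
  zero : D 0 = ∅
  succ : ∀ i < n, (D (i + 1) : Set (ℕ × ℕ)) = s (S (i + 1)) \ s (S i)
  domino : ∀ i < n, ∃ c, AddDomino (s (S i)) c (s (S (i + 1)))
  points : ∀ i < n, ∃ b t, lab b = .num (-((i : ℤ) + 1)) ∧ lab t = .num ((i : ℤ) + 1) ∧
    S (i + 1) = insert b (insert t (S i)) ∧ Below g (insert t (S i)) b ∧
    Above g (insert b (S i)) t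

namespace DominoChain

variable {ι α β : Type} [DecidableEq ι] [LinearOrder α] [LinearOrder β] {n : ℕ}
  {s : Finset ι → Set (ℕ × ℕ)} {f : ι → α} {g : ι → β} {lab : ι → Letter} {S : ℕ → Finset ι}
  {D : Dominoes} {Y : Filling Letter}

theorem mono (h : DominoChain n s g lab S D) {i j : ℕ} (hij : i ≤ j) (hj : j ≤ n) :
    s (S i) ⊆ s (S j) := by
  induction j with
  | zero => obtain rfl : i = 0 := by omega
            rfl
  | succ j ih =>
    rcases hij.lt_or_eq with hij | rfl
    · refine (ih (by omega) (by omega)).trans ?_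
      obtain ⟨c, ⟨-, hc⟩ | ⟨-, hc⟩⟩ := h.domino j hj <;>
      · rw [hc]
        exact (Set.subset_insert _ _).trans (Set.subset_insert _ _)
    · rfl

theorem mem_iff (h : DominoChain n s g lab S D) {i : ℕ} (hi : i < n) (c : ℕ × ℕ) :
    c ∈ D (i + 1) ↔ c ∈ s (S (i + 1)) ∧ c ∉ s (S i) := by
  rw [← Finset.mem_coe, h.succ i hi]
  rfl

theorem eq_of_mem (h : DominoChain n s g lab S D) {i j : ℕ} (hi : i ≤ n) (hj : j ≤ n)
    {c : ℕ × ℕ} (hci : c ∈ D i) (hcj : c ∈ D j) : i = j := by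
  rcases i with _ | i
  · rw [h.zero] at hci; simp at hci
  rcases j with _ | j
  · rw [h.zero] at hcj; simp at hcj
  rw [h.mem_iff hi] at hci
  rw [h.mem_iff hj] at hcj
  rcases lt_trichotomy i j with hij | rfl | hij
  · exact absurd (h.mono hij (Nat.le_of_lt hj) hci.1) hcj.2
  · rfl
  · exact absurd (h.mono hij (Nat.le_of_lt hi) hcj.1) hci.2

theorem youngOfDomino_of_mem (h : DominoChain n s g lab S D) {i : ℕ} (hi : i ≤ n) {c : ℕ × ℕ}
    (hc : c ∈ D i) : youngOfDomino n Y D c =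
      if (c.1 + 1, c.2) ∈ D i ∨ (c.1, c.2 + 1) ∈ D i then (Letter.bar i : WithBot Letter)
      else (Letter.num i : WithBot Letter) := by
  rw [youngOfDomino]
  rcases hf : (List.range (n + 1)).find? (fun i => decide (c ∈ D i)) with _ | j
  · rw [List.find?_eq_none] at hf
    exact absurd (hf i (by simp; omega)) (by simpa using hc)
  · have h1 := List.find?_some hf
    have h2 := List.mem_of_find?_eq_some hf
    simp only [decide_eq_true_eq, List.mem_range] at h1 h2
    obtain rfl := h.eq_of_mem hi (by omega) hc h1
    rfl

theorem youngOfDomino_of_forall {c : ℕ × ℕ} (hc : ∀ i ≤ n, c ∉ D i) :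
    youngOfDomino n Y D c = Y c := by
  rw [youngOfDomino]
  rcases hf : (List.range (n + 1)).find? (fun i => decide (c ∈ D i)) with _ | j
  · rfl
  · have h1 := List.find?_some hf
    have h2 := List.mem_of_find?_eq_some hf
    simp only [decide_eq_true_eq, List.mem_range] at h1 h2
    exact absurd h1 (hc j (by omega))

/-- The barred letter occupies the square where the domino starts, which is the square that an
intermediate shape must add. -/
theorem exists_domino (h : DominoChain n s g lab S D) (hg : RowGrowth s g f) {i : ℕ}
    (hi : i < n) : ∃ c d, AddDomino (s (S i)) c (s (S (i + 1))) ∧ c ∉ s (S i) ∧ d ∉ s (S i) ∧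
      d ≠ c ∧ s (S (i + 1)) = insert d (insert c (s (S i))) ∧
      youngOfDomino n Y D c = (Letter.bar (i + 1) : WithBot Letter) ∧
      youngOfDomino n Y D d = (Letter.num ((i : ℤ) + 1) : WithBot Letter) := by
  obtain ⟨c, hc⟩ := h.domino i hi
  obtain ⟨h1, d, hd, h2, e⟩ := hc.mem_iff (hg.shape _)
  have hdc : d ≠ c := by rcases hd with rfl | rfl <;> simp [Prod.ext_iff]
  have hD : ∀ z, z ∈ D (i + 1) ↔ z = c ∨ z = d := by
    intro z
    rw [h.mem_iff hi, e]
    simp only [Set.mem_insert_iff]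
    grind
  refine ⟨c, d, hc, h1, h2, hdc, e, ?_, ?_⟩
  · rw [h.youngOfDomino_of_mem (i := i + 1) hi ((hD c).2 (Or.inl rfl)), if_pos]
    rw [hD, hD]
    rcases hd with rfl | rfl <;> simp
  · rw [h.youngOfDomino_of_mem (i := i + 1) hi ((hD d).2 (Or.inr rfl)), if_neg]
    · simp
    · rw [hD, hD]
      rcases hd with rfl | rfl <;> simp [Prod.ext_iff] <;> omega

/-- The conversion of the first barred letters. -/
theorem exists_negTableau (h : DominoChain n s g lab S D) (hg : RowGrowth s g f)
    (hY : IsTab s g lab (S 0) Y) (j : ℕ) (hj : j ≤ n) :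
    ∃ F, IsTab s g lab (S j) F ∧
      negTableau j (youngOfDomino n Y D) = overlay (s (S j)) F (youngOfDomino n Y D) := by
  have hbarY : ∀ c i, Y c ≠ (Letter.bar i : WithBot Letter) := by
    intro c i hc
    obtain ⟨p, -, e⟩ := hY.exists_of_eq hc
    exact h.ne_bar p i e.symm
  induction j with
  | zero =>
    refine ⟨Y, hY, ?_⟩
    ext c : 1
    by_cases hc : c ∈ s (S 0)
    · rw [overlay_of_mem hc]
      refine youngOfDomino_of_forall fun i hi hci => ?_
      rcases i with _ | i
      · rw [h.zero] at hci; simp at hci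
      · rw [h.mem_iff hi] at hci
        exact hci.2 (h.mono (Nat.zero_le _) (by omega) hc)
    · rw [overlay_of_notMem hc]; rfl
  | succ j ih =>
    obtain ⟨F, hF, e⟩ := ih (by omega)
    obtain ⟨c, d, had, hc, hd, hdc, hs, ec, ed⟩ := h.exists_domino (Y := Y) hg hj
    obtain ⟨b, t, hb, ht, hS, hBb, hAt⟩ := h.points j hj
    have hBb' : Below g (S j) b := hBb.mono (Finset.subset_insert _ _)
    have hS' : S (j + 1) = insert t (insert b (S j)) := by rw [hS, Finset.insert_comm]
    obtain ⟨u, hu, eu⟩ := hg.box_below (S j) b hBb'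
    obtain ⟨v, hv, ev⟩ := hg.box_above (insert b (S j)) t hAt
    rw [← hS'] at ev
    -- The smallest point `b` alone adds the starting square of the domino, so the square of the
    -- barred letter is where `IsTab.convert` has to begin.
    obtain rfl := had.eq_of_between (hg.shape _) hu eu ev
    have hvd : v = d := by
      rw [hs, eu] at ev
      rw [eu] at hv
      exact eq_of_mem_insert ev.symm (Set.mem_insert _ _) hv
    subst hvd
    have hF' := hF.convert hg h.strictMono hBb' hc eu
    have huniq : ∀ z, negTableau j (youngOfDomino n Y D) z =
        (Letter.bar (j + 1) : WithBot Letter) ↔ z = u := by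
      intro z
      rw [e]
      constructor
      · intro hz
        by_cases hzj : z ∈ s (S j)
        · rw [overlay_of_mem hzj] at hz
          obtain ⟨p, -, e⟩ := hF.exists_of_eq hz
          exact absurd e.symm (h.ne_bar p _)
        · rw [overlay_of_notMem hzj] at hz
          by_cases hall : ∀ i ≤ n, z ∉ D i
          · rw [youngOfDomino_of_forall hall] at hz
            exact absurd hz (hbarY z _)
          · push Not at hall
            obtain ⟨i, hi, hzi⟩ := hall
            have hij : i = j + 1 := by
              rw [h.youngOfDomino_of_mem hi hzi] at hz
              split_ifs at hz
              · have := WithBot.coe_injective hz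
                injection this
              · have := WithBot.coe_injective hz
                cases this
            subst hij
            rw [h.mem_iff hj, hs] at hzi
            rcases hzi.1 with rfl | rfl | hz'
            · rw [ed] at hz
              have := WithBot.coe_injective hz
              cases this
            · rfl
            · exact absurd hz' hzj
      · rintro rfl
        rw [overlay_of_notMem hc, ec]
    have hfin := IsTab.step t v hF' hAt hv (by rw [← hS', ev])
    rw [← hS'] at hfin
    refine ⟨_, hfin, ?_⟩
    have e1 : negTableau (j + 1) (youngOfDomino n Y D) =
        replaceAndSwap (negTableau j (youngOfDomino n Y D)) u (lab b) := by
      rw [negTableau, convertLetter_eq huniq, hb]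
    -- The square `u` may be counted as part of the converted region, since its entry is overwritten
    -- at once.
    have e2 : replaceAndSwap (overlay (s (S j)) F (youngOfDomino n Y D)) u (lab b) =
        replaceAndSwap (overlay (s (insert b (S j))) F (youngOfDomino n Y D)) u (lab b) := by
      have : Function.update (overlay (s (S j)) F (youngOfDomino n Y D)) u
          (lab b : WithBot Letter) = Function.update (overlay (s (insert b (S j))) F
            (youngOfDomino n Y D)) u (lab b : WithBot Letter) := by
        ext z : 1
        by_cases hz : z = u
        · subst hz; rw [Function.update_self, Function.update_self]
        · rw [Function.update_of_ne hz, Function.update_of_ne hz, eu]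
          rw [overlay_insert hz]
      rw [replaceAndSwap, replaceAndSwap, this]
    have hu' : u ∈ s (insert b (S j)) := by rw [eu]; exact Set.mem_insert _ _
    rw [e1, e, e2, replaceAndSwap_overlay (hg.shape _) hu', ev]
    -- The second square of the domino already carries the letter of `t`, so it joins the converted
    -- region without change.
    ext z : 1
    by_cases hz : z = v
    · subst hz
      rw [overlay_of_notMem hv, overlay_of_mem (Set.mem_insert _ _), Function.update_self, ed, ht]
    · rw [overlay_insert hz]
      by_cases hzP : z ∈ s (insert b (S j))
      · rw [overlay_of_mem hzP, overlay_of_mem hzP, Function.update_of_ne hz]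
      · rw [overlay_of_notMem hzP, overlay_of_notMem hzP]

theorem isTab_negTableau (h : DominoChain n s g lab S D) (hg : RowGrowth s g f)
    (hY : IsTab s g lab (S 0) Y) :
    IsTab s g lab (S n) (negTableau n (youngOfDomino n Y D)) := by
  obtain ⟨F, hF, e⟩ := h.exists_negTableau hg hY n le_rfl
  convert hF using 1
  rw [e]
  ext c : 1
  by_cases hc : c ∈ s (S n)
  · rw [overlay_of_mem hc]
  · rw [overlay_of_notMem hc, hF.eq_bot hg.empty hc, youngOfDomino_of_forall]
    · exact hY.eq_bot hg.empty fun h0 => hc (h.mono (Nat.zero_le _) le_rfl h0)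
    · intro i hi hci
      rcases i with _ | i
      · rw [h.zero] at hci; simp at hci
      · rw [h.mem_iff hi] at hci
        exact hc (h.mono hi le_rfl hci.1)

end DominoChain
/-! ### The main theorem -/

section Final

variable {n r : ℕ} (w : W n) {x : Equiv.Perm (Fin (coreSize r))}

theorem Points.letter_ne_bar {k : ℕ} (p : Points n k) (i : ℕ) : p.letter ≠ .bar i := by
  rcases p with z | j <;> exact fun h => by cases h

/-- Here points are ordered by value, so the growth to be used with this chain is the inverse one;
for the recording tableau it is the direct one. -/
theorem dominoChain_dominoP (hx : x ∈ cellZero r) :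
    DominoChain n (rsShape (letters (pointPerm w x))) (letters (pointPerm w x))
      (letters (pointPerm w x)) (fun i => window (pointPerm w x) i n) (dominoP r w) where
  strictMono _ _ h := h
  ne_bar _ i := Points.letter_ne_bar _ i
  zero := dominoP_zero w hx
  succ i hi := dominoP_succ w hx hi
  domino i hi := (windowShape_dominoes w x i n).1 hi le_rfl (Points.abs_le _)
  points i hi := by
    have e1 : pointPerm w x ((pointPerm w x).symm (.neg ⟨i, hi⟩)) = .neg ⟨i, hi⟩ :=
      Equiv.apply_symm_apply _ _
    have e2 : pointPerm w x ((pointPerm w x).symm (.pos ⟨i, hi⟩)) = .pos ⟨i, hi⟩ :=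
      Equiv.apply_symm_apply _ _
    refine ⟨(pointPerm w x).symm (.neg ⟨i, hi⟩), (pointPerm w x).symm (.pos ⟨i, hi⟩), ?_, ?_,
      window_succ_left w x (i := ⟨i, hi⟩) (Points.abs_le _), ?_, ?_⟩
    · rw [letters, e1]; rfl
    · rw [letters, e2]; rfl
    · intro z hz
      change pointPerm w x _ < pointPerm w x z
      rw [e1]
      rcases Finset.mem_insert.1 hz with rfl | hz
      · rw [e2]; exact Points.neg_lt_pos _
      · exact Points.neg_lt (mem_window.1 hz).2
    · intro z hz
      change pointPerm w x z < pointPerm w x _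
      rw [e2]
      rcases Finset.mem_insert.1 hz with rfl | hz
      · rw [e1]; exact Points.neg_lt_pos _
      · exact Points.lt_pos (mem_window.1 hz).2

theorem window_succ_right_full {k : ℕ} (x : Equiv.Perm (Fin k)) (i : Fin n) :
    window (pointPerm w x) n (i + 1) =
        insert (.neg i) (insert (.pos i) (window (pointPerm w x) n i)) ∧
      Below id (insert (.pos i) (window (pointPerm w x) n i)) (.neg i) ∧
      Above id (insert (.neg i) (window (pointPerm w x) n i)) (.pos i) := by
  refine ⟨window_succ_right w x (Points.abs_le _), ?_, ?_⟩
  · intro z hz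
    rcases Finset.mem_insert.1 hz with rfl | hz
    · exact Points.neg_lt_pos _
    · exact Points.neg_lt (mem_window.1 hz).1
  · intro z hz
    rcases Finset.mem_insert.1 hz with rfl | hz
    · exact Points.neg_lt_pos _
    · exact Points.lt_pos (mem_window.1 hz).1

theorem dominoChain_dominoQ (hx : x ∈ cellZero r) :
    DominoChain n (rsShape (letters (pointPerm w x))) id Points.letter
      (fun i => window (pointPerm w x) n i) (dominoQ r w) where
  strictMono _ _ h := h
  ne_bar p i := p.letter_ne_bar i
  zero := dominoQ_zero w
  succ i hi := dominoQ_succ w hx hi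
  domino i hi := (windowShape_dominoes w x n i).2 hi le_rfl (Points.abs_le _)
  points i hi :=
    ⟨.neg ⟨i, hi⟩, .pos ⟨i, hi⟩, rfl, rfl, window_succ_right_full w x ⟨i, hi⟩⟩

theorem window_full {k : ℕ} (x : Equiv.Perm (Fin k)) :
    window (pointPerm w x) n n = Finset.univ := by
  ext p
  simp [mem_window, Points.abs_le]

theorem negTableau_dominoP (hx : x ∈ cellZero r) :
    negTableau n (youngOfDomino n ((rsP x).map zeroLetter) (dominoP r w)) =
      (rsP (pointPerm w x)).map Points.letter := by
  have hinj := letters_injective (pointPerm w x)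
  have h0 := isTab_schensted hinj (window (pointPerm w x) 0 n)
  rw [window_eq_zeros w x (Or.inl rfl), schensted_zeros,
    ← window_eq_zeros w x (i := 0) (m := n) (Or.inl rfl)] at h0
  have h1 := (dominoChain_dominoP w hx).isTab_negTableau (rowGrowth_letters _).inverse h0
  have h2 := isTab_schensted hinj (window (pointPerm w x) n n)
  rw [h1.unique h2, window_full, rsP_eq, ← schensted_map Points.letter_strictMono, ← wordOn_comp]
  rfl

theorem isTab_rsQ : IsTab (rsShape (letters (pointPerm w x))) id Points.letter Finset.univ
    ((rsQ (pointPerm w x)).map Points.letter) := by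
  have h := isTab_recording (letters_injective (pointPerm w x)) Points.letter Finset.univ
  have e : recording (letters (pointPerm w x)) Finset.univ = rsQ (pointPerm w x) := by
    rw [rsQ_eq]
    exact recording_comp Points.letter_strictMono _ _
  rwa [e] at h

theorem negTableau_dominoQ (hx : x ∈ cellZero r) :
    negTableau n (youngOfDomino n ((rsQ x).map zeroLetter) (dominoQ r w)) =
      (rsQ (pointPerm w x)).map Points.letter := by
  have hinj := letters_injective (pointPerm w x)
  have h0 := isTab_recording hinj Points.letter (window (pointPerm w x) n 0)
  have e : ((rsQ x).map (zeroEmb n (coreSize r))).map Points.letter =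
      (rsQ x).map zeroLetter := by
    ext c : 1
    simp only [Filling.map, WithBot.map_map]
    rfl
  rw [window_eq_zeros w x (Or.inr rfl), recording_zeros, e,
    ← window_eq_zeros w x (i := n) (m := 0) (Or.inr rfl)] at h0
  have h1 := (dominoChain_dominoQ w hx).isTab_negTableau (rowGrowth_letters _) h0
  rw [window_full] at h1
  exact h1.unique (isTab_rsQ w)

theorem Filling.map_injective {α β : Type} {φ : α → β} (hφ : Function.Injective φ) :
    Function.Injective (Filling.map φ) := by
  intro F G h
  ext c : 1
  exact WithBot.map_injective hφ (congrFun h c)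

/-- The recording tableau determines the shapes of the windows of full height. -/
theorem windowShape_eq_of_rsQ_eq (w' : W n)
    (h : rsQ (pointPerm w x) = rsQ (pointPerm w' x)) (m : ℕ) (hm : m ≤ n) :
    windowShape (pointPerm w x) n m = windowShape (pointPerm w' x) n m := by
  -- At full height a window only restricts positions, so the two growths can be compared on the
  -- same sets of points.
  have hw : ∀ m, window (pointPerm w x) n m = window (pointPerm w' x) n m := by
    intro m
    ext p
    simp [mem_window, Points.abs_le]
  have hlab : ∀ p q : Points n (coreSize r), id p < id q → p.letter ≠ q.letter :=
    fun p q hpq e => hpq.ne (Points.letter_injective e)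
  have g := rowGrowth_letters (pointPerm w x)
  have g' := rowGrowth_letters (pointPerm w' x)
  -- Descending from the full set: stripping `-(m + 1)` undoes a slide, and stripping `m + 1`
  -- removes the largest entry.
  have key : ∀ d m, m + d = n → ∃ F,
      IsTab (rsShape (letters (pointPerm w x))) id Points.letter (window (pointPerm w x) n m) F ∧
      IsTab (rsShape (letters (pointPerm w' x))) id Points.letter
        (window (pointPerm w x) n m) F := by
    intro d
    induction d with
    | zero =>
      intro m hmn
      have h1 := isTab_rsQ w (x := x)
      have h2 := isTab_rsQ w' (x := x)
      rw [← h] at h2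
      rw [show m = n by omega, window_full]
      exact ⟨_, h1, h2⟩
    | succ d ih =>
      intro m hmd
      obtain ⟨F, h1, h2⟩ := ih (m + 1) (by omega)
      obtain ⟨e, hb, ha⟩ := window_succ_right_full w x ⟨m, by omega⟩
      simp only at e hb ha
      rw [e] at h1 h2
      obtain ⟨F1, k1, k2⟩ := h1.common_of_insert g g' hlab hb h2
      obtain ⟨F2, -, l1, l2, -⟩ := k1.common_of_insert_above g.empty g'.empty hlab
        (ha.mono (Finset.subset_insert _ _)) k2
      exact ⟨F2, l1, l2⟩
  obtain ⟨F, h1, h2⟩ := key (n - m) m (by omega)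
  rw [windowShape, windowShape, ← hw, ← h1.support_eq g.empty, h2.support_eq g'.empty]

/-- One direction is the identity for recording tableaux, whose left side depends on `w` only
through its domino tableau. The other recovers each domino as a difference of window shapes. -/
theorem dominoEquiv_iff (hx : x ∈ cellZero r) (w' : W n) :
    DominoEquiv r w w' ↔ RSEquiv (pointPerm w x) (pointPerm w' x) := by
  constructor
  · intro h
    refine Filling.map_injective Points.letter_injective ?_
    rw [← negTableau_dominoQ w hx, ← negTableau_dominoQ w' hx,
      show dominoQ r w = dominoQ r w' from h]
  · intro h
    have hs := windowShape_eq_of_rsQ_eq w w' (x := x) h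
    funext m
    rcases m with _ | m
    · rw [dominoQ_zero, dominoQ_zero]
    rcases lt_or_ge m n with hm | hm
    · rw [← Finset.coe_inj, dominoQ_succ w hx hm, dominoQ_succ w' hx hm, hs _ hm, hs _ hm.le]
    · rw [dominoQ_of_lt w (by omega), dominoQ_of_lt w' (by omega)]

end Final
end DominoInsertion

theorem mainTheorem5 (n r : ℕ) (x : Equiv.Perm (Fin (DominoInsertion.coreSize r)))
    (hx : x ∈ DominoInsertion.cellZero r) :
    (∀ w : DominoInsertion.W n,
      DominoInsertion.negTableau n
          (DominoInsertion.youngOfDomino n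
            ((DominoInsertion.rsP x).map DominoInsertion.zeroLetter)
            (DominoInsertion.dominoP r w)) =
        (DominoInsertion.rsP (DominoInsertion.iota r w * DominoInsertion.inclI n x)).map
          DominoInsertion.Points.letter ∧
      DominoInsertion.negTableau n
          (DominoInsertion.youngOfDomino n
            ((DominoInsertion.rsQ x).map DominoInsertion.zeroLetter)
            (DominoInsertion.dominoQ r w)) =
        (DominoInsertion.rsQ (DominoInsertion.iota r w * DominoInsertion.inclI n x)).map
          DominoInsertion.Points.letter) ∧
    (∀ w w' : DominoInsertion.W n,
      DominoInsertion.DominoEquiv r w w' ↔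
        DominoInsertion.RSEquiv (DominoInsertion.iota r w * DominoInsertion.inclI n x)
          (DominoInsertion.iota r w' * DominoInsertion.inclI n x)) := by
  simp only [DominoInsertion.iota_mul_inclI]
  exact ⟨fun w => ⟨DominoInsertion.negTableau_dominoP w hx,
    DominoInsertion.negTableau_dominoQ w hx⟩,
    fun w w' => DominoInsertion.dominoEquiv_iff w hx w'⟩
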